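/- Let $d\ge 1$, $\mu>0$, and let $U,W:\mathbb{R}^d\to\mathbb{R}$ be measurable. On $L^2(\mathbb{R}^d,\mathbb{C}^2)$ put $$\mathcal{H}_0=\begin{pmatrix}-\Delta+\mu&0\\0&\Delta-\mu\end{pmatrix},\qquad V=\begin{pmatrix}U&W\\-W&-U\end{pmatrix},\qquad \mathcal{H}=\mathcal{H}_0+V,$$ where $\mathcal{H}_0$ has domain $H^2(\mathbb{R}^d,\mathbb{C}^2)$ and $V$ is the maximal multiplication operator. A function $X:\mathbb{R}^d\to\mathbb{R}$ is called relatively Laplacian-compact if $Xg\in L^2(\mathbb{R}^d)$ for all $g\in H^2(\mathbb{R}^d)$ and, for every sequence $(g_n)$ in $H^2(\mathbb{R}^d)$ with $(g_n)$ and $(\Delta g_n)$ bounded in $L^2$, the sequence $(Xg_n)$ has a subsequence that converges in $L^2$. For a densely defined operator $T$ on a Hilbert space let $\rho(T)$ be the set of $z\in\mathbb{C}$ such that $T-z$ has an everywhere defined bounded inverse, and $\sigma(T)=\mathbb{C}\setminus\rho(T)$. A closed operator is semi-Fredholm if its range is closed and its kernel or the orthogonal complement of its range is finite-dimensional; it is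 Fredholm if its range is closed and both are finite-dimensional, and its index is then the difference of the two dimensions. Let $\Delta_1(T)=\{z: T-z \text{ semi-Fredholm}\}$, $\Delta_2(T)=\{z\in\Delta_1(T): \dim\ker(T-z)<\infty\}$, $\Delta_3(T)=\{z: T-z\text{ Fredholm}\}$, $\Delta_4(T)=\{z\in\Delta_3(T): \operatorname{ind}(T-z)=0\}$, $\Delta_5(T)=\{z\in\Delta_4(T): \text{a deleted neighbourhood of } z \text{ lies in }\rho(T)\}$, and $\sigma_{\mathrm{ess},j}(T)=\mathbb{C}\setminus\Delta_j(T)$. (a) Let $X:\mathbb{R}^d\to\mathbb{R}$ be measurable and $-\Delta$-bounded with relative bound zero (that is, $Xg\in L^2$ for all $g\in H^2(\mathbb{R}^d)$, and for every $\varepsilon>0$ there is $C_\varepsilon$ with $\|Xg\|_2\le\varepsilon\|\Delta g\|_2+C_\varepsilon\|g\|_2$ for all $g\in H^2(\mathbb{R}^d)$), and suppose that $X(x)\to0$ as $|x|\to\infty$ (outside a null set). Then $X$ is relatively Laplacian-compact. (b) Suppose that $U$ and $W$ are relatively Laplacian-compact. Then $$\sigma_{\mathrm{ess},j}(\mathcal{H})=\sigma(\mathcal{H}_0)=(-\infty,-\mu]\cup[\mu,\infty)\qquad(j=1,\dots,5).$$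 The set $\sigma(\mathcal{H})\setminus\big((-\infty,-\mu]\cup[\mu,\infty)\big)$ is discrete, with no accumulation point outside $(-\infty,-\mu]\cup[\mu,\infty)$, and each of its points is an eigenvalue of $\mathcal{H}$ of finite algebraic multiplicity: its Riesz projection has finite rank and its generalized eigenspace $\bigcup_k\ker(\mathcal{H}-z)^k$ is finite-dimensional. Moreover $\sigma(\mathcal{H})$ is symmetric under reflection in the real and in the imaginary axis; $\sigma(\mathcal{H})=-\sigma(\mathcal{H})$ and $\sigma(\mathcal{H}^*)=\sigma(\mathcal{H})$. -/

import Mathlib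

/-! ### Unbounded operators: spectrum, Fredholm properties, algebraic multiplicity -/

namespace UnboundedOp

open Filter Topology

noncomputable section

variable {H : Type*} [NormedAddCommGroup H] [InnerProductSpace ℂ H]

/-- The operator `T - z`, on the domain of `T`. -/
def shift (T : H →ₗ.[ℂ] H) (z : ℂ) : H →ₗ.[ℂ] H where
  domain := T.domain
  toFun := T.toFun - z • T.domain.subtype

/-- `B` is an everywhere defined bounded two-sided inverse of `T`. -/
def IsBoundedInverse (T : H →ₗ.[ℂ] H) (B : H →L[ℂ] H) : Prop :=
  (∀ x : H, ∃ h : B x ∈ T.domain, T ⟨B x, h⟩ = x) ∧ ∀ u : T.domain, B (T u) = u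

/-- The resolvent set: all `z` such that `T - z` is boundedly invertible. -/
def resolventSet (T : H →ₗ.[ℂ] H) : Set ℂ :=
  {z | ∃ B : H →L[ℂ] H, IsBoundedInverse (shift T z) B}

/-- The spectrum, the complement of the resolvent set. -/
def spectrum (T : H →ₗ.[ℂ] H) : Set ℂ := (resolventSet T)ᶜ

/-- The kernel of `T`. -/
def kernel (T : H →ₗ.[ℂ] H) : Submodule ℂ T.domain := LinearMap.ker T.toFun

/-- The range of `T`. -/
def range (T : H →ₗ.[ℂ] H) : Submodule ℂ H := LinearMap.range T.toFun

/-- A closed operator is semi-Fredholm if its range is closed and its kernel or its co-kernel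
(the orthogonal complement of the range) is finite-dimensional. -/
def IsSemiFredholm (T : H →ₗ.[ℂ] H) : Prop :=
  T.IsClosed ∧ IsClosed (range T : Set H) ∧
    (FiniteDimensional ℂ (kernel T) ∨ FiniteDimensional ℂ (range T)ᗮ)

/-- A closed operator is Fredholm if its range is closed and both its kernel and its co-kernel
are finite-dimensional. -/
def IsFredholm (T : H →ₗ.[ℂ] H) : Prop :=
  T.IsClosed ∧ IsClosed (range T : Set H) ∧
    FiniteDimensional ℂ (kernel T) ∧ FiniteDimensional ℂ (range T)ᗮ

/-- The index `dim ker T - dim (ran T)ᗮ`; only used for Fredholm operators. -/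
def index (T : H →ₗ.[ℂ] H) : ℤ :=
  (Module.finrank ℂ (kernel T) : ℤ) - (Module.finrank ℂ (range T)ᗮ : ℤ)

def Delta1 (T : H →ₗ.[ℂ] H) : Set ℂ := {z | IsSemiFredholm (shift T z)}

def Delta2 (T : H →ₗ.[ℂ] H) : Set ℂ :=
  {z | IsSemiFredholm (shift T z) ∧ FiniteDimensional ℂ (kernel (shift T z))}

def Delta3 (T : H →ₗ.[ℂ] H) : Set ℂ := {z | IsFredholm (shift T z)}

def Delta4 (T : H →ₗ.[ℂ] H) : Set ℂ := {z | IsFredholm (shift T z) ∧ index (shift T z) = 0}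

/-- The points of `Delta4 T` with a deleted neighbourhood contained in the resolvent set. -/
def Delta5 (T : H →ₗ.[ℂ] H) : Set ℂ := {z | z ∈ Delta4 T ∧ ∀ᶠ w in 𝓝[≠] z, w ∈ resolventSet T}

/-- The five essential spectra; the index `j : Fin 5` stands for the `(j + 1)`-st one. -/
def essentialSpectrum (T : H →ₗ.[ℂ] H) (j : Fin 5) : Set ℂ :=
  (![Delta1 T, Delta2 T, Delta3 T, Delta4 T, Delta5 T] j)ᶜ

/-- `z` is an eigenvalue of `T`. -/
def IsEigenvalue (T : H →ₗ.[ℂ] H) (z : ℂ) : Prop :=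
  ∃ u : T.domain, u ≠ 0 ∧ T u = z • (u : H)

/-- The kernel of `T ^ k`, where `D(T ^ (k + 1)) = {x ∈ D(T) | T x ∈ D(T ^ k)}`. -/
def kernelPow (T : H →ₗ.[ℂ] H) : ℕ → Submodule ℂ H
  | 0 => ⊥
  | k + 1 => ((kernelPow T k).comap T.toFun).map T.domain.subtype

/-- The generalized eigenspace `⋃ₖ ker (T - z) ^ k` (an increasing union). -/
def generalizedEigenspace (T : H →ₗ.[ℂ] H) (z : ℂ) : Submodule ℂ H :=
  ⨆ k, kernelPow (shift T z) k

open Classical in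
/-- The resolvent `(T - z)⁻¹` (zero if `z` is not in the resolvent set). -/
def resolvent (T : H →ₗ.[ℂ] H) (z : ℂ) : H →L[ℂ] H :=
  if h : z ∈ resolventSet T then h.choose else 0

/-- The Riesz projection `-(2πi)⁻¹ ∮ (T - w)⁻¹ dw` over the circle of radius `r` around `z`. -/
def rieszProjection (T : H →ₗ.[ℂ] H) (z : ℂ) (r : ℝ) : H →L[ℂ] H :=
  (-(2 * (Real.pi : ℂ) * Complex.I)⁻¹) • ∮ w in C(z, r), resolvent T w

/-- Finite algebraic multiplicity of an isolated point `z` of the spectrum: the Riesz projection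
at `z` has finite rank. Finite-dimensionality of the generalized eigenspace, which is the other
usual meaning of the term, is required as well. -/
def HasFiniteAlgebraicMultiplicity (T : H →ₗ.[ℂ] H) (z : ℂ) : Prop :=
  (∃ r : ℝ, 0 < r ∧ Metric.closedBall z r \ {z} ⊆ resolventSet T ∧
      FiniteDimensional ℂ (LinearMap.range (rieszProjection T z r).toLinearMap)) ∧
    FiniteDimensional ℂ (generalizedEigenspace T z)

/-- `A` is `T`-bounded with relative bound zero. -/
def IsRelativelyBoundedZero (A T : H →ₗ.[ℂ] H) : Prop :=
  ∃ h : T.domain ≤ A.domain, ∀ ε : ℝ, 0 < ε → ∃ C : ℝ, ∀ u : T.domain,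
    ‖A (Submodule.inclusion h u)‖ ≤ ε * ‖T u‖ + C * ‖(u : H)‖

/-- `A` is `T`-compact: `D(T) ⊆ D(A)`, and if `uₙ` and `T uₙ` are bounded sequences, then `A uₙ`
has a convergent subsequence. -/
def IsRelativelyCompact (A T : H →ₗ.[ℂ] H) : Prop :=
  ∃ h : T.domain ≤ A.domain, ∀ u : ℕ → T.domain,
    (∃ C : ℝ, ∀ n, ‖(u n : H)‖ ≤ C ∧ ‖T (u n)‖ ≤ C) →
    ∃ (y : H) (φ : ℕ → ℕ), StrictMono φ ∧
      Tendsto (fun n => A (Submodule.inclusion h (u (φ n)))) atTop (𝓝 y)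

end

end UnboundedOp

/-! ### The matrix Schrödinger operator -/

namespace MatrixSchrodinger

open MeasureTheory Filter Topology TemperedDistribution
open scoped SchwartzMap Laplacian ENNReal

noncomputable section

/-- `ℝ^d` with its Euclidean structure. -/
abbrev Space (d : ℕ) : Type := EuclideanSpace ℝ (Fin d)

/-- `L²(ℝ^d, F)`. -/
abbrev L2 (d : ℕ) (F : Type*) [NormedAddCommGroup F] : Type _ :=
  Lp F 2 (volume : Measure (Space d))

/-- `ℂ²` with its Hermitian structure. -/
abbrev C2 : Type := EuclideanSpace ℂ (Fin 2)

section

variable (d : ℕ) (F : Type*) [NormedAddCommGroup F] [InnerProductSpace ℂ F] [CompleteSpace F]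

/-- The embedding of `L²` into the tempered distributions. -/
def toDistr : L2 d F →L[ℂ] 𝓢'(Space d, F) := Lp.toTemperedDistributionCLM F volume 2

theorem toDistr_injective : Function.Injective (toDistr d F) :=
  LinearMap.ker_eq_bot.mp (Lp.ker_toTemperedDistributionCLM_eq_bot (F := F) (p := 2)
    (μ := (volume : Measure (Space d))))

/-- The Sobolev space `H²(ℝ^d, F)` as a subspace of `L²(ℝ^d, F)`. -/
def sobolevH2 : Submodule ℂ (L2 d F) where
  carrier := {f | MemSobolev 2 2 (toDistr d F f)}
  add_mem' hf hg := by
    simp only [Set.mem_ofPred_eq, map_add]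
    exact MemSobolev.add hf hg
  zero_mem' := by
    simp only [Set.mem_ofPred_eq, map_zero]
    exact memSobolev_fun_zero _ _ _ _
  smul_mem' c f hf := by
    simp only [Set.mem_ofPred_eq, map_smul]
    exact MemSobolev.smul c hf

theorem exists_laplacian (f : sobolevH2 d F) :
    ∃ g : L2 d F, toDistr d F g = Δ (toDistr d F (f : L2 d F)) := by
  have h : MemSobolev (2 - 2) 2 (Δ (toDistr d F (f : L2 d F))) := MemSobolev.laplacian f.2
  rw [sub_self, memSobolev_zero_iff] at h
  obtain ⟨g, hg⟩ := h
  exact ⟨g, hg.symm⟩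

/-- The Laplacian `Δ` on `L²(ℝ^d, F)` with domain `H²(ℝ^d, F)`: the function `Δ f` is the element
of `L²` that represents the distributional Laplacian of `f`. -/
def laplacian : L2 d F →ₗ.[ℂ] L2 d F where
  domain := sobolevH2 d F
  toFun :=
    { toFun := fun f => (exists_laplacian d F f).choose
      map_add' := fun f g => by
        apply toDistr_injective d F
        rw [map_add, (exists_laplacian d F (f + g)).choose_spec,
          (exists_laplacian d F f).choose_spec, (exists_laplacian d F g).choose_spec]
        simp only [Submodule.coe_add, map_add, ← TemperedDistribution.laplacianCLM_apply]
      map_smul' := fun c f => by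
        apply toDistr_injective d F
        rw [map_smul, (exists_laplacian d F (c • f)).choose_spec,
          (exists_laplacian d F f).choose_spec]
        simp only [Submodule.coe_smul, map_smul, RingHom.id_apply, ← TemperedDistribution.laplacianCLM_apply] }

end

section

variable {d : ℕ} {F : Type*} [NormedAddCommGroup F] [InnerProductSpace ℂ F]

theorem multiplication_add (A : Space d → F →L[ℂ] F) (f g : L2 d F) :
    (fun x => A x (f x)) + (fun x => A x (g x)) =ᵐ[volume] fun x => A x ((f + g : L2 d F) x) := by
  filter_upwards [Lp.coeFn_add f g] with x hx
  rw [hx, Pi.add_apply, Pi.add_apply, map_add]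

theorem multiplication_smul (A : Space d → F →L[ℂ] F) (c : ℂ) (f : L2 d F) :
    c • (fun x => A x (f x)) =ᵐ[volume] fun x => A x ((c • f : L2 d F) x) := by
  filter_upwards [Lp.coeFn_smul c f] with x hx
  rw [hx, Pi.smul_apply, Pi.smul_apply, map_smul]

theorem multiplication_zero (A : Space d → F →L[ℂ] F) :
    (0 : Space d → F) =ᵐ[volume] fun x => A x ((0 : L2 d F) x) := by
  filter_upwards [Lp.coeFn_zero F 2 (volume : Measure (Space d))] with x hx
  rw [hx, Pi.zero_apply, map_zero]

/-- The natural domain `{f ∈ L² | A f ∈ L²}` of multiplication by `A`. -/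
def multiplicationDomain (A : Space d → F →L[ℂ] F) : Submodule ℂ (L2 d F) where
  carrier := {f | MemLp (fun x => A x (f x)) 2 (volume : Measure (Space d))}
  add_mem' {f g} hf hg := (MemLp.add hf hg).ae_eq (multiplication_add A f g)
  zero_mem' := MemLp.ae_eq (multiplication_zero A) MemLp.zero'
  smul_mem' c f hf := (MemLp.const_smul hf c).ae_eq (multiplication_smul A c f)

theorem mem_multiplicationDomain (A : Space d → F →L[ℂ] F) (f : multiplicationDomain A) :
    MemLp (fun x => A x ((f : L2 d F) x)) 2 (volume : Measure (Space d)) := f.2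

theorem multiplication_map_smul (A : Space d → F →L[ℂ] F) (c : ℂ) (f : multiplicationDomain A) :
    (mem_multiplicationDomain A (c • f)).toLp = c • (mem_multiplicationDomain A f).toLp := by
  rw [← MemLp.toLp_const_smul]
  exact MemLp.toLp_congr _ _ (multiplication_smul A c (f : L2 d F)).symm

theorem multiplication_map_add (A : Space d → F →L[ℂ] F) (f g : multiplicationDomain A) :
    (mem_multiplicationDomain A (f + g)).toLp =
      (mem_multiplicationDomain A f).toLp + (mem_multiplicationDomain A g).toLp := by
  rw [← MemLp.toLp_add]
  exact MemLp.toLp_congr _ _ (multiplication_add A (f : L2 d F) (g : L2 d F)).symm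

/-- The maximal operator of multiplication by an operator-valued function `A`. -/
def multiplication (A : Space d → F →L[ℂ] F) : L2 d F →ₗ.[ℂ] L2 d F where
  domain := multiplicationDomain A
  toFun :=
    { toFun := fun f => (mem_multiplicationDomain A f).toLp
      map_add' := multiplication_map_add A
      map_smul' := multiplication_map_smul A }

end

/-- Multiplication by the real-valued function `X` on `L²(ℝ^d, ℂ)`. -/
def scalarMultiplication {d : ℕ} (X : Space d → ℝ) : L2 d ℂ →ₗ.[ℂ] L2 d ℂ :=
  multiplication fun x => (X x : ℂ) • ContinuousLinearMap.id ℂ ℂ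

/-- `X` is Laplacian-bounded with relative bound zero. -/
def LaplacianBoundedZero {d : ℕ} (X : Space d → ℝ) : Prop :=
  UnboundedOp.IsRelativelyBoundedZero (scalarMultiplication X) (-laplacian d ℂ)

/-- `X` is relatively Laplacian-compact. -/
def LaplacianCompact {d : ℕ} (X : Space d → ℝ) : Prop :=
  UnboundedOp.IsRelativelyCompact (scalarMultiplication X) (-laplacian d ℂ)

/-- `X` tends to zero at infinity, up to a null set. -/
def DecaysAtInfinity {d : ℕ} (X : Space d → ℝ) : Prop :=
  Tendsto X (cocompact (Space d) ⊓ ae volume) (𝓝 0)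

/-- A `2 × 2` matrix as an operator on `ℂ²`. -/
def matrixCLM (M : Matrix (Fin 2) (Fin 2) ℂ) : C2 →L[ℂ] C2 :=
  Matrix.toEuclideanCLM (n := Fin 2) (𝕜 := ℂ) M

/-- The free operator `diag(-Δ + μ, Δ - μ) = diag(1, -1) (-Δ + μ)` on `H²(ℝ^d, ℂ²)`. -/
def freeOp (d : ℕ) (μ : ℝ) : L2 d C2 →ₗ.[ℂ] L2 d C2 where
  domain := (laplacian d C2).domain
  toFun := ((matrixCLM !![1, 0; 0, -1]).compLpL 2 (volume : Measure (Space d))).toLinearMap ∘ₗ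
    (-(laplacian d C2).toFun + (μ : ℂ) • (laplacian d C2).domain.subtype)

/-- Multiplication by the matrix potential with rows `(U, W)` and `(-W, -U)`. -/
def potential {d : ℕ} (U W : Space d → ℝ) : L2 d C2 →ₗ.[ℂ] L2 d C2 :=
  multiplication fun x => matrixCLM !![(U x : ℂ), (W x : ℂ); -(W x : ℂ), -(U x : ℂ)]

/-- The operator with rows `(-Δ + μ + U, W)` and `(-W, Δ - μ - U)`. Its domain is
`H²(ℝ^d, ℂ²)` if that space lies in the domain of the potential. -/
def fullOp {d : ℕ} (μ : ℝ) (U W : Space d → ℝ) : L2 d C2 →ₗ.[ℂ] L2 d C2 :=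
  freeOp d μ + potential U W

/-- The set `(-∞, -μ] ∪ [μ, ∞)` in the complex plane. -/
def gapComplement (μ : ℝ) : Set ℂ := Complex.ofReal '' (Set.Iic (-μ) ∪ Set.Ici μ)

end

end MatrixSchrodinger

/-! ### Resolvents and bounded factorizations of unbounded operators. -/

namespace UnboundedOp

open Filter Topology

noncomputable section

variable {H : Type*} [NormedAddCommGroup H] [InnerProductSpace ℂ H]

/-! Everything off the half-lines rests on one factorization. If `z` lies in the resolvent set of
`T` and `V` is relatively compact, then `(T + V - z)(T - z)⁻¹ = 1 + V (T - z)⁻¹` is the identity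
plus a compact operator, hence `A + E C` with `A` invertible and `E C` of finite rank. Kernel,
cokernel and invertibility of `T + V - z` become questions about the finite matrix `1 + C A⁻¹ E`. A
square matrix and its adjoint have kernels of equal dimension, so the index is zero
(`Factorization.mem_Delta4`). Near `z` the operator `A` can be continued analytically, and the
resolvent of `T + V` is a quotient of analytic functions whose denominator is a determinant
(`Factorization.isFredholmPoint`).

For the free operator the resolvent off the two half-lines is an explicit Fourier multiplier. The
complement of the half-lines is connected because `μ > 0`, so the spectrum of the full operator is
discrete there once a single resolvent point is known; `IsGraphCompact.exists_mem_resolventSet`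
finds one on the imaginary axis from the symmetry of the free operator. The poles of the resolvent
have some finite order `m`, and the Riesz projection and the generalized eigenspace both end up in
the finite-dimensional space `ker (T - z) ^ m`.

On the half-lines, an orthonormal Weyl sequence of the free operator, supported on thin frequency
shells, remains singular after a relatively compact perturbation. This excludes closed range
together with finite-dimensional kernel. The remaining semi-Fredholm alternative is reduced to this
one: `σ₃` times the full operator is symmetric, so at a real point `σ₃` embeds the kernel into the
cokernel. All five essential spectra are then squeezed to the same set. The symmetries come from `σ₁
H σ₁ = -H` and `H* = σ₃ H σ₃`.

For decaying potentials, a weakly null sequence bounded in the graph norm is split by frequency. The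
high frequencies are small in `L²` and are controlled by the relative bound zero. The low
frequencies are uniformly bounded and tend to zero pointwise, so dominated convergence works on a
ball, while outside the ball the potential itself is small. -/

theorem shift_apply (T : H →ₗ.[ℂ] H) (z : ℂ) (u : T.domain) :
    shift T z u = T u - z • (u : H) := rfl

theorem IsBoundedInverse.unique {T : H →ₗ.[ℂ] H} {B B' : H →L[ℂ] H}
    (h : IsBoundedInverse T B) (h' : IsBoundedInverse T B') : B = B' := by
  ext x
  obtain ⟨hx, hTx⟩ := h.1 x
  have := h'.2 ⟨B x, hx⟩
  rw [hTx] at this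
  exact this.symm

theorem isBoundedInverse_resolvent {T : H →ₗ.[ℂ] H} {z : ℂ} (hz : z ∈ resolventSet T) :
    IsBoundedInverse (shift T z) (resolvent T z) := by
  rw [resolvent, dif_pos hz]
  exact hz.choose_spec

theorem IsBoundedInverse.resolvent_eq {T : H →ₗ.[ℂ] H} {z : ℂ} {B : H →L[ℂ] H}
    (h : IsBoundedInverse (shift T z) B) : resolvent T z = B :=
  (isBoundedInverse_resolvent ⟨B, h⟩).unique h

theorem resolvent_mem_domain {T : H →ₗ.[ℂ] H} {z : ℂ} (hz : z ∈ resolventSet T) (x : H) :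
    resolvent T z x ∈ T.domain := ((isBoundedInverse_resolvent hz).1 x).1

theorem apply_resolvent {T : H →ₗ.[ℂ] H} {z : ℂ} (hz : z ∈ resolventSet T) (x : H) :
    T ⟨resolvent T z x, resolvent_mem_domain hz x⟩ = x + z • resolvent T z x := by
  have : T ⟨resolvent T z x, resolvent_mem_domain hz x⟩ - z • resolvent T z x = x :=
    ((isBoundedInverse_resolvent hz).1 x).2
  rwa [sub_eq_iff_eq_add] at this

theorem resolvent_apply_sub {T : H →ₗ.[ℂ] H} {z : ℂ} (hz : z ∈ resolventSet T) (u : T.domain) :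
    resolvent T z (T u - z • (u : H)) = u :=
  (isBoundedInverse_resolvent hz).2 u

/-- An operator with nonempty resolvent set is closed, and so are its shifts. -/
theorem isClosed_shift_of_mem_resolventSet {T : H →ₗ.[ℂ] H} {w : ℂ} (hw : w ∈ resolventSet T)
    (z : ℂ) : (shift T z).IsClosed := by
  have : ((shift T z).graph : Set (H × H)) =
      {p | p.1 = resolvent T w (p.2 + (z - w) • p.1)} := by
    ext ⟨u, v⟩
    simp only [SetLike.mem_coe, LinearPMap.mem_graph_iff, Set.mem_ofPred_eq]
    constructor
    · rintro ⟨y, rfl, rfl⟩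
      have h : T y - z • (y : H) + (z - w) • (y : H) = T y - w • (y : H) := by module
      exact (resolvent_apply_sub hw y).symm.trans (congrArg _ h.symm)
    · intro h
      refine ⟨⟨_, resolvent_mem_domain hw (v + (z - w) • u)⟩, h.symm, ?_⟩
      refine (shift_apply T z ⟨_, resolvent_mem_domain hw _⟩).trans ?_
      rw [apply_resolvent hw (v + (z - w) • u)]
      change _ + w • resolvent T w _ - z • resolvent T w _ = v
      rw [← h]
      module
  rw [LinearPMap.IsClosed, this]
  exact isClosed_eq continuous_fst (by fun_prop)

/-- `(T - z) R = S`, where `R` is a bounded bijection onto the domain of `T`. -/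
structure Factorization (T : H →ₗ.[ℂ] H) (z : ℂ) (R S : H →L[ℂ] H) : Prop where
  injective : Function.Injective R
  domain_eq : T.domain = LinearMap.range R.toLinearMap
  apply_eq : ∀ (x : H) (h : R x ∈ T.domain), T ⟨R x, h⟩ - z • R x = S x

namespace Factorization

variable {T : H →ₗ.[ℂ] H} {z : ℂ} {R S : H →L[ℂ] H}

theorem mem_domain (h : Factorization T z R S) (x : H) : R x ∈ T.domain := by
  rw [h.domain_eq]; exact ⟨x, rfl⟩

theorem exists_eq (h : Factorization T z R S) (u : T.domain) :
    ∃ x, u = ⟨R x, h.mem_domain x⟩ := by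
  obtain ⟨x, hx⟩ : (u : H) ∈ LinearMap.range R.toLinearMap := h.domain_eq ▸ u.2
  exact ⟨x, Subtype.ext hx.symm⟩

theorem shift_apply_eq (h : Factorization T z R S) (x : H) :
    shift T z ⟨R x, h.mem_domain x⟩ = S x := h.apply_eq x _

/-- The same factorization at another point. -/
theorem at_point (h : Factorization T z R S) (w : ℂ) : Factorization T w R (S - (w - z) • R) where
  injective := h.injective
  domain_eq := h.domain_eq
  apply_eq x hx := by
    simp only [sub_apply, smul_apply, ← h.apply_eq x hx]
    module

theorem range_eq (h : Factorization T z R S) :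
    range (shift T z) = LinearMap.range S.toLinearMap := by
  ext y
  constructor
  · rintro ⟨u, rfl⟩
    obtain ⟨x, rfl⟩ := h.exists_eq u
    exact ⟨x, (h.shift_apply_eq x).symm⟩
  · rintro ⟨x, rfl⟩
    exact ⟨⟨R x, h.mem_domain x⟩, h.shift_apply_eq x⟩

/-- The kernel of `T - z` is isomorphic to the kernel of `S`. -/
def kernelEquiv (h : Factorization T z R S) :
    LinearMap.ker S.toLinearMap ≃ₗ[ℂ] kernel (shift T z) :=
  LinearEquiv.ofBijective
    { toFun := fun x : LinearMap.ker S.toLinearMap =>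
        (⟨⟨R x, h.mem_domain x⟩, (h.shift_apply_eq x).trans x.2⟩ : kernel (shift T z))
      map_add' := fun x y => Subtype.ext (Subtype.ext (map_add R _ _))
      map_smul' := fun c x => Subtype.ext (Subtype.ext (map_smul R c _)) }
    ⟨fun x y hxy => Subtype.ext (h.injective (congrArg (fun v : kernel (shift T z) => (v.1.1 : H)) hxy)),
     fun u => by
      obtain ⟨u, hu⟩ := u
      obtain ⟨x, rfl⟩ := h.exists_eq u
      exact ⟨⟨x, (h.shift_apply_eq x).symm.trans hu⟩, rfl⟩⟩

theorem isBoundedInverse (h : Factorization T z R S) {B : H →L[ℂ] H} (h1 : S * B = 1)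
    (h2 : B * S = 1) : IsBoundedInverse (shift T z) (R * B) := by
  constructor
  · intro x
    exact ⟨h.mem_domain (B x), (h.shift_apply_eq (B x)).trans (congrArg (fun A : H →L[ℂ] H => A x) h1)⟩
  · intro u
    obtain ⟨x, rfl⟩ := h.exists_eq u
    exact (congrArg (R * B) (h.shift_apply_eq x)).trans
      (congrArg (fun A : H →L[ℂ] H => R (A x)) h2)

end Factorization

/-! ### Finite-rank perturbations of invertible operators -/

section FiniteRank

variable {K : Type*} [NormedAddCommGroup K] [InnerProductSpace ℂ K]

/-- The kernel of `A + E C` is isomorphic to that of `1 + C A⁻¹ E`. -/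
def kerAddCompEquiv {A B : H →L[ℂ] H} (h1 : A * B = 1) (h2 : B * A = 1) (E : K →L[ℂ] H)
    (C : H →L[ℂ] K) :
    LinearMap.ker (A + E ∘L C).toLinearMap ≃ₗ[ℂ]
      LinearMap.ker ((1 : K →L[ℂ] K) + C ∘L B ∘L E).toLinearMap where
  toFun x := ⟨C x, by
    have hx : A (x : H) + E (C x) = 0 := x.2
    have hx' : B (E (C x)) = -(x : H) := by
      rw [← neg_eq_iff_add_eq_zero] at hx
      rw [← hx, map_neg]
      exact congrArg Neg.neg (congrArg (fun A : H →L[ℂ] H => A x) h2)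
    change C x + C (B (E (C x))) = 0
    rw [hx', map_neg, add_neg_cancel]⟩
  map_add' x y := Subtype.ext (map_add C _ _)
  map_smul' c x := Subtype.ext (map_smul C c _)
  invFun c := ⟨-B (E c), by
    have hc : (c : K) + C (B (E c)) = 0 := c.2
    have h1' : A (B (E (c : K))) = E c := congrArg (fun A : H →L[ℂ] H => A (E c)) h1
    change A (-B (E c)) + E (C (-B (E c))) = 0
    rw [map_neg, map_neg, h1', map_neg, ← neg_add, ← map_add, hc, map_zero, neg_zero]⟩
  left_inv x := by
    have hx : A (x : H) + E (C x) = 0 := x.2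
    rw [← neg_eq_iff_add_eq_zero] at hx
    apply Subtype.ext
    change -B (E (C x)) = x
    rw [← hx, map_neg, neg_neg]
    exact congrArg (fun A : H →L[ℂ] H => A x) h2
  right_inv c := by
    have hc : (c : K) + C (B (E c)) = 0 := c.2
    apply Subtype.ext
    change C (-B (E c)) = c
    rw [map_neg, neg_eq_iff_add_eq_zero, add_comm]
    exact hc

variable [FiniteDimensional ℂ K]

theorem finiteDimensional_ker_add_comp {A B : H →L[ℂ] H} (h1 : A * B = 1) (h2 : B * A = 1)
    (E : K →L[ℂ] H) (C : H →L[ℂ] K) :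
    FiniteDimensional ℂ (LinearMap.ker (A + E ∘L C).toLinearMap) :=
  (kerAddCompEquiv h1 h2 E C).symm.finiteDimensional

/-- On the kernel of `C B` the vector `B x` is a preimage of `x`, because the finite-rank term drops
out. The range thus contains a closed subspace of finite codimension, which forces it to be closed.
-/
theorem isClosed_range_add_comp {A B : H →L[ℂ] H} (h1 : A * B = 1)
    (E : K →L[ℂ] H) (C : H →L[ℂ] K) :
    IsClosed (LinearMap.range (A + E ∘L C).toLinearMap : Set H) := by
  have hker : IsClosed (LinearMap.ker (C ∘L B).toLinearMap : Set H) :=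
    (C ∘L B).isClosed_ker
  have : FiniteDimensional ℂ (H ⧸ LinearMap.ker (C ∘L B).toLinearMap) :=
    ((C ∘L B).toLinearMap.quotKerEquivRange).symm.finiteDimensional
  refine Submodule.isClosed_mono_of_finiteDimensional_quotient hker ?_
  intro x hx
  refine ⟨B x, ?_⟩
  have hx' : C (B x) = 0 := hx
  change A (B x) + E (C (B x)) = x
  rw [hx', map_zero, add_zero]
  exact congrArg (fun A : H →L[ℂ] H => A x) h1

theorem ker_adjoint_eq [CompleteSpace H] (S : H →L[ℂ] H) :
    (LinearMap.range S.toLinearMap)ᗮ = LinearMap.ker (ContinuousLinearMap.adjoint S).toLinearMap :=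
  S.orthogonal_range

theorem finrank_ker_adjoint (M : K →L[ℂ] K) :
    Module.finrank ℂ (LinearMap.ker (ContinuousLinearMap.adjoint M).toLinearMap) =
      Module.finrank ℂ (LinearMap.ker M.toLinearMap) := by
  have : CompleteSpace K := FiniteDimensional.complete ℂ K
  rw [← ker_adjoint_eq]
  have h1 := M.toLinearMap.finrank_range_add_finrank_ker
  have h2 := (LinearMap.range M.toLinearMap).finrank_add_finrank_orthogonal
  omega

/-- The adjoint `A* + C* E*` has the same shape, and its small matrix is the adjoint of `1 + C B E`.
Both kernels are therefore kernels of a square matrix and of its adjoint. -/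
theorem coker_add_comp [CompleteSpace H] {A B : H →L[ℂ] H} (h1 : A * B = 1) (h2 : B * A = 1)
    (E : K →L[ℂ] H) (C : H →L[ℂ] K) :
    FiniteDimensional ℂ (LinearMap.range (A + E ∘L C).toLinearMap)ᗮ ∧
      Module.finrank ℂ (LinearMap.range (A + E ∘L C).toLinearMap)ᗮ =
        Module.finrank ℂ (LinearMap.ker (A + E ∘L C).toLinearMap) := by
  have : CompleteSpace K := FiniteDimensional.complete ℂ K
  have h1' : ContinuousLinearMap.adjoint A * ContinuousLinearMap.adjoint B = 1 := by
    have := congrArg star h2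
    rw [star_mul, star_one] at this
    exact this
  have h2' : ContinuousLinearMap.adjoint B * ContinuousLinearMap.adjoint A = 1 := by
    have := congrArg star h1
    rw [star_mul, star_one] at this
    exact this
  have key := kerAddCompEquiv h1' h2' (ContinuousLinearMap.adjoint C) (ContinuousLinearMap.adjoint E)
  have e1 : ContinuousLinearMap.adjoint A +
      (ContinuousLinearMap.adjoint C) ∘L (ContinuousLinearMap.adjoint E) =
        ContinuousLinearMap.adjoint (A + E ∘L C) := by
    rw [map_add, ContinuousLinearMap.adjoint_comp]
  have e2 : (1 : K →L[ℂ] K) + ContinuousLinearMap.adjoint E ∘L ContinuousLinearMap.adjoint B ∘L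
      ContinuousLinearMap.adjoint C = ContinuousLinearMap.adjoint (1 + C ∘L B ∘L E) := by
    rw [map_add, ContinuousLinearMap.adjoint_comp, ContinuousLinearMap.adjoint_comp,
      ContinuousLinearMap.comp_assoc]
    congr 1
    exact (star_one (K →L[ℂ] K)).symm
  rw [e1, e2] at key
  rw [ker_adjoint_eq]
  refine ⟨key.symm.finiteDimensional, ?_⟩
  rw [key.finrank_eq, finrank_ker_adjoint, (kerAddCompEquiv h1 h2 E C).finrank_eq]

/-- Since `R` is a bijection onto the domain, `T - z` and `A + E C` have the same range and
isomorphic kernels, so all Fredholm data can be read off the bounded operator. -/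
theorem Factorization.mem_Delta4 [CompleteSpace H] {T : H →ₗ.[ℂ] H} {z : ℂ} {R A B : H →L[ℂ] H}
    {E : K →L[ℂ] H} {C : H →L[ℂ] K} (h : Factorization T z R (A + E ∘L C))
    (h1 : A * B = 1) (h2 : B * A = 1) (hT : (shift T z).IsClosed) : z ∈ Delta4 T := by
  have hf := finiteDimensional_ker_add_comp h1 h2 E C
  obtain ⟨hc, hc'⟩ := coker_add_comp h1 h2 E C
  refine ⟨⟨hT, ?_, h.kernelEquiv.finiteDimensional, ?_⟩, ?_⟩
  · rw [h.range_eq]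
    exact isClosed_range_add_comp h1 E C
  · rw [h.range_eq]
    exact hc
  · rw [index, h.range_eq, hc', h.kernelEquiv.finrank_eq, sub_self]

end FiniteRank

/-- On a Hilbert space, the identity plus an operator that maps the unit ball to a totally bounded
set is a finite-rank perturbation of an invertible operator. -/
theorem exists_eq_add_comp_of_totallyBounded [CompleteSpace H] (L : H →L[ℂ] H)
    (hL : TotallyBounded (L '' Metric.closedBall 0 1)) :
    ∃ (N : Submodule ℂ H) (_ : FiniteDimensional ℂ N) (C : H →L[ℂ] N) (A B : H →L[ℂ] H),
      A * B = 1 ∧ B * A = 1 ∧ 1 + L = A + N.subtypeL ∘L C := by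
  -- Projecting `L` onto the span of a finite `1/2`-net of the image of the ball changes it by norm
  -- at most `1/2`. The remainder is absorbed into an operator invertible by a Neumann series.
  obtain ⟨t, ht, hcov⟩ := Metric.totallyBounded_iff.1 hL (1 / 2) (by norm_num)
  let N : Submodule ℂ H := Submodule.span ℂ t
  have hN : FiniteDimensional ℂ N := FiniteDimensional.span_of_finite ℂ ht
  let P : H →L[ℂ] N := N.orthogonalProjectionOnto
  let C : H →L[ℂ] N := P ∘L L
  let Q : H →L[ℂ] H := N.subtypeL ∘L C - L
  have hball : ∀ x : H, ‖x‖ ≤ 1 → ‖Q x‖ ≤ 1 / 2 := by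
    intro x hx
    have hx' : L x ∈ L '' Metric.closedBall 0 1 := ⟨x, by simpa using hx, rfl⟩
    obtain ⟨y, hy, hxy⟩ := Set.mem_iUnion₂.1 (hcov hx')
    have hyN : y ∈ N := Submodule.subset_span hy
    have := N.starProjection_minimal (L x)
    have hle : ‖L x - N.starProjection (L x)‖ ≤ ‖L x - y‖ := by
      rw [this]
      exact ciInf_le ⟨0, by rintro _ ⟨w, rfl⟩; exact norm_nonneg _⟩ (⟨y, hyN⟩ : N)
    have hQ : Q x = -(L x - N.starProjection (L x)) := by
      simp [Q, C, P]
    rw [hQ, norm_neg]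
    exact hle.trans (by rw [← dist_eq_norm]; exact (Metric.mem_ball.1 hxy).le)
  have hQ : ‖Q‖ ≤ 1 / 2 := by
    refine ContinuousLinearMap.opNorm_le_of_unit_norm (by norm_num) ?_
    intro x hx
    exact hball x hx.le
  let u : (H →L[ℂ] H)ˣ := Units.oneSub Q (hQ.trans_lt (by norm_num))
  refine ⟨N, hN, C, 1 - Q, ((u⁻¹ : (H →L[ℂ] H)ˣ) : H →L[ℂ] H), u.mul_inv, u.inv_mul, ?_⟩
  change 1 + L = 1 - (N.subtypeL ∘L C - L) + N.subtypeL ∘L C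
  abel

end

end UnboundedOp

namespace UnboundedOp

open Filter Topology

noncomputable section

variable {H : Type*} [NormedAddCommGroup H] [InnerProductSpace ℂ H]

/-! ### Determinants of finite-rank perturbations -/

section Cofactor

variable {K : Type*} [NormedAddCommGroup K] [InnerProductSpace ℂ K]
  {ι : Type*} [Fintype ι] [DecidableEq ι]

/-- The matrix of `1 + C B E`. -/
def perturbationMatrix (b : Module.Basis ι ℂ K) (E : K →L[ℂ] H) (C : H →L[ℂ] K) (B : H →L[ℂ] H) :
    Matrix ι ι ℂ :=
  LinearMap.toMatrix b b ((1 : K →L[ℂ] K) + C ∘L B ∘L E).toLinearMap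

/-- The operator on `K` with a single matrix entry equal to one. -/
def entryOp [FiniteDimensional ℂ K] (b : Module.Basis ι ℂ K) (i j : ι) : K →L[ℂ] K :=
  LinearMap.toContinuousLinearMap (Matrix.toLin b b (Matrix.single i j 1))

/-- The operator `Θ` with `(A + E C) Θ = Θ (A + E C) = det (1 + C A⁻¹ E)`, where `B = A⁻¹`. -/
def cofactorOp [FiniteDimensional ℂ K] (b : Module.Basis ι ℂ K) (E : K →L[ℂ] H) (C : H →L[ℂ] K)
    (B : H →L[ℂ] H) : H →L[ℂ] H :=
  (perturbationMatrix b E C B).det • B -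
    ∑ i, ∑ j, (perturbationMatrix b E C B).adjugate i j • (B * ((E ∘L entryOp b i j ∘L C) * B))

variable [FiniteDimensional ℂ K]

/-- The definition expands the adjugate over its entries, so that analyticity in `B` reduces to that
of scalar coefficients. This recombined form is the one used for the algebra. -/
theorem cofactorOp_apply (b : Module.Basis ι ℂ K) (E : K →L[ℂ] H) (C : H →L[ℂ] K)
    (B : H →L[ℂ] H) (x : H) :
    cofactorOp b E C B x = (perturbationMatrix b E C B).det • B x -
      B (E (Matrix.toLin b b (perturbationMatrix b E C B).adjugate (C (B x)))) := by
  conv_rhs => rw [Matrix.matrix_eq_sum_single (perturbationMatrix b E C B).adjugate]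
  have : ∀ i j, Matrix.single i j ((perturbationMatrix b E C B).adjugate i j) =
      (perturbationMatrix b E C B).adjugate i j • Matrix.single i j (1 : ℂ) := by
    intro i j
    rw [Matrix.smul_single, smul_eq_mul, mul_one]
  simp only [this, map_sum, map_smul, LinearMap.sum_apply, LinearMap.smul_apply]
  simp [cofactorOp, entryOp]

/-- This is the Woodbury formula for the inverse of `A + E C` with the denominator cleared. It
follows from `M * adj M = det M` and needs no invertibility of `M`. -/
theorem mul_cofactorOp (b : Module.Basis ι ℂ K) (E : K →L[ℂ] H) (C : H →L[ℂ] K)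
    {A B : H →L[ℂ] H} (h1 : A * B = 1) :
    (A + E ∘L C) * cofactorOp b E C B = (perturbationMatrix b E C B).det • 1 := by
  ext x
  set M := perturbationMatrix b E C B with hM
  set y := Matrix.toLin b b M.adjugate (C (B x)) with hy
  have hAB : ∀ v, A (B v) = v := fun v => congrArg (fun A : H →L[ℂ] H => A v) h1
  have key : y + C (B (E y)) = M.det • C (B x) := by
    have e : ((1 : K →L[ℂ] K) + C ∘L B ∘L E).toLinearMap = Matrix.toLin b b M := by
      rw [hM, perturbationMatrix, Matrix.toLin_toMatrix]
    have e2 : y + C (B (E y)) = Matrix.toLin b b M y := by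
      rw [← e]; rfl
    rw [e2, hy, ← Matrix.toLin_mul_apply b b b, Matrix.mul_adjugate]
    simp
  change A (cofactorOp b E C B x) + E (C (cofactorOp b E C B x)) = M.det • x
  rw [cofactorOp_apply, ← hM, ← hy]
  have key' := congrArg E key
  rw [map_add, map_smul] at key'
  simp only [map_sub, map_smul, hAB, ← key']
  abel

theorem cofactorOp_mul (b : Module.Basis ι ℂ K) (E : K →L[ℂ] H) (C : H →L[ℂ] K)
    {A B : H →L[ℂ] H} (h2 : B * A = 1) :
    cofactorOp b E C B * (A + E ∘L C) = (perturbationMatrix b E C B).det • 1 := by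
  ext x
  set M := perturbationMatrix b E C B with hM
  have hBA : ∀ v, B (A v) = v := fun v => congrArg (fun A : H →L[ℂ] H => A v) h2
  have e : ((1 : K →L[ℂ] K) + C ∘L B ∘L E).toLinearMap = Matrix.toLin b b M := by
    rw [hM, perturbationMatrix, Matrix.toLin_toMatrix]
  have key : C x + C (B (E (C x))) = Matrix.toLin b b M (C x) := by
    rw [← e]; rfl
  have key2 : Matrix.toLin b b M.adjugate (Matrix.toLin b b M (C x)) = M.det • C x := by
    rw [← Matrix.toLin_mul_apply b b b, Matrix.adjugate_mul]
    simp
  change cofactorOp b E C B (A x + E (C x)) = M.det • x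
  rw [cofactorOp_apply, ← hM]
  simp only [map_add, hBA, key]
  rw [key2]
  simp only [map_smul, smul_add]
  abel

theorem exists_ker_of_det_eq_zero (b : Module.Basis ι ℂ K) (E : K →L[ℂ] H) (C : H →L[ℂ] K)
    {A B : H →L[ℂ] H} (h1 : A * B = 1) (h2 : B * A = 1)
    (hdet : (perturbationMatrix b E C B).det = 0) : ∃ x, x ≠ 0 ∧ (A + E ∘L C) x = 0 := by
  rw [perturbationMatrix, LinearMap.det_toMatrix] at hdet
  have := LinearMap.bot_lt_ker_of_det_eq_zero hdet
  obtain ⟨c, hc, hc0⟩ := Submodule.exists_mem_ne_zero_of_ne_bot this.ne'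
  refine ⟨(kerAddCompEquiv h1 h2 E C).symm ⟨c, hc⟩, ?_,
    ((kerAddCompEquiv h1 h2 E C).symm ⟨c, hc⟩).2⟩
  intro h0
  have h0' : (kerAddCompEquiv h1 h2 E C).symm ⟨c, hc⟩ = 0 := Subtype.ext h0
  rw [LinearEquiv.map_eq_zero_iff] at h0'
  exact hc0 (congrArg Subtype.val h0')

theorem differentiableAt_det {M : ℂ → Matrix ι ι ℂ} {w : ℂ}
    (h : ∀ i j, DifferentiableAt ℂ (fun v => M v i j) w) :
    DifferentiableAt ℂ (fun v => (M v).det) w := by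
  simp only [Matrix.det_apply]
  refine DifferentiableAt.fun_sum fun σ _ => ?_
  exact (DifferentiableAt.fun_finsetProd fun i _ => h _ _).const_smul _

theorem differentiableAt_adjugate {M : ℂ → Matrix ι ι ℂ} {w : ℂ}
    (h : ∀ i j, DifferentiableAt ℂ (fun v => M v i j) w) (i j : ι) :
    DifferentiableAt ℂ (fun v => (M v).adjugate i j) w := by
  simp only [Matrix.adjugate_apply]
  refine differentiableAt_det fun k l => ?_
  by_cases hk : k = j
  · simp [hk]
  · simpa [Matrix.updateRow_ne hk] using h k l

theorem differentiableAt_perturbationMatrix (b : Module.Basis ι ℂ K) (E : K →L[ℂ] H)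
    (C : H →L[ℂ] K) {B : ℂ → H →L[ℂ] H} {w : ℂ} (h : DifferentiableAt ℂ B w) (i j : ι) :
    DifferentiableAt ℂ (fun v => perturbationMatrix b E C (B v) i j) w := by
  have : ∀ v, perturbationMatrix b E C (B v) i j =
      (LinearMap.toContinuousLinearMap (b.coord i)) (b j + C (B v (E (b j)))) := by
    intro v
    simp [perturbationMatrix, LinearMap.toMatrix_apply]
  simp only [this]
  fun_prop

theorem differentiableAt_cofactorOp (b : Module.Basis ι ℂ K) (E : K →L[ℂ] H)
    (C : H →L[ℂ] K) {B : ℂ → H →L[ℂ] H} {w : ℂ} (h : DifferentiableAt ℂ B w) :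
    DifferentiableAt ℂ (fun v => cofactorOp b E C (B v)) w := by
  have hM := differentiableAt_perturbationMatrix b E C h
  unfold cofactorOp
  refine ((differentiableAt_det hM).smul h).sub ?_
  refine DifferentiableAt.fun_sum fun i _ => DifferentiableAt.fun_sum fun j _ => ?_
  refine (differentiableAt_adjugate hM i j).smul ?_
  exact h.mul ((differentiableAt_const _).mul h)

end Cofactor

/-! ### Meromorphy of the resolvent -/

/-- Near `z` the resolvent of `T` is a quotient `Θ / D` of analytic functions, and the zeros of `D`
are eigenvalues. -/
def IsFredholmPoint (T : H →ₗ.[ℂ] H) (z : ℂ) : Prop :=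
  ∃ (D : ℂ → ℂ) (Θ : ℂ → H →L[ℂ] H), AnalyticAt ℂ D z ∧ AnalyticAt ℂ Θ z ∧
    ∀ᶠ w in 𝓝 z, (D w = 0 → IsEigenvalue T w) ∧
      (D w ≠ 0 → w ∈ resolventSet T ∧ D w • resolvent T w = Θ w)

theorem IsEigenvalue.notMem_resolventSet {T : H →ₗ.[ℂ] H} {z : ℂ} (h : IsEigenvalue T z) :
    z ∉ resolventSet T := by
  intro hz
  obtain ⟨u, hu, hTu⟩ := h
  have := resolvent_apply_sub hz u
  rw [hTu, sub_self, map_zero] at this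
  exact hu (Subtype.ext this.symm)

/-- At a nearby point `w` the factorization has `A - (w - z) R` in place of `A`, while the
finite-rank term is unchanged. Invertibility persists near `z`, so the determinant and the cofactor
operator are analytic there; a zero of the determinant yields a kernel vector, which the injective
`R` turns into an eigenvector. -/
theorem Factorization.isFredholmPoint [CompleteSpace H] {K : Type*} [NormedAddCommGroup K]
    [InnerProductSpace ℂ K] [FiniteDimensional ℂ K] {T : H →ₗ.[ℂ] H} {z : ℂ} {R A B : H →L[ℂ] H}
    {E : K →L[ℂ] H} {C : H →L[ℂ] K} (h : Factorization T z R (A + E ∘L C))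
    (h1 : A * B = 1) (h2 : B * A = 1) : IsFredholmPoint T z := by
  let b := Module.finBasis ℂ K
  let Aw : ℂ → H →L[ℂ] H := fun w => A - (w - z) • R
  have hAw : Differentiable ℂ Aw := by fun_prop
  have hunit : ∀ᶠ w in 𝓝 z, IsUnit (Aw w) := by
    have hz : Aw z ∈ {a : H →L[ℂ] H | IsUnit a} := by
      change IsUnit (Aw z)
      simp only [Aw, sub_self, zero_smul, sub_zero]
      exact ⟨⟨A, B, h1, h2⟩, rfl⟩
    exact hAw.continuous.continuousAt.eventually_mem (Units.isOpen.mem_nhds hz)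
  -- `Ring.inverse` is zero off the units; only the neighbourhood of `z` where `Aw w` is a unit
  -- matters.
  let Bw : ℂ → H →L[ℂ] H := fun w => Ring.inverse (Aw w)
  have hBw : ∀ᶠ w in 𝓝 z, DifferentiableAt ℂ Bw w := by
    filter_upwards [hunit] with w hw
    exact (hAw w).inverse hw
  refine ⟨fun w => (perturbationMatrix b E C (Bw w)).det,
    fun w => R * cofactorOp b E C (Bw w), ?_, ?_, ?_⟩
  · rw [Complex.analyticAt_iff_eventually_differentiableAt]
    filter_upwards [hBw] with w hw
    exact differentiableAt_det (differentiableAt_perturbationMatrix b E C hw)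
  · rw [Complex.analyticAt_iff_eventually_differentiableAt]
    filter_upwards [hBw] with w hw
    exact (differentiableAt_const _).mul (differentiableAt_cofactorOp b E C hw)
  · filter_upwards [hunit] with w hw
    have e1 : Aw w * Bw w = 1 := Ring.mul_inverse_cancel _ hw
    have e2 : Bw w * Aw w = 1 := Ring.inverse_mul_cancel _ hw
    have hfac : Factorization T w R (Aw w + E ∘L C) := by
      have := h.at_point w
      convert this using 1
      simp only [Aw]
      abel
    refine ⟨fun hD => ?_, fun hD => ?_⟩
    · obtain ⟨x, hx, hx0⟩ := exists_ker_of_det_eq_zero b E C e1 e2 hD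
      refine ⟨⟨R x, hfac.mem_domain x⟩, ?_, ?_⟩
      · intro h0
        apply hx
        apply hfac.injective
        rw [map_zero]
        exact congrArg Subtype.val h0
      · have := hfac.apply_eq x (hfac.mem_domain x)
        rwa [hx0, sub_eq_zero] at this
    · set D := (perturbationMatrix b E C (Bw w)).det
      have hB := hfac.isBoundedInverse (B := D⁻¹ • cofactorOp b E C (Bw w))
        (by rw [mul_smul_comm, mul_cofactorOp b E C e1, smul_smul, inv_mul_cancel₀ hD, one_smul])
        (by rw [smul_mul_assoc, cofactorOp_mul b E C e2, smul_smul, inv_mul_cancel₀ hD, one_smul])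
      refine ⟨⟨_, hB⟩, ?_⟩
      rw [hB.resolvent_eq, mul_smul_comm, smul_smul, mul_inv_cancel₀ hD, one_smul]

namespace IsFredholmPoint

variable {T : H →ₗ.[ℂ] H} {z : ℂ}

theorem mem_resolventSet (h : IsFredholmPoint T z) (hz : ¬ IsEigenvalue T z) :
    z ∈ resolventSet T := by
  obtain ⟨D, Θ, -, -, hw⟩ := h
  have := hw.self_of_nhds
  exact (this.2 fun h0 => hz (this.1 h0)).1

theorem isEigenvalue (h : IsFredholmPoint T z) (hz : z ∉ resolventSet T) : IsEigenvalue T z := by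
  by_contra hz'
  exact hz (h.mem_resolventSet hz')

/-- An analytic denominator either vanishes identically near `z` or is nonzero in a deleted
neighbourhood. -/
theorem dichotomy (h : IsFredholmPoint T z) :
    (∀ᶠ w in 𝓝[≠] z, w ∈ resolventSet T) ∨ ∀ᶠ w in 𝓝 z, w ∉ resolventSet T := by
  obtain ⟨D, Θ, hD, -, hw⟩ := h
  rcases hD.eventually_eq_zero_or_eventually_ne_zero with h0 | h0
  · right
    filter_upwards [h0, hw] with w h0 hw
    exact (hw.1 h0).notMem_resolventSet
  · left
    filter_upwards [h0, nhdsWithin_le_nhds hw] with w h0 hw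
    exact (hw.2 h0).1

/-- At an isolated point of the spectrum the resolvent has a pole of finite order. -/
theorem exists_pole (h : IsFredholmPoint T z) (hz : ∀ᶠ w in 𝓝[≠] z, w ∈ resolventSet T) :
    ∃ (m : ℕ) (Φ : ℂ → H →L[ℂ] H), AnalyticAt ℂ Φ z ∧
      ∀ᶠ w in 𝓝[≠] z, (w - z) ^ m • resolvent T w = Φ w := by
  obtain ⟨D, Θ, hD, hΘ, hw⟩ := h
  have hne : ¬ ∀ᶠ w in 𝓝 z, D w = 0 := by
    intro h0
    have : ∀ᶠ w in 𝓝[≠] z, False := by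
      filter_upwards [hz, nhdsWithin_le_nhds hw, nhdsWithin_le_nhds h0] with w hz hw h0
      exact (hw.1 h0).notMem_resolventSet hz
    exact this.frequently.exists.choose_spec
  -- The vanishing order `m` of the denominator bounds the order of the pole; it may exceed the true
  -- order.
  obtain ⟨m, g, hg, hgz, hDg⟩ := hD.exists_eventuallyEq_pow_smul_nonzero_iff.2 hne
  refine ⟨m, fun w => (g w)⁻¹ • Θ w, (hg.inv hgz).smul hΘ, ?_⟩
  have hg0 : ∀ᶠ w in 𝓝 z, g w ≠ 0 := hg.continuousAt.eventually_ne hgz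
  filter_upwards [nhdsWithin_le_nhds hw, nhdsWithin_le_nhds hDg, nhdsWithin_le_nhds hg0,
    self_mem_nhdsWithin] with w hw hDg hg0 hwz
  have hwz' : w - z ≠ 0 := sub_ne_zero.2 hwz
  have hD0 : D w ≠ 0 := by
    rw [hDg]
    exact smul_ne_zero (pow_ne_zero _ hwz') hg0
  rw [← (hw.2 hD0).2, hDg, smul_smul, smul_eq_mul, mul_comm ((w - z) ^ m), inv_mul_cancel_left₀ hg0]

end IsFredholmPoint

/-- If a connected set consists of Fredholm points and meets the resolvent set, then the spectrum
is discrete in it. -/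
theorem eventually_mem_resolventSet_of_isPreconnected {T : H →ₗ.[ℂ] H} {Ω : Set ℂ}
    (hΩ : IsPreconnected Ω) (hT : ∀ z ∈ Ω, IsFredholmPoint T z) {z₀ : ℂ} (hz₀ : z₀ ∈ Ω)
    (hρ : z₀ ∈ resolventSet T) {z : ℂ} (hz : z ∈ Ω) : ∀ᶠ w in 𝓝[≠] z, w ∈ resolventSet T := by
  -- Both sets are open and they are disjoint. By the dichotomy they cover `Ω`, so connectedness
  -- leaves only the one that contains `z₀`.
  let u : Set ℂ := {z | ∀ᶠ w in 𝓝[≠] z, w ∈ resolventSet T}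
  let v : Set ℂ := {z | ∀ᶠ w in 𝓝 z, w ∉ resolventSet T}
  have hu : IsOpen u := by
    rw [isOpen_iff_mem_nhds]
    intro x hx
    filter_upwards [eventually_nhds_nhdsWithin.2 hx] with y hy
    by_cases hyx : y = x
    · rw [hyx]
      exact hx
    · have : {x}ᶜ ∈ 𝓝 y := isOpen_compl_singleton.mem_nhds hyx
      rw [nhdsWithin_eq_nhds.2 this] at hy
      exact nhdsWithin_le_nhds hy
  have hv : IsOpen v := isOpen_setOfPred_eventually_nhds
  have huv : Disjoint u v := by
    rw [Set.disjoint_left]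
    intro x hx hx'
    have : ∀ᶠ w in 𝓝[≠] x, False := by
      filter_upwards [hx, nhdsWithin_le_nhds hx'] with w h1 h2
      exact h2 h1
    exact this.frequently.exists.choose_spec
  refine hΩ.subset_left_of_subset_union hu hv huv (fun x hx => (hT x hx).dichotomy) ?_ hz
  refine ⟨z₀, hz₀, (hT z₀ hz₀).dichotomy.resolve_right ?_⟩
  intro h
  exact h.self_of_nhds hρ

end

end UnboundedOp

namespace UnboundedOp

open Filter Topology

noncomputable section

variable {H : Type*} [NormedAddCommGroup H] [InnerProductSpace ℂ H]

/-! ### Algebraic multiplicity -/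

theorem mem_kernelPow_succ {T : H →ₗ.[ℂ] H} {k : ℕ} {x : H} :
    x ∈ kernelPow T (k + 1) ↔ ∃ h : x ∈ T.domain, T ⟨x, h⟩ ∈ kernelPow T k := by
  constructor
  · rintro ⟨u, hu, rfl⟩
    exact ⟨u.2, hu⟩
  · rintro ⟨h, hx⟩
    exact ⟨⟨x, h⟩, hx, rfl⟩

/-- The preimage of `kernelPow T k` under `T` is an extension of a subspace of `kernelPow T k` by a
subspace of `kernel T`. -/
theorem finiteDimensional_kernelPow {T : H →ₗ.[ℂ] H} (hT : FiniteDimensional ℂ (kernel T)) (k : ℕ) :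
    FiniteDimensional ℂ (kernelPow T k) := by
  induction k with
  | zero => exact inferInstanceAs (FiniteDimensional ℂ (⊥ : Submodule ℂ H))
  | succ k ih =>
    have h1 : (kernelPow T k).FG := Module.Finite.iff_fg.1 ih
    have h2 : (kernel T).FG := Module.Finite.iff_fg.1 hT
    have h3 : ((kernelPow T k).comap T.toFun).FG := by
      refine Submodule.fg_of_fg_map_of_fg_inf_ker T.toFun ?_ ?_
      · have : FiniteDimensional ℂ (((kernelPow T k).comap T.toFun).map T.toFun) :=
          Submodule.finiteDimensional_of_le (Submodule.map_comap_le _ _)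
        exact Module.Finite.iff_fg.1 this
      · have : FiniteDimensional ℂ
            ((kernelPow T k).comap T.toFun ⊓ LinearMap.ker T.toFun : Submodule ℂ T.domain) :=
          Submodule.finiteDimensional_of_le (S₂ := kernel T) inf_le_right
        exact Module.Finite.iff_fg.1 this
    exact Module.Finite.iff_fg.2 (h3.map T.domain.subtype)

theorem kernelPow_le_of_succ_le {T : H →ₗ.[ℂ] H} {m : ℕ}
    (h : kernelPow T (m + 1) ≤ kernelPow T m) (k : ℕ) : kernelPow T k ≤ kernelPow T m := by
  induction k with
  | zero => exact bot_le
  | succ k ih =>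
    intro x hx
    obtain ⟨hd, hx⟩ := mem_kernelPow_succ.1 hx
    exact h (mem_kernelPow_succ.2 ⟨hd, ih hx⟩)

/-- The limit is `-(T - z) ^ n x`. Writing `R(w)` for the resolvent, the identity `R(w) (T - z) x =
x + (w - z) R(w) x` passes from `(T - z) x` to `x` at the cost of one factor `w - z`. -/
theorem tendsto_pow_smul_resolvent {T : H →ₗ.[ℂ] H} {z : ℂ}
    (hz : ∀ᶠ w in 𝓝[≠] z, w ∈ resolventSet T) (n : ℕ) {x : H}
    (hx : x ∈ kernelPow (shift T z) (n + 1)) :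
    ∃ y : H, Tendsto (fun w => (w - z) ^ (n + 1) • resolvent T w x) (𝓝[≠] z) (𝓝 y) ∧
      (y = 0 → x ∈ kernelPow (shift T z) n) := by
  induction n generalizing x with
  | zero =>
    obtain ⟨hd, hx⟩ := mem_kernelPow_succ.1 hx
    have hx' : T ⟨x, hd⟩ - z • x = 0 := hx
    refine ⟨-x, ?_, fun h => neg_eq_zero.1 h⟩
    refine tendsto_const_nhds.congr' ?_
    filter_upwards [hz] with w hw
    have := resolvent_apply_sub hw ⟨x, hd⟩
    rw [sub_eq_zero.1 hx'] at this
    simp only [← sub_smul, map_smul] at this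
    rw [zero_add, pow_one, ← neg_sub z w, neg_smul, this]
  | succ n ih =>
    obtain ⟨hd, hx⟩ := mem_kernelPow_succ.1 hx
    obtain ⟨y, hy, hy0⟩ := ih hx
    refine ⟨y, ?_, fun h => mem_kernelPow_succ.2 ⟨hd, hy0 h⟩⟩
    have h0 : Tendsto (fun w : ℂ => (w - z) ^ (n + 1) • x) (𝓝[≠] z) (𝓝 0) := by
      have : Continuous (fun w : ℂ => (w - z) ^ (n + 1) • x) := by fun_prop
      have := this.tendsto z
      simp only [sub_self, ne_eq, Nat.add_eq_zero_iff, one_ne_zero, and_false, not_false_eq_true,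
        zero_pow, zero_smul] at this
      exact this.mono_left nhdsWithin_le_nhds
    have h1 := hy.sub h0
    rw [sub_zero] at h1
    refine h1.congr' ?_
    filter_upwards [hz] with w hw
    have h2 := resolvent_apply_sub hw ⟨x, hd⟩
    have h3 : shift T z ⟨x, hd⟩ = (T ⟨x, hd⟩ - w • x) + (w - z) • x := by
      refine (shift_apply T z ⟨x, hd⟩).trans ?_
      simp only [sub_smul]
      abel
    rw [h3, map_add, h2, map_smul]
    simp only [smul_add, smul_smul, ← pow_succ]
    abel

/-- If `(w - z) ^ m R(w)` stays bounded near `z`, one more factor `w - z` makes the limit of the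
preceding lemma zero. A pole of order at most `m` thus stops the growth of the generalized
eigenspace at `m`. -/
theorem kernelPow_succ_le_of_pole {T : H →ₗ.[ℂ] H} {z : ℂ} {m : ℕ} {Φ : ℂ → H →L[ℂ] H}
    (hz : ∀ᶠ w in 𝓝[≠] z, w ∈ resolventSet T) (hΦ : ContinuousAt Φ z)
    (hm : ∀ᶠ w in 𝓝[≠] z, (w - z) ^ m • resolvent T w = Φ w) :
    kernelPow (shift T z) (m + 1) ≤ kernelPow (shift T z) m := by
  intro x hx
  obtain ⟨y, hy, hy0⟩ := tendsto_pow_smul_resolvent hz m hx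
  refine hy0 (tendsto_nhds_unique hy ?_)
  have h1 : Tendsto (fun w => (w - z) • Φ w x) (𝓝[≠] z) (𝓝 0) := by
    have : ContinuousAt (fun w => (w - z) • Φ w x) z := by fun_prop
    have := this.tendsto
    simp only [sub_self, zero_smul] at this
    exact this.mono_left nhdsWithin_le_nhds
  refine h1.congr' ?_
  filter_upwards [hm] with w hw
  rw [← hw, pow_succ', mul_smul]
  rfl

/-- The first resolvent identity, arranged with the fixed operator `resolvent T w₀` outermost. It
can then be pulled out of a contour integral, which places the integral in the domain of `T`. -/
theorem resolvent_eq_resolvent_apply {T : H →ₗ.[ℂ] H} {w w₀ : ℂ} (hw : w ∈ resolventSet T)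
    (hw₀ : w₀ ∈ resolventSet T) (x : H) :
    resolvent T w x = resolvent T w₀ (x + (w - w₀) • resolvent T w x) := by
  have h1 := resolvent_apply_sub hw₀ ⟨_, resolvent_mem_domain hw x⟩
  rw [apply_resolvent hw] at h1
  refine h1.symm.trans (congrArg _ ?_)
  simp only [sub_smul]
  abel

variable [CompleteSpace H]

theorem circleIntegral_clm_apply {E F : Type*} [NormedAddCommGroup E] [NormedSpace ℂ E]
    [NormedAddCommGroup F] [NormedSpace ℂ F] [CompleteSpace E] [CompleteSpace F] (L : E →L[ℂ] F)
    {f : ℂ → E} {c : ℂ} {r : ℝ} (hf : CircleIntegrable f c r) :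
    ∮ w in C(c, r), L (f w) = L (∮ w in C(c, r), f w) := by
  unfold circleIntegral
  rw [← L.intervalIntegral_comp_comm hf.out]
  simp

/-- The moments `∮ (w - z) ^ k (T - w)⁻¹ x dw` lie in the domain, and `T - z` raises `k`. -/
theorem shift_moment {T : H →ₗ.[ℂ] H} {z : ℂ} {r : ℝ} (hr : 0 < r)
    (hρ : Metric.closedBall z r \ {z} ⊆ resolventSet T)
    (hc : ContinuousOn (resolvent T) (Metric.sphere z r)) (x : H) (k : ℕ) :
    ∃ h : (∮ w in C(z, r), (w - z) ^ k • resolvent T w x) ∈ T.domain,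
      shift T z ⟨_, h⟩ = ∮ w in C(z, r), (w - z) ^ (k + 1) • resolvent T w x := by
  have hsphere : Metric.sphere z r ⊆ resolventSet T := by
    intro w hw
    refine hρ ⟨Metric.sphere_subset_closedBall hw, ?_⟩
    rintro rfl
    simp at hw
    exact hr.ne hw
  have hint : ∀ k : ℕ, CircleIntegrable (fun w => (w - z) ^ k • resolvent T w x) z r := by
    intro k
    refine ContinuousOn.circleIntegrable hr.le ?_
    exact (by fun_prop : Continuous fun w : ℂ => (w - z) ^ k).continuousOn.smul
      (hc.clm_apply continuousOn_const)
  have hint' : CircleIntegrable (fun w => (w - z) ^ k • x) z r :=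
    ContinuousOn.circleIntegrable hr.le (by fun_prop)
  have hint2 : ∀ c : ℂ, CircleIntegrable (fun w => c • ((w - z) ^ k • resolvent T w x)) z r := by
    intro c
    refine ContinuousOn.circleIntegrable hr.le ?_
    exact ((by fun_prop : Continuous fun w : ℂ => (w - z) ^ k).continuousOn.smul
      (hc.clm_apply continuousOn_const)).const_smul c
  have hint3 : ∀ c : ℂ, CircleIntegrable (fun w => (w - z) ^ (k + 1) • resolvent T w x +
      c • ((w - z) ^ k • resolvent T w x)) z r := fun c => (hint (k + 1)).add (hint2 c)
  have hint4 : ∀ c : ℂ, CircleIntegrable (fun w => (w - z) ^ k • x +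
      ((w - z) ^ (k + 1) • resolvent T w x + c • ((w - z) ^ k • resolvent T w x))) z r :=
    fun c => hint'.add (hint3 c)
  have hzero : ∮ w in C(z, r), (w - z) ^ k • x = 0 := by
    refine Complex.circleIntegral_eq_zero_of_differentiable_on_off_countable hr.le
      Set.countable_empty (by fun_prop) (fun w _ => by fun_prop)
  obtain ⟨w₀, hw₀⟩ : (Metric.sphere z r).Nonempty := (NormedSpace.sphere_nonempty).2 hr.le
  have hw₀ρ := hsphere hw₀
  set I : ℕ → H := fun k => ∮ w in C(z, r), (w - z) ^ k • resolvent T w x with hI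
  -- Integrate the resolvent identity against `(w - z) ^ k`, writing `w - w₀ = (w - z) + (z - w₀)`.
  -- The term `(w - z) ^ k • x` contributes nothing by Cauchy's theorem.
  have key : I k = resolvent T w₀ (I (k + 1) + (z - w₀) • I k) := by
    have e : I (k + 1) + (z - w₀) • I k = ∮ w in C(z, r),
        ((w - z) ^ k • x + ((w - z) ^ (k + 1) • resolvent T w x +
          (z - w₀) • ((w - z) ^ k • resolvent T w x))) := by
      rw [circleIntegral.integral_add hint' (hint3 _), hzero, zero_add,
        circleIntegral.integral_add (hint _) (hint2 _), circleIntegral.integral_smul]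
    rw [e, ← circleIntegral_clm_apply _ (hint4 _)]
    refine circleIntegral.integral_congr hr.le fun w hw => ?_
    have := resolvent_eq_resolvent_apply (hsphere hw) hw₀ρ x
    change (w - z) ^ k • resolvent T w x = _
    conv_lhs => rw [this]
    rw [← map_smul]
    congr 1
    simp only [smul_add, smul_smul, pow_succ]
    rw [← add_smul]
    congr 2
    ring
  have hd : I k ∈ T.domain := by
    rw [key]
    exact resolvent_mem_domain hw₀ρ _
  refine ⟨hd, ?_⟩
  have h1 := apply_resolvent hw₀ρ (I (k + 1) + (z - w₀) • I k)
  have h2 : (⟨I k, hd⟩ : T.domain) = ⟨_, resolvent_mem_domain hw₀ρ _⟩ := Subtype.ext key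
  rw [← h2, ← key] at h1
  refine (shift_apply T z ⟨I k, hd⟩).trans ?_
  rw [h1]
  simp only [hI]
  module

/-- A pole of order at most `m` makes the `m`-th moment of the resolvent the integral of an analytic
function, hence zero. As `T - z` raises the moment by one, `(T - z) ^ m` annihilates the range of
the Riesz projection. The ascent of the kernels also stops at `m`. -/
theorem IsFredholmPoint.hasFiniteAlgebraicMultiplicity {T : H →ₗ.[ℂ] H} {z : ℂ}
    (h : IsFredholmPoint T z) (hz : ∀ᶠ w in 𝓝[≠] z, w ∈ resolventSet T)
    (hker : FiniteDimensional ℂ (kernel (shift T z))) : HasFiniteAlgebraicMultiplicity T z := by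
  obtain ⟨m, Φ, hΦ, hm⟩ := h.exists_pole hz
  have hfin := finiteDimensional_kernelPow hker m
  constructor
  · have hev := hz.and (hm.and (nhdsWithin_le_nhds hΦ.eventually_analyticAt))
    rw [eventually_nhdsWithin_iff, Metric.eventually_nhds_iff] at hev
    obtain ⟨ε, hε, hev⟩ := hev
    have hr : 0 < ε / 2 := by positivity
    have hball : ∀ w ∈ Metric.closedBall z (ε / 2) \ {z}, w ∈ resolventSet T ∧
        (w - z) ^ m • resolvent T w = Φ w ∧ AnalyticAt ℂ Φ w := fun w hw =>
      hev ((Metric.mem_closedBall.1 hw.1).trans_lt (by linarith)) hw.2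
    have hsph : Metric.sphere z (ε / 2) ⊆ Metric.closedBall z (ε / 2) \ {z} := by
      intro w hw
      refine ⟨Metric.sphere_subset_closedBall hw, ?_⟩
      rintro rfl
      simp at hw
      exact hr.ne hw
    have hΦan : ∀ w ∈ Metric.closedBall z (ε / 2), AnalyticAt ℂ Φ w := by
      intro w hw
      by_cases hwz : w = z
      · rw [hwz]; exact hΦ
      · exact (hball w ⟨hw, hwz⟩).2.2
    have hρ : Metric.closedBall z (ε / 2) \ {z} ⊆ resolventSet T := fun w hw => (hball w hw).1
    have hc : ContinuousOn (resolvent T) (Metric.sphere z (ε / 2)) := by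
      have : ContinuousOn (fun w => ((w - z) ^ m)⁻¹ • Φ w) (Metric.sphere z (ε / 2)) := by
        refine ContinuousOn.smul (ContinuousOn.inv₀
          (by fun_prop : Continuous fun w : ℂ => (w - z) ^ m).continuousOn ?_) ?_
        · intro w hw
          exact pow_ne_zero _ (sub_ne_zero.2 (hsph hw).2)
        · intro w hw
          exact (hball w (hsph hw)).2.2.continuousAt.continuousWithinAt
      refine this.congr fun w hw => ?_
      change _ = ((w - z) ^ m)⁻¹ • Φ w
      rw [← (hball w (hsph hw)).2.1, smul_smul, inv_mul_cancel₀, one_smul]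
      exact pow_ne_zero _ (sub_ne_zero.2 (hsph hw).2)
    refine ⟨ε / 2, hr, hρ, ?_⟩
    -- Induction on `j = m - k`, starting from the vanishing moment `k = m`; the case `k = 0` is the
    -- Riesz integral.
    have hmoment : ∀ (x : H) (j k : ℕ), j + k = m →
        (∮ w in C(z, ε / 2), (w - z) ^ k • resolvent T w x) ∈ kernelPow (shift T z) j := by
      intro x j
      induction j with
      | zero =>
        intro k hk
        rw [zero_add] at hk
        subst hk
        have : ∮ w in C(z, ε / 2), (w - z) ^ k • resolvent T w x =
            ∮ w in C(z, ε / 2), Φ w x := by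
          refine circleIntegral.integral_congr hr.le fun w hw => ?_
          rw [← (hball w (hsph hw)).2.1]
          rfl
        rw [this, Complex.circleIntegral_eq_zero_of_differentiable_on_off_countable hr.le
          Set.countable_empty]
        · exact Submodule.zero_mem _
        · intro w hw
          exact ((hΦan w hw).continuousAt.clm_apply continuousAt_const).continuousWithinAt
        · intro w hw
          exact (hΦan w (Metric.ball_subset_closedBall hw.1)).differentiableAt.clm_apply
            (differentiableAt_const _)
      | succ j ih =>
        intro k hk
        obtain ⟨hd, hs⟩ := shift_moment hr hρ hc x k
        refine mem_kernelPow_succ.2 ⟨hd, ?_⟩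
        rw [hs]
        exact ih (k + 1) (by omega)
    refine Submodule.finiteDimensional_of_le (S₂ := kernelPow (shift T z) m) ?_
    rintro _ ⟨x, rfl⟩
    have h0 := hmoment x m 0 (by omega)
    simp only [pow_zero, one_smul] at h0
    have e : rieszProjection T z (ε / 2) x = (-(2 * (Real.pi : ℂ) * Complex.I)⁻¹) •
        ∮ w in C(z, ε / 2), resolvent T w x := by
      rw [rieszProjection, smul_apply]
      congr 1
      exact (circleIntegral_clm_apply (ContinuousLinearMap.apply ℂ H x)
        (hc.circleIntegrable hr.le)).symm
    change rieszProjection T z (ε / 2) x ∈ _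
    rw [e]
    exact Submodule.smul_mem _ _ h0
  · refine Submodule.finiteDimensional_of_le (S₂ := kernelPow (shift T z) m) ?_
    exact iSup_le fun k =>
      kernelPow_le_of_succ_le (kernelPow_succ_le_of_pole hz hΦ.continuousAt hm) k

end

end UnboundedOp

namespace UnboundedOp

open Filter Topology

noncomputable section

variable {H : Type*} [NormedAddCommGroup H] [InnerProductSpace ℂ H]

/-! ### Closed range and finite-dimensional kernel -/

/-- A closed operator with closed range and finite-dimensional kernel is proper on bounded sets. -/
theorem exists_subseq_tendsto_of_isClosed_range [CompleteSpace H] {T : H →ₗ.[ℂ] H}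
    (hT : T.IsClosed) (hr : IsClosed (range T : Set H)) (hk : FiniteDimensional ℂ (kernel T))
    {u : ℕ → T.domain} {M : ℝ} (hb : ∀ n, ‖(u n : H)‖ ≤ M) {y : H}
    (hy : Tendsto (fun n => T (u n)) atTop (𝓝 y)) :
    ∃ (x : H) (φ : ℕ → ℕ), StrictMono φ ∧ Tendsto (fun n => (u (φ n) : H)) atTop (𝓝 x) := by
  have : CompleteSpace T.graph := hT.completeSpace_coe
  have : CompleteSpace (range T) := hr.completeSpace_coe
  -- On the complete graph of `T`, the second projection is a bounded surjection onto the closed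
  -- range. The open mapping theorem supplies preimages with norm control.
  let f : T.graph →L[ℂ] range T :=
    ((ContinuousLinearMap.snd ℂ H H).comp T.graph.subtypeL).codRestrict (range T) (by
      rintro ⟨p, hp⟩
      obtain ⟨v, -, hv⟩ := (LinearPMap.mem_graph_iff T).1 hp
      exact ⟨v, hv⟩)
  have hf : Function.Surjective f := by
    rintro ⟨_, v, rfl⟩
    exact ⟨⟨(v, T v), T.mem_graph v⟩, rfl⟩
  obtain ⟨C, -, hC⟩ := f.exists_preimage_norm_le hf
  have hyr : y ∈ range T := hr.mem_of_tendsto hy (Eventually.of_forall fun n => ⟨u n, rfl⟩)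
  obtain ⟨u₀, hu₀⟩ := hyr
  have hu₀' : T u₀ = y := hu₀
  have hpre : ∀ n, ∃ v : T.domain, T v = T (u n) - y ∧ ‖(v : H)‖ ≤ C * ‖T (u n) - y‖ := by
    intro n
    obtain ⟨g, hg, hgn⟩ := hC ⟨T (u n) - y, by
      rw [← hu₀', ← LinearPMap.map_sub]; exact ⟨u n - u₀, rfl⟩⟩
    obtain ⟨v, hv1, hv2⟩ := (LinearPMap.mem_graph_iff T).1 g.2
    refine ⟨v, ?_, ?_⟩
    · rw [hv2]
      exact congrArg Subtype.val hg
    · rw [hv1]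
      exact (norm_fst_le (g : H × H)).trans hgn
  choose v hv hvn using hpre
  have hv0 : Tendsto (fun n => (v n : H)) atTop (𝓝 0) := by
    have : Tendsto (fun n => C * ‖T (u n) - y‖) atTop (𝓝 0) := by
      have := (tendsto_iff_norm_sub_tendsto_zero.1 hy).const_mul C
      rwa [mul_zero] at this
    exact squeeze_zero_norm hvn this
  -- Subtracting a fixed preimage of `y` and the small preimages `v n` leaves a bounded sequence in
  -- the kernel, where finite dimension gives compactness.
  let N : Submodule ℂ H := (kernel T).map T.domain.subtype
  have hN : FiniteDimensional ℂ N := inferInstance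
  have : ProperSpace N := FiniteDimensional.proper ℂ N
  let k : ℕ → N := fun n => ⟨(u n : H) - u₀ - v n, ⟨u n - u₀ - v n, by
    change T (u n - u₀ - v n) = 0
    rw [LinearPMap.map_sub, LinearPMap.map_sub, hv, hu₀', sub_self], rfl⟩⟩
  have hkb : Bornology.IsBounded (Set.range k) := by
    obtain ⟨M', hM'⟩ := hv0.norm.bddAbove_range
    refine isBounded_iff_forall_norm_le.2 ⟨M + ‖(u₀ : H)‖ + M', ?_⟩
    rintro _ ⟨n, rfl⟩
    have h1 : ‖(v n : H)‖ ≤ M' := hM' ⟨n, rfl⟩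
    calc ‖k n‖ = ‖(u n : H) - u₀ - v n‖ := rfl
      _ ≤ ‖(u n : H)‖ + ‖(u₀ : H)‖ + ‖(v n : H)‖ :=
        (norm_sub_le _ _).trans (add_le_add_left (norm_sub_le _ _) _)
      _ ≤ _ := by linarith [hb n]
  obtain ⟨a, -, φ, hφ, ha⟩ := tendsto_subseq_of_bounded hkb (fun n => Set.mem_range_self n)
  refine ⟨a + u₀ + 0, φ, hφ, ?_⟩
  have h1 : Tendsto (fun n => (k (φ n) : H)) atTop (𝓝 (a : H)) :=
    (continuous_subtype_val.tendsto a).comp ha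
  refine ((h1.add_const (u₀ : H)).add (hv0.comp hφ.tendsto_atTop)).congr fun n => ?_
  simp only [k, Function.comp_apply]
  abel

/-! ### Relatively compact perturbations -/

/-- A linear map that sends bounded sequences to sequences with a convergent subsequence is a
compact operator. -/
theorem isCompactOperator_of_seq {L : H →ₗ[ℂ] H}
    (hL : ∀ x : ℕ → H, (∀ n, ‖x n‖ ≤ 1) → ∃ (y : H) (φ : ℕ → ℕ), StrictMono φ ∧
      Tendsto (fun n => L (x (φ n))) atTop (𝓝 y)) : IsCompactOperator L := by
  rw [isCompactOperator_iff_isCompact_closure_image_closedBall L one_pos]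
  refine IsSeqCompact.isCompact ?_
  intro y hy
  have : ∀ n : ℕ, ∃ x : H, ‖x‖ ≤ 1 ∧ dist (y n) (L x) < 1 / ((n : ℝ) + 1) := by
    intro n
    obtain ⟨_, ⟨x, hx, rfl⟩, hd⟩ := Metric.mem_closure_iff.1 (hy n) (1 / ((n : ℝ) + 1))
      (by positivity)
    exact ⟨x, by simpa using hx, hd⟩
  choose x hx hd using this
  obtain ⟨a, φ, hφ, ha⟩ := hL x hx
  have hya : Tendsto (y ∘ φ) atTop (𝓝 a) := by
    refine (tendsto_iff_of_dist ?_).2 ha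
    have h0 : Tendsto (fun n => dist (y n) (L (x n))) atTop (𝓝 0) :=
      squeeze_zero (fun _ => dist_nonneg) (fun n => (hd n).le) tendsto_one_div_add_atTop_nhds_zero_nat
    exact h0.comp hφ.tendsto_atTop
  exact ⟨a, isClosed_closure.mem_of_tendsto hya (Eventually.of_forall fun n => hy _), φ, hφ, hya⟩

/-- The operator `T + V` for `V` defined on the domain of `T`. -/
def perturb (T : H →ₗ.[ℂ] H) (V : T.domain →ₗ[ℂ] H) : H →ₗ.[ℂ] H := ⟨T.domain, T.toFun + V⟩

theorem perturb_apply (T : H →ₗ.[ℂ] H) (V : T.domain →ₗ[ℂ] H) (u : T.domain) :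
    perturb T V u = T u + V u := rfl

/-- `V` maps graph-norm bounded sequences to sequences with a convergent subsequence. -/
def IsGraphCompact (T : H →ₗ.[ℂ] H) (V : T.domain →ₗ[ℂ] H) : Prop :=
  ∀ u : ℕ → T.domain, (∃ C : ℝ, ∀ n, ‖(u n : H)‖ ≤ C ∧ ‖T (u n)‖ ≤ C) →
    ∃ (y : H) (φ : ℕ → ℕ), StrictMono φ ∧ Tendsto (fun n => V (u (φ n))) atTop (𝓝 y)

/-- Take `L = V (T - z)⁻¹`. The resolvent sends bounded sequences to sequences bounded in the graph
norm, on which `V` is compact. -/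
theorem IsGraphCompact.exists_factorization {T : H →ₗ.[ℂ] H} {V : T.domain →ₗ[ℂ] H}
    (hV : IsGraphCompact T V) {z : ℂ} (hz : z ∈ resolventSet T) :
    ∃ L : H →L[ℂ] H, TotallyBounded (L '' Metric.closedBall 0 1) ∧
      Factorization (perturb T V) z (resolvent T z) (1 + L) := by
  let R : H →ₗ[ℂ] T.domain := (resolvent T z).toLinearMap.codRestrict T.domain
    (resolvent_mem_domain hz)
  have hTR : ∀ x, T (R x) = x + z • resolvent T z x := apply_resolvent hz
  have hcomp : IsCompactOperator (V ∘ₗ R) := by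
    refine isCompactOperator_of_seq fun x hx => hV (fun n => R (x n)) ?_
    refine ⟨1 + (‖z‖ + 1) * ‖resolvent T z‖, fun n => ?_⟩
    have h1 : ‖resolvent T z (x n)‖ ≤ ‖resolvent T z‖ :=
      (ContinuousLinearMap.le_opNorm _ _).trans
        (mul_le_of_le_one_right (norm_nonneg _) (hx n))
    have h0 := norm_nonneg (resolvent T z)
    have hz0 := norm_nonneg z
    constructor
    · refine h1.trans ?_
      nlinarith
    · rw [hTR]
      refine (norm_add_le _ _).trans ?_
      rw [norm_smul]
      have := mul_le_mul_of_nonneg_left h1 hz0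
      linarith [hx n]
  -- `V` is not assumed bounded; the continuity of `V (T - z)⁻¹` is a consequence of its
  -- compactness.
  refine ⟨ContinuousLinearMap.mkOfIsCompactOperator hcomp, ?_, ?_⟩
  · exact (hcomp.isCompact_closure_image_closedBall 1).totallyBounded.subset subset_closure
  · refine ⟨?_, ?_, ?_⟩
    · intro x y hxy
      have hR : R x = R y := Subtype.ext hxy
      have h1 := hTR x
      rw [hR, hTR y, ← hxy] at h1
      exact (add_right_cancel h1).symm
    · ext u
      constructor
      · intro hu
        exact ⟨_, resolvent_apply_sub hz ⟨u, hu⟩⟩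
      · rintro ⟨x, rfl⟩
        exact resolvent_mem_domain hz x
    · intro x hx
      refine (congrArg (· - z • resolvent T z x) (perturb_apply T V (R x))).trans ?_
      change T (R x) + V (R x) - z • resolvent T z x = x + V (R x)
      rw [hTR]
      abel

theorem IsGraphCompact.isFredholmPoint [CompleteSpace H] {T : H →ₗ.[ℂ] H} {V : T.domain →ₗ[ℂ] H}
    (hV : IsGraphCompact T V) {z : ℂ} (hz : z ∈ resolventSet T) :
    IsFredholmPoint (perturb T V) z := by
  obtain ⟨L, hL, hfac⟩ := hV.exists_factorization hz
  obtain ⟨N, hN, C, A, B, h1, h2, h3⟩ := exists_eq_add_comp_of_totallyBounded L hL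
  rw [h3] at hfac
  exact hfac.isFredholmPoint h1 h2

theorem IsGraphCompact.mem_Delta4 [CompleteSpace H] {T : H →ₗ.[ℂ] H} {V : T.domain →ₗ[ℂ] H}
    (hV : IsGraphCompact T V) {z : ℂ} (hz : z ∈ resolventSet T)
    (hcl : (shift (perturb T V) z).IsClosed) : z ∈ Delta4 (perturb T V) := by
  obtain ⟨L, hL, hfac⟩ := hV.exists_factorization hz
  obtain ⟨N, hN, C, A, B, h1, h2, h3⟩ := exists_eq_add_comp_of_totallyBounded L hL
  rw [h3] at hfac
  exact hfac.mem_Delta4 h1 h2 hcl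

/-- A singular sequence for `T` at `z` excludes that `T + V - z` has closed range and
finite-dimensional kernel. -/
theorem IsGraphCompact.not_isClosed_range [CompleteSpace H] {T : H →ₗ.[ℂ] H}
    {V : T.domain →ₗ[ℂ] H} (hV : IsGraphCompact T V) {z : ℂ} {u : ℕ → T.domain}
    (hu : ∀ n, ‖(u n : H)‖ = 1) (hu2 : ∀ m n, m ≠ n → 1 ≤ ‖(u m : H) - u n‖)
    (hu3 : Tendsto (fun n => shift T z (u n)) atTop (𝓝 0))
    (hcl : (shift (perturb T V) z).IsClosed)
    (hr : IsClosed (range (shift (perturb T V) z) : Set H)) :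
    ¬ FiniteDimensional ℂ (kernel (shift (perturb T V) z)) := by
  intro hk
  have hu3' : Tendsto (fun n => T (u n) - z • (u n : H)) atTop (𝓝 0) := hu3
  obtain ⟨M, hM⟩ := hu3'.norm.bddAbove_range
  obtain ⟨y, φ, hφ, hy⟩ := hV u ⟨max 1 (M + ‖z‖), fun n => ⟨(hu n).le.trans (le_max_left _ _), by
    have h1 : ‖T (u n) - z • (u n : H)‖ ≤ M := hM ⟨n, rfl⟩
    have h2 : ‖z • (u n : H)‖ = ‖z‖ := by rw [norm_smul, hu, mul_one]
    have h3 := norm_sub_norm_le (T (u n)) (z • (u n : H))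
    exact le_trans (by linarith) (le_max_right _ _)⟩⟩
  have hlim : Tendsto (fun n => shift (perturb T V) z (u (φ n))) atTop (𝓝 (0 + y)) := by
    refine ((hu3'.comp hφ.tendsto_atTop).add hy).congr fun n => ?_
    change T (u (φ n)) - z • (u (φ n) : H) + V (u (φ n)) =
      T (u (φ n)) + V (u (φ n)) - z • (u (φ n) : H)
    abel
  -- Closed range and finite-dimensional kernel would give a convergent subsequence of vectors that
  -- stay at mutual distance at least one.
  obtain ⟨x, ψ, hψ, hx⟩ := exists_subseq_tendsto_of_isClosed_range hcl hr hk
    (u := fun n => u (φ n)) (fun n => (hu _).le) hlim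
  have hc := hx.cauchySeq
  rw [Metric.cauchySeq_iff] at hc
  obtain ⟨N, hN⟩ := hc 1 one_pos
  have h1 := hN N le_rfl (N + 1) (Nat.le_succ N)
  have h2 := hu2 (φ (ψ N)) (φ (ψ (N + 1)))
    ((hφ.comp hψ).injective.ne (Nat.succ_ne_self N).symm)
  rw [dist_eq_norm] at h1
  exact absurd h1 (not_lt.2 h2)

/-- A relatively compact perturbation of a symmetric operator has no eigenvalues `i y` with
large `y`. -/
theorem IsGraphCompact.exists_mem_resolventSet [CompleteSpace H] {T : H →ₗ.[ℂ] H}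
    {V : T.domain →ₗ[ℂ] H} (hV : IsGraphCompact T V) (hd : Dense (T.domain : Set H))
    (hsymm : ∀ u v : T.domain, inner ℂ (T u) (v : H) = inner ℂ (u : H) (T v))
    (hres : ∀ y : ℝ, y ≠ 0 → (y * Complex.I : ℂ) ∈ resolventSet T) :
    ∃ y : ℝ, 0 < y ∧ (y * Complex.I : ℂ) ∈ resolventSet (perturb T V) := by
  by_contra! hcon
  -- By the Fredholm alternative, failure of the claim makes every `i (n + 1)` an eigenvalue. The
  -- eigenvectors are normalized in the graph norm, so `V` is compact along them; the contradiction
  -- will be that both `u n` and `T (u n)` tend to zero.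
  have hex : ∀ n : ℕ, ∃ u : T.domain, ‖(u : H)‖ + ‖T u‖ = 1 ∧
      T u + V u = (((n : ℝ) + 1 : ℝ) * Complex.I : ℂ) • (u : H) := by
    intro n
    have hn : (0 : ℝ) < (n : ℝ) + 1 := by positivity
    obtain ⟨u', hu0, hu⟩ := (hV.isFredholmPoint (hres _ hn.ne')).isEigenvalue (hcon _ hn)
    -- The domain of `perturb T V` is that of `T` by definition; the vector is only retyped.
    obtain ⟨u, rfl⟩ : ∃ u : T.domain, u = u' := ⟨u', rfl⟩
    have hu' : T u + V u = (((n : ℝ) + 1 : ℝ) * Complex.I : ℂ) • (u : H) := hu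
    have hpos : 0 < ‖(u : H)‖ + ‖T u‖ := by
      have : 0 < ‖(u : H)‖ := norm_pos_iff.2 fun h => hu0 (Subtype.ext h)
      linarith [norm_nonneg (T u)]
    set s := ‖(u : H)‖ + ‖T u‖
    have hs : ‖((s⁻¹ : ℝ) : ℂ)‖ = s⁻¹ := by
      rw [Complex.norm_real, Real.norm_of_nonneg (inv_nonneg.2 hpos.le)]
    refine ⟨((s⁻¹ : ℝ) : ℂ) • (u : T.domain), ?_, ?_⟩
    · rw [LinearPMap.map_smul]
      change ‖((s⁻¹ : ℝ) : ℂ) • (u : H)‖ + _ = 1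
      rw [norm_smul, norm_smul, hs, ← mul_add]
      exact inv_mul_cancel₀ hpos.ne'
    · rw [LinearPMap.map_smul, map_smul, ← smul_add]
      refine (congrArg (((s⁻¹ : ℝ) : ℂ) • ·) hu').trans ?_
      exact smul_comm _ _ _
  choose u hu hTu using hex
  have hle1 : ∀ n, ‖(u n : H)‖ ≤ 1 := fun n => by linarith [hu n, norm_nonneg (T (u n))]
  have hle2 : ∀ n, ‖T (u n)‖ ≤ 1 := fun n => by linarith [hu n, norm_nonneg (u n : H)]
  obtain ⟨w, φ, hφ, hw⟩ := hV u ⟨1, fun n => ⟨hle1 n, hle2 n⟩⟩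
  have hVn : ∀ n, V (u n) = (((n : ℝ) + 1 : ℝ) * Complex.I : ℂ) • (u n : H) - T (u n) := fun n => by
    rw [← hTu n]; abel
  have him : ∀ n, (inner ℂ (u n : H) (T (u n))).im = 0 := by
    intro n
    have h1 := inner_conj_symm (𝕜 := ℂ) (u n : H) (T (u n))
    rw [hsymm] at h1
    exact Complex.conj_eq_iff_im.1 h1
  -- Since `⟨u, T u⟩` is real, the imaginary part of `⟨u, V u⟩` equals `(n + 1) ‖u‖²`.
  have hunorm : ∀ n : ℕ, ((n : ℝ) + 1) * ‖(u n : H)‖ ≤ ‖V (u n)‖ := by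
    intro n
    have h1 : inner ℂ (u n : H) (V (u n)) =
        (((n : ℝ) + 1 : ℝ) * Complex.I : ℂ) * ((‖(u n : H)‖ ^ 2 : ℝ) : ℂ) -
          inner ℂ (u n : H) (T (u n)) := by
      rw [hVn, inner_sub_right, inner_smul_right, inner_self_eq_norm_sq_to_K]
      norm_cast
    have h2 : (inner ℂ (u n : H) (V (u n))).im = ((n : ℝ) + 1) * ‖(u n : H)‖ ^ 2 := by
      rw [h1, Complex.sub_im, him, sub_zero, Complex.im_mul_ofReal]
      simp
    have h3 : ((n : ℝ) + 1) * ‖(u n : H)‖ ^ 2 ≤ ‖(u n : H)‖ * ‖V (u n)‖ := by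
      rw [← h2]
      exact ((Complex.abs_im_le_norm _).trans (norm_inner_le_norm _ _)).trans' (le_abs_self _)
    by_cases h0 : ‖(u n : H)‖ = 0
    · rw [h0, mul_zero]; exact norm_nonneg _
    · have hp : 0 < ‖(u n : H)‖ := lt_of_le_of_ne (norm_nonneg _) (Ne.symm h0)
      refine le_of_mul_le_mul_left ?_ hp
      linarith [h3, sq ‖(u n : H)‖, mul_comm (((n : ℝ) + 1) * ‖(u n : H)‖) ‖(u n : H)‖,
        mul_assoc ((n : ℝ) + 1) ‖(u n : H)‖ ‖(u n : H)‖]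
  -- The real part of `⟨V u, T u⟩` is `-‖T u‖²`. Replacing `V u` by a vector `d` of the domain
  -- allows `T` to be moved onto `d`, leaving a factor `‖u‖` that tends to zero.
  have hTd : ∀ (n : ℕ) (d : T.domain),
      ‖T (u n)‖ ^ 2 ≤ ‖T d‖ * ‖(u n : H)‖ + ‖V (u n) - d‖ := by
    intro n d
    have h1 : (inner ℂ (V (u n)) (T (u n))).re = -‖T (u n)‖ ^ 2 := by
      have h0 : inner ℂ (V (u n)) (T (u n)) =
          -(((n : ℝ) + 1 : ℝ) * Complex.I : ℂ) * inner ℂ (u n : H) (T (u n)) -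
            ((‖T (u n)‖ ^ 2 : ℝ) : ℂ) := by
        rw [hVn, inner_sub_left, inner_smul_left, inner_self_eq_norm_sq_to_K]
        simp
      rw [h0, Complex.sub_re, Complex.mul_re, him, Complex.ofReal_re]
      simp
    have h2 : inner ℂ (V (u n)) (T (u n)) =
        inner ℂ (T d) (u n : H) + inner ℂ (V (u n) - d) (T (u n)) := by
      rw [hsymm, ← inner_add_left]
      congr 1
      abel
    have h3 : ‖inner ℂ (V (u n)) (T (u n))‖ ≤ ‖T d‖ * ‖(u n : H)‖ + ‖V (u n) - d‖ := by
      rw [h2]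
      refine (norm_add_le _ _).trans (add_le_add (norm_inner_le_norm _ _) ?_)
      exact (norm_inner_le_norm _ _).trans (mul_le_of_le_one_right (norm_nonneg _) (hle2 n))
    have h4 := Complex.abs_re_le_norm (inner ℂ (V (u n)) (T (u n)))
    rw [h1, abs_neg, abs_of_nonneg (by positivity)] at h4
    exact h4.trans h3
  have hu0 : Tendsto (fun n => ‖(u (φ n) : H)‖) atTop (𝓝 0) := by
    obtain ⟨M, hM⟩ := hw.norm.bddAbove_range
    have h1 : Tendsto (fun n : ℕ => M * (1 / ((φ n : ℝ) + 1))) atTop (𝓝 0) := by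
      have := (tendsto_one_div_add_atTop_nhds_zero_nat (𝕜 := ℝ)).comp hφ.tendsto_atTop
      simpa using this.const_mul M
    refine squeeze_zero (fun _ => norm_nonneg _) (fun n => ?_) h1
    have h2 : ‖V (u (φ n))‖ ≤ M := hM ⟨n, rfl⟩
    have h3 := hunorm (φ n)
    rw [mul_one_div, le_div_iff₀ (by positivity)]
    linarith
  have hT0 : Tendsto (fun n => ‖T (u (φ n))‖) atTop (𝓝 0) := by
    rw [Metric.tendsto_atTop]
    intro ε hε
    -- The limit of `V (u (φ n))` need not lie in the domain of `T`, so density is needed; the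
    -- tolerance is quadratic because `‖T u‖²` is estimated.
    obtain ⟨d, hdD, hdw⟩ := hd.exists_dist_lt w (ε := ε ^ 2 / 2) (by positivity)
    have hlim : Tendsto (fun n => ‖T ⟨d, hdD⟩‖ * ‖(u (φ n) : H)‖ + ‖V (u (φ n)) - d‖) atTop
        (𝓝 (‖T ⟨d, hdD⟩‖ * 0 + ‖w - d‖)) :=
      (hu0.const_mul _).add (hw.sub_const d).norm
    have hlt : ‖T ⟨d, hdD⟩‖ * 0 + ‖w - d‖ < ε ^ 2 := by
      rw [dist_eq_norm] at hdw
      nlinarith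
    obtain ⟨N, hN⟩ := eventually_atTop.1 (hlim.eventually_lt_const hlt)
    refine ⟨N, fun n hn => ?_⟩
    rw [dist_zero_right, norm_norm]
    have := (hTd (φ n) ⟨d, hdD⟩).trans_lt (hN n hn)
    exact lt_of_pow_lt_pow_left₀ 2 hε.le this
  have hsum := hu0.add hT0
  have : Tendsto (fun n => ‖(u (φ n) : H)‖ + ‖T (u (φ n))‖) atTop (𝓝 1) := by
    simp only [hu]
    exact tendsto_const_nhds
  have h01 := tendsto_nhds_unique hsum this
  norm_num at h01

/-! ### Symmetries of the spectrum -/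

/-- If `T' = c J T J` with an involution `J` and `c ^ 2 = 1`, then `ρ(T') ⊇ c ρ(T)`. -/
theorem mem_resolventSet_of_conj {T T' : H →ₗ.[ℂ] H} {J : H →L[ℂ] H} (hJ : ∀ x, J (J x) = x)
    {c : ℂ} (hc : c * c = 1)
    (h : ∀ u : T.domain, ∃ h' : J u ∈ T'.domain, T' ⟨J u, h'⟩ = c • J (T u))
    (h2 : ∀ u : T'.domain, J u ∈ T.domain) {z : ℂ} (hz : z ∈ resolventSet T) :
    c * z ∈ resolventSet T' := by
  refine ⟨c • (J * (resolvent T z * J)), fun x => ?_, fun u => ?_⟩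
  · obtain ⟨hm, hv⟩ := h ⟨_, resolvent_mem_domain hz (J x)⟩
    have hm' : (c • (J * (resolvent T z * J)) : H →L[ℂ] H) x ∈ T'.domain :=
      Submodule.smul_mem _ c hm
    refine ⟨hm', ?_⟩
    have e : (⟨_, hm'⟩ : T'.domain) = c • ⟨_, hm⟩ := rfl
    refine (shift_apply T' (c * z) ⟨_, hm'⟩).trans ?_
    rw [e, LinearPMap.map_smul, hv, apply_resolvent hz, map_add, hJ, map_smul, smul_smul, hc,
      one_smul]
    change x + z • J (resolvent T z (J x)) - (c * z) • c • J (resolvent T z (J x)) = x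
    rw [smul_smul, mul_right_comm, hc, one_mul, add_sub_cancel_right]
  · obtain ⟨hm, hv⟩ := h ⟨_, h2 u⟩
    have e : (⟨J (J u), hm⟩ : T'.domain) = u := Subtype.ext (hJ u)
    rw [e] at hv
    have e2 : shift T' (c * z) u = c • J (T ⟨_, h2 u⟩ - z • J u) := by
      refine (shift_apply T' (c * z) u).trans ?_
      rw [hv, map_sub, map_smul, hJ, smul_sub, smul_smul]
    refine (congrArg _ e2).trans ?_
    change c • J (resolvent T z (J (c • J (T ⟨_, h2 u⟩ - z • J u)))) = u
    rw [map_smul, map_smul, map_smul, hJ, smul_smul, hc, one_smul,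
      resolvent_apply_sub hz ⟨_, h2 u⟩, hJ]

section Symmetric

variable {T : H →ₗ.[ℂ] H} {J : H →L[ℂ] H}

/-- If `J T` is symmetric, then `J` maps the kernel of `T - z` to the orthogonal complement of the
range of `T - conj z`. -/
theorem map_kernel_le_orthogonal (hJs : ∀ x y, inner ℂ (J x) y = inner ℂ x (J y))
    (hT : ∀ u v : T.domain, inner ℂ (J (T u)) (v : H) = inner ℂ (u : H) (J (T v))) {z : ℂ}
    {u : T.domain} (hu : T u = z • (u : H)) :
    J u ∈ (range (shift T (starRingEnd ℂ z)))ᗮ := by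
  rw [Submodule.mem_orthogonal]
  rintro _ ⟨v', rfl⟩
  obtain ⟨v, rfl⟩ : ∃ v : T.domain, v = v' := ⟨v', rfl⟩
  change inner ℂ (T v - (starRingEnd ℂ z) • (v : H)) (J (u : H)) = 0
  rw [← hJs, map_sub, inner_sub_left, hT, hu, map_smul, map_smul, inner_smul_left,
    inner_smul_right, Complex.conj_conj, hJs, sub_self]

/-- If `T - conj z` were surjective, the nonzero vector `J u` would be orthogonal to the whole
space. -/
theorem IsEigenvalue.conj_notMem_resolventSet (hJ : ∀ x, J (J x) = x)
    (hJs : ∀ x y, inner ℂ (J x) y = inner ℂ x (J y))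
    (hT : ∀ u v : T.domain, inner ℂ (J (T u)) (v : H) = inner ℂ (u : H) (J (T v))) {z : ℂ}
    (hz : IsEigenvalue T z) : starRingEnd ℂ z ∉ resolventSet T := by
  intro hρ
  obtain ⟨u, hu0, hu⟩ := hz
  have h := map_kernel_le_orthogonal hJs hT hu
  have h1 : J (u : H) ∈ range (shift T (starRingEnd ℂ z)) := by
    obtain ⟨hm, hv⟩ := (isBoundedInverse_resolvent hρ).1 (J u)
    exact ⟨⟨_, hm⟩, hv⟩
  have h2 : J (u : H) = 0 := inner_self_eq_zero.1 ((Submodule.mem_orthogonal _ _).1 h _ h1)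
  apply hu0
  apply Subtype.ext
  rw [← hJ u, h2, map_zero]
  rfl

/-- At a real point `J` embeds the kernel into the cokernel. This reduces the semi-Fredholm
alternative to the case of a finite-dimensional kernel. -/
theorem finiteDimensional_kernel_of_coker (hJ : ∀ x, J (J x) = x)
    (hJs : ∀ x y, inner ℂ (J x) y = inner ℂ x (J y))
    (hT : ∀ u v : T.domain, inner ℂ (J (T u)) (v : H) = inner ℂ (u : H) (J (T v))) {z : ℂ}
    (hz : starRingEnd ℂ z = z) (h : FiniteDimensional ℂ (range (shift T z))ᗮ) :
    FiniteDimensional ℂ (kernel (shift T z)) := by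
  let f : kernel (shift T z) →ₗ[ℂ] (range (shift T z))ᗮ :=
    (J.toLinearMap ∘ₗ T.domain.subtype ∘ₗ (kernel (shift T z)).subtype).codRestrict _ (by
      intro u
      have hu : T u.1 - z • (u.1 : H) = 0 := u.2
      have := map_kernel_le_orthogonal hJs hT (sub_eq_zero.1 hu)
      rwa [hz] at this)
  refine FiniteDimensional.of_injective f ?_
  intro u v huv
  have h1 : J (u.1 : H) = J (v.1 : H) := congrArg Subtype.val huv
  refine Subtype.ext (Subtype.ext ?_)
  rw [← hJ (u.1 : H), h1, hJ]

open scoped LinearPMap in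
/-- If `J T` is symmetric and both `w` and `conj w` lie in the resolvent set, then the adjoint of
`T` is `J T J`, and has the same spectrum. -/
theorem spectrum_adjoint_eq [CompleteSpace H] (hd : Dense (T.domain : Set H))
    (hJ : ∀ x, J (J x) = x)
    (hJs : ∀ x y, inner ℂ (J x) y = inner ℂ x (J y))
    (hT : ∀ u v : T.domain, inner ℂ (J (T u)) (v : H) = inner ℂ (u : H) (J (T v))) {w : ℂ}
    (hw : w ∈ resolventSet T) (hw' : starRingEnd ℂ w ∈ resolventSet T) :
    spectrum T† = spectrum T := by
  have hsub : ∀ u : T.domain, ∃ h' : J u ∈ T†.domain, T† ⟨J u, h'⟩ = (1 : ℂ) • J (T u) := by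
    intro u
    have hex : ∀ x : T.domain, inner ℂ (J (T u)) (x : H) = inner ℂ (J (u : H)) (T x) := by
      intro x
      rw [hT, hJs]
    have hm := LinearPMap.mem_adjoint_domain_of_exists (T := T) (J u) ⟨J (T u), hex⟩
    exact ⟨hm, by rw [one_smul]; exact LinearPMap.adjoint_apply_eq hd ⟨_, hm⟩ hex⟩
  -- The vector `v = J (T - w)⁻¹ J f` solves `(T† - w) v = (T† - w) u`. The difference `u - v` is
  -- then in the kernel of `T† - w`, hence orthogonal to the range of `T - conj w`, which is
  -- everything.
  have hdom : ∀ u : T†.domain, J u ∈ T.domain := by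
    intro u
    set f : H := T† u - w • (u : H) with hf
    obtain ⟨hm, hv⟩ := hsub ⟨_, resolvent_mem_domain hw (J f)⟩
    set v : T†.domain := ⟨_, hm⟩ with hvdef
    have hvw : T† v - w • (v : H) = f := by
      rw [hv, one_smul, apply_resolvent hw, map_add, hJ, map_smul]
      change f + _ - w • J (resolvent T w (J f)) = f
      rw [add_sub_cancel_right]
    have heig : T† (u - v) = w • ((u : H) - v) := by
      rw [LinearPMap.map_sub]
      rw [sub_eq_iff_eq_add] at hvw
      rw [hvw, hf, smul_sub]
      abel
    have horth : (u : H) - v = 0 := by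
      have h1 := apply_resolvent hw' ((u : H) - v)
      have h2 := LinearPMap.adjoint_isFormalAdjoint hd (u - v)
        ⟨_, resolvent_mem_domain hw' ((u : H) - v)⟩
      rw [heig, h1, inner_smul_left, inner_add_right, inner_smul_right] at h2
      have h3 : inner ℂ ((u : H) - v) ((u : H) - v) = (0 : ℂ) := by
        have e : ((u - v : T†.domain) : H) = (u : H) - v := rfl
        rw [e] at h2
        linear_combination -h2
      exact inner_self_eq_zero.1 h3
    rw [sub_eq_zero] at horth
    rw [horth]
    change J (J _) ∈ _
    rw [hJ]
    exact resolvent_mem_domain hw _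
  have hsub' : ∀ u : T†.domain, ∃ h' : J u ∈ T.domain, T ⟨J u, h'⟩ = (1 : ℂ) • J (T† u) := by
    intro u
    refine ⟨hdom u, ?_⟩
    obtain ⟨hm, hv⟩ := hsub ⟨_, hdom u⟩
    have e : (⟨J (J u), hm⟩ : T†.domain) = u := Subtype.ext (hJ u)
    rw [e] at hv
    rw [hv, one_smul, one_smul, hJ]
  unfold spectrum
  congr 1
  ext z
  constructor
  · intro hz
    have := mem_resolventSet_of_conj hJ (mul_one (1 : ℂ)) hsub' (fun u => (hsub u).1) hz
    rwa [one_mul] at this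
  · intro hz
    have := mem_resolventSet_of_conj hJ (mul_one (1 : ℂ)) hsub hdom hz
    rwa [one_mul] at this

end Symmetric

end

end UnboundedOp

namespace MatrixSchrodinger

open MeasureTheory Filter Topology TemperedDistribution FourierTransform
open scoped SchwartzMap Laplacian ENNReal ContDiff

noncomputable section

/-! ### The Laplacian in Fourier space -/

section Fourier

variable {d : ℕ} {F : Type*} [NormedAddCommGroup F] [InnerProductSpace ℂ F] [CompleteSpace F]

/-- The symbol `(2π|ξ|)²` of `-Δ`. -/
def symbol (ξ : Space d) : ℝ := (2 * Real.pi) ^ 2 * ‖ξ‖ ^ 2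

theorem symbol_nonneg (ξ : Space d) : 0 ≤ symbol ξ := by unfold symbol; positivity

theorem continuous_symbol : Continuous (symbol : Space d → ℝ) := by unfold symbol; fun_prop

theorem fourier_toDistr (f : L2 d F) : 𝓕 (toDistr d F f) = toDistr d F (𝓕 f) :=
  Lp.fourier_toTemperedDistribution_eq f

theorem toDistr_apply (f : L2 d F) (u : 𝓢(Space d, ℂ)) : toDistr d F f u = ∫ x, u x • f x :=
  Lp.toTemperedDistribution_apply f u

/-- The product `g f` need not be in `L²`, but it is locally integrable, so testing against
compactly supported smooth functions suffices to identify it. -/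
theorem smulLeftCLM_toDistr_eq_iff {g : Space d → ℂ} (hg : g.HasTemperateGrowth) (f h : L2 d F) :
    smulLeftCLM F g (toDistr d F f) = toDistr d F h ↔ h =ᵐ[volume] fun x => g x • f x := by
  constructor
  · intro hfh
    have hloc : LocallyIntegrable (fun x => g x • f x) (volume : Measure (Space d)) :=
      ((Lp.memLp f).locallyIntegrable one_le_two).continuous_smul hg.1.continuous
    refine ae_eq_of_integral_contDiff_smul_eq ((Lp.memLp h).locallyIntegrable one_le_two) hloc ?_
    intro φ hφ hφc
    have hg₁ : HasCompactSupport (Complex.ofRealCLM ∘ φ) := hφc.comp_left rfl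
    have hg₂ : ContDiff ℝ ∞ (Complex.ofRealCLM ∘ φ) := by fun_prop
    have := congrArg (fun T : 𝓢'(Space d, F) => T (hg₁.toSchwartzMap hg₂)) hfh
    simp only [smulLeftCLM_apply_apply, toDistr_apply] at this
    rw [SchwartzMap.smulLeftCLM_apply hg] at this
    simp only [HasCompactSupport.toSchwartzMap_toFun, Function.comp_apply, Complex.ofRealCLM_apply,
      smul_eq_mul] at this
    simp only [← Complex.coe_smul, smul_smul, mul_comm _ (g _)]
    exact this.symm
  · intro hfh
    ext u
    simp only [smulLeftCLM_apply_apply, toDistr_apply]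
    refine integral_congr_ae ?_
    filter_upwards [hfh] with x hx
    rw [hx, SchwartzMap.smulLeftCLM_apply_apply hg, smul_smul, smul_eq_mul, mul_comm]

theorem toDistr_laplacian (f : (laplacian d F).domain) :
    toDistr d F (laplacian d F f) = Δ (toDistr d F (f : L2 d F)) :=
  (exists_laplacian d F f).choose_spec

/-- Converts the Sobolev weight into the symbol of `-Δ`: after rescaling by `(2π)²` the two products
differ by a multiple of `f`, which is in `L²`. -/
theorem memLp_one_add_norm_sq_iff {F : Type*} [NormedAddCommGroup F] [NormedSpace ℂ F]
    {f : Space d → F} (hf : MemLp f 2 volume) :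
    MemLp (fun ξ => ((1 + ‖ξ‖ ^ 2 : ℝ) : ℂ) • f ξ) 2 (volume : Measure (Space d)) ↔
      MemLp (fun ξ => (symbol ξ : ℂ) • f ξ) 2 (volume : Measure (Space d)) := by
  have hpi : ((2 * Real.pi : ℝ) : ℂ) ^ 2 ≠ 0 := by
    have := Real.pi_pos
    exact_mod_cast (by positivity : (2 * Real.pi) ^ 2 ≠ 0)
  constructor
  · intro h
    refine ((h.sub hf).const_smul (((2 * Real.pi : ℝ) : ℂ) ^ 2)).ae_eq ?_
    refine Eventually.of_forall fun ξ => ?_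
    simp only [Pi.smul_apply, Pi.sub_apply, symbol]
    push_cast
    module
  · intro h
    refine (hf.add (h.const_smul ((((2 * Real.pi : ℝ) : ℂ) ^ 2)⁻¹))).ae_eq ?_
    refine Eventually.of_forall fun ξ => ?_
    simp only [Pi.smul_apply, Pi.add_apply, symbol]
    rw [smul_smul]
    push_cast at hpi ⊢
    rw [inv_mul_cancel_left₀ hpi]
    module

theorem mem_laplacian_domain_iff (f : L2 d F) :
    f ∈ (laplacian d F).domain ↔
      MemLp (fun ξ => (symbol ξ : ℂ) • (𝓕 f : L2 d F) ξ) 2 (volume : Measure (Space d)) := by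
  rw [← memLp_one_add_norm_sq_iff (Lp.memLp _)]
  have h1 : f ∈ (laplacian d F).domain ↔ MemSobolev 2 2 (toDistr d F f) := Iff.rfl
  rw [h1, memSobolev_iff_exists_smulLeftCLM_fourier, fourier_toDistr]
  have e : (fun x : Space d => (((1 + ‖x‖ ^ 2) ^ ((2 : ℝ) / 2) : ℝ) : ℂ)) =
      fun x : Space d => ((1 + ‖x‖ ^ 2 : ℝ) : ℂ) := by
    ext x
    rw [div_self two_ne_zero, Real.rpow_one]
  rw [e]
  have hg : (fun x : Space d => ((1 + ‖x‖ ^ 2 : ℝ) : ℂ)).HasTemperateGrowth := by fun_prop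
  constructor
  · rintro ⟨h, hh⟩
    have := (smulLeftCLM_toDistr_eq_iff hg (𝓕 f) h).1 hh
    exact (Lp.memLp h).ae_eq this
  · intro h
    exact ⟨h.toLp _, (smulLeftCLM_toDistr_eq_iff hg (𝓕 f) _).2 h.coeFn_toLp⟩

theorem fourier_laplacian (f : (laplacian d F).domain) :
    (𝓕 (laplacian d F f) : L2 d F) =ᵐ[volume]
      fun ξ => -(symbol ξ : ℂ) • (𝓕 (f : L2 d F) : L2 d F) ξ := by
  have hg : (fun x : Space d => -(symbol x : ℂ)).HasTemperateGrowth := by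
    unfold symbol
    fun_prop
  refine (smulLeftCLM_toDistr_eq_iff hg _ _).1 ?_
  rw [← fourier_toDistr, ← fourier_toDistr, toDistr_laplacian, laplacian_eq_fourierMultiplierCLM]
  rw [fourierMultiplierCLM_apply]
  have e : (fun x : Space d => -(symbol x : ℂ)) =
      (-((2 * Real.pi : ℝ) : ℂ) ^ 2) • fun x : Space d => ((‖x‖ ^ 2 : ℝ) : ℂ) := by
    ext x
    simp [symbol]
  rw [e, smulLeftCLM_smul (by fun_prop), ← Complex.coe_smul, FourierTransform.fourier_smul,
    fourier_fourierInv_eq]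
  simp

theorem fourier_injective {f g : L2 d F} (h : (𝓕 f : L2 d F) =ᵐ[volume] (𝓕 g : L2 d F)) : f = g :=
  (Lp.fourierTransformₗᵢ (Space d) F).injective (Lp.ext h)

/-- The Fourier multiplier with bounded symbol `a`. -/
def fourierMul {a : Space d → ℂ} (ha : MemLp a ∞ (volume : Measure (Space d))) :
    L2 d F →L[ℂ] L2 d F :=
  (Lp.fourierTransformₗᵢ (Space d) F).symm.toContinuousLinearEquiv.toContinuousLinearMap ∘L
    ((ContinuousLinearMap.lsmul ℂ ℂ).holderL volume ∞ 2 2 (ha.toLp a)) ∘L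
      (Lp.fourierTransformₗᵢ (Space d) F).toContinuousLinearEquiv.toContinuousLinearMap

theorem fourier_fourierMul {a : Space d → ℂ} (ha : MemLp a ∞ (volume : Measure (Space d)))
    (f : L2 d F) :
    (𝓕 (fourierMul ha f) : L2 d F) =ᵐ[volume] fun ξ => a ξ • (𝓕 f : L2 d F) ξ := by
  have e : (𝓕 (fourierMul ha f) : L2 d F) =
      (ContinuousLinearMap.lsmul ℂ ℂ).holder 2 (ha.toLp a) (𝓕 f : L2 d F) :=
    (Lp.fourierTransformₗᵢ (Space d) F).apply_symm_apply _
  rw [e]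
  filter_upwards [(ContinuousLinearMap.lsmul ℂ ℂ).coeFn_holder (r := 2) (ha.toLp a)
    (𝓕 f : L2 d F), ha.coeFn_toLp] with x h1 h2
  rw [h1, h2]
  rfl

/-- Paired with a Schwartz function, a constant linear map passes through the integral, whereas the
Fourier transform acts only on the test function. -/
theorem fourier_compLpL {F' : Type*} [NormedAddCommGroup F'] [InnerProductSpace ℂ F']
    [CompleteSpace F'] (L : F →L[ℂ] F') (f : L2 d F) :
    (𝓕 (L.compLpL 2 volume f) : L2 d F') = L.compLpL 2 volume (𝓕 f : L2 d F) := by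
  have key : ∀ (g : L2 d F) (u : 𝓢(Space d, ℂ)),
      toDistr d F' (L.compLpL 2 volume g) u = L (toDistr d F g u) := by
    intro g u
    rw [toDistr_apply, toDistr_apply, ← L.integral_comp_comm]
    · refine integral_congr_ae ?_
      filter_upwards [L.coeFn_compLpL g] with x hx
      rw [hx, map_smul]
    · exact memLp_one_iff_integrable.1 ((Lp.memLp g).smul (u.memLp 2 volume))
  apply toDistr_injective d F'
  rw [← fourier_toDistr]
  ext u
  rw [TemperedDistribution.fourier_apply, key, key, ← fourier_toDistr,
    TemperedDistribution.fourier_apply]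

theorem compLpL_mem_laplacian_domain {F' : Type*} [NormedAddCommGroup F'] [InnerProductSpace ℂ F']
    [CompleteSpace F'] (L : F →L[ℂ] F') {f : L2 d F} (hf : f ∈ (laplacian d F).domain) :
    L.compLpL 2 volume f ∈ (laplacian d F').domain := by
  rw [mem_laplacian_domain_iff] at hf ⊢
  rw [fourier_compLpL]
  refine (L.comp_memLp' hf).ae_eq ?_
  filter_upwards [L.coeFn_compLpL (𝓕 f : L2 d F)] with x hx
  rw [hx]
  exact map_smul L _ _

theorem laplacian_compLpL {F' : Type*} [NormedAddCommGroup F'] [InnerProductSpace ℂ F']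
    [CompleteSpace F'] (L : F →L[ℂ] F') (f : (laplacian d F).domain) :
    laplacian d F' ⟨L.compLpL 2 volume (f : L2 d F), compLpL_mem_laplacian_domain L f.2⟩ =
      L.compLpL 2 volume (laplacian d F f) := by
  apply fourier_injective
  rw [fourier_compLpL]
  have h1 := fourier_laplacian ⟨L.compLpL 2 volume (f : L2 d F), compLpL_mem_laplacian_domain L f.2⟩
  simp only [fourier_compLpL] at h1
  filter_upwards [h1, fourier_laplacian f, L.coeFn_compLpL (𝓕 (f : L2 d F) : L2 d F),
    L.coeFn_compLpL (𝓕 (laplacian d F f) : L2 d F)] with ξ h1 h2 h3 h4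
  rw [h1, h3, h4, h2, map_smul]

theorem inner_laplacian (f g : (laplacian d F).domain) :
    inner ℂ (laplacian d F f) (g : L2 d F) = inner ℂ (f : L2 d F) (laplacian d F g) := by
  rw [← Lp.inner_fourier_eq, ← Lp.inner_fourier_eq (f : L2 d F), L2.inner_def, L2.inner_def]
  refine integral_congr_ae ?_
  filter_upwards [fourier_laplacian f, fourier_laplacian g] with ξ h1 h2
  rw [h1, h2, inner_smul_left, inner_smul_right]
  simp

end Fourier

end

end MatrixSchrodinger

namespace MatrixSchrodinger

open MeasureTheory Filter Topology TemperedDistribution FourierTransform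
open scoped SchwartzMap Laplacian ENNReal ContDiff

noncomputable section

/-! ### Weak convergence -/

/-- Bounded sequences in a separable Hilbert space have weakly convergent subsequences. -/
theorem exists_subseq_weakly_tendsto {E : Type*} [NormedAddCommGroup E] [InnerProductSpace ℂ E]
    [CompleteSpace E] [TopologicalSpace.SeparableSpace E] {x : ℕ → E} {M : ℝ}
    (hx : ∀ n, ‖x n‖ ≤ M) :
    ∃ (a : E) (φ : ℕ → ℕ), StrictMono φ ∧
      ∀ y, Tendsto (fun n => inner ℂ y (x (φ n) - a)) atTop (𝓝 0) := by
  -- Sequential Banach–Alaoglu in the dual, carried back by the Riesz isomorphism; the later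
  -- conjugation only exchanges the slots of the inner product.
  obtain ⟨ℓ, -, φ, hφ, hℓ⟩ := WeakDual.isSeqCompact_closedBall ℂ E 0 M
    (x := fun n => StrongDual.toWeakDual (InnerProductSpace.toDual ℂ E (x n)))
    (fun n => by
      rw [Set.mem_preimage, mem_closedBall_zero_iff]
      exact ((InnerProductSpace.toDual ℂ E).norm_map (x n)).trans_le (hx n))
  refine ⟨(InnerProductSpace.toDual ℂ E).symm (WeakDual.toStrongDual ℓ), φ, hφ, fun y => ?_⟩
  have h1 := tendsto_iff_forall_eval_tendsto_topDualPairing.1 hℓ y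
  have h2 : Tendsto (fun n => inner ℂ (x (φ n)) y) atTop
      (𝓝 (inner ℂ ((InnerProductSpace.toDual ℂ E).symm (WeakDual.toStrongDual ℓ)) y)) := by
    rw [InnerProductSpace.toDual_symm_apply]
    exact h1
  have h3 := (Complex.continuous_conj.tendsto _).comp h2
  rw [inner_conj_symm] at h3
  have h4 := h3.sub_const
    (inner ℂ y ((InnerProductSpace.toDual ℂ E).symm (WeakDual.toStrongDual ℓ)))
  rw [sub_self] at h4
  refine h4.congr fun n => ?_
  rw [Function.comp_apply, inner_conj_symm, ← inner_sub_right]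

theorem weakly_tendsto_clm {E E' : Type*} [NormedAddCommGroup E] [InnerProductSpace ℂ E]
    [CompleteSpace E] [NormedAddCommGroup E'] [InnerProductSpace ℂ E'] [CompleteSpace E']
    (L : E →L[ℂ] E') {x : ℕ → E} (hx : ∀ y, Tendsto (fun n => inner ℂ y (x n)) atTop (𝓝 0))
    (y : E') : Tendsto (fun n => inner ℂ y (L (x n))) atTop (𝓝 0) := by
  refine (hx (ContinuousLinearMap.adjoint L y)).congr fun n => ?_
  rw [ContinuousLinearMap.adjoint_inner_left]

/-! ### Fourier multipliers on `H²` and pointwise Fourier inversion. -/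

section

variable {d : ℕ} {F : Type*} [NormedAddCommGroup F] [InnerProductSpace ℂ F] [CompleteSpace F]

theorem norm_le_of_fourier_le {f g : L2 d F} {c : ℝ}
    (h : ∀ᵐ ξ, ‖(𝓕 f : L2 d F) ξ‖ ≤ c * ‖(𝓕 g : L2 d F) ξ‖) : ‖f‖ ≤ c * ‖g‖ := by
  rw [← Lp.norm_fourier_eq f, ← Lp.norm_fourier_eq g]
  exact Lp.norm_le_mul_norm_of_ae_le_mul h

theorem fourierMul_mem_domain {a : Space d → ℂ} (ha : MemLp a ∞ (volume : Measure (Space d)))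
    {f : L2 d F} (hf : f ∈ (laplacian d F).domain) : fourierMul ha f ∈ (laplacian d F).domain := by
  rw [mem_laplacian_domain_iff] at hf ⊢
  refine (MemLp.smul hf ha (r := 2)).ae_eq ?_
  filter_upwards [fourier_fourierMul ha f] with ξ h
  rw [h]
  exact smul_comm _ _ _

theorem laplacian_fourierMul {a : Space d → ℂ} (ha : MemLp a ∞ (volume : Measure (Space d)))
    (f : (laplacian d F).domain) :
    laplacian d F ⟨fourierMul ha (f : L2 d F), fourierMul_mem_domain ha f.2⟩ =
      fourierMul ha (laplacian d F f) := by
  apply fourier_injective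
  filter_upwards [fourier_laplacian ⟨fourierMul ha (f : L2 d F), fourierMul_mem_domain ha f.2⟩,
    fourier_laplacian f, fourier_fourierMul ha (f : L2 d F),
    fourier_fourierMul ha (laplacian d F f)] with ξ h1 h2 h3 h4
  rw [h1, h4, h2]
  rw [h3, smul_comm]

/-- If the Fourier transform is integrable, the inversion formula holds almost everywhere. -/
theorem ae_eq_fourierInv {f : L2 d F} {g : Space d → F} (hg : Integrable g volume)
    (hfg : (𝓕 f : L2 d F) =ᵐ[volume] g) :
    f =ᵐ[volume] fun x => ∫ ξ, Real.fourierChar (inner ℝ ξ x) • g ξ := by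
  have hcont : Continuous (fun x => ∫ ξ, Real.fourierChar (inner ℝ ξ x) • g ξ) := by
    have := VectorFourier.fourierIntegral_continuous (μ := volume) (L := -innerₗ (Space d))
      Real.continuous_fourierChar
      (continuous_inner.neg : Continuous fun p : Space d × Space d => -(inner ℝ p.1 p.2)) hg
    refine this.congr fun x => ?_
    simp [VectorFourier.fourierIntegral]
  refine ae_eq_of_integral_contDiff_smul_eq ((Lp.memLp f).locallyIntegrable one_le_two)
    hcont.locallyIntegrable ?_
  intro φ hφ hφc
  have hg₁ : HasCompactSupport (Complex.ofRealCLM ∘ φ) := hφc.comp_left rfl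
  have hg₂ : ContDiff ℝ ∞ (Complex.ofRealCLM ∘ φ) := by fun_prop
  let u : 𝓢(Space d, ℂ) := hg₁.toSchwartzMap hg₂
  have h1 : toDistr d F f u = ∫ x, φ x • f x := by
    rw [toDistr_apply]
    rfl
  have h2 : toDistr d F f = 𝓕⁻ (toDistr d F (𝓕 f)) := by
    rw [← fourier_toDistr, fourierInv_fourier_eq]
  rw [← h1, h2, TemperedDistribution.fourierInv_apply, toDistr_apply]
  have h3 : ∫ x, (𝓕⁻ u) x • (𝓕 f : L2 d F) x = ∫ x, (𝓕⁻ u) x • g x := by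
    refine integral_congr_ae ?_
    filter_upwards [hfg] with x hx
    rw [hx]
  rw [h3]
  -- The inverse transform is moved from the test function onto `g`, which is allowed because both
  -- are integrable.
  have h4 := VectorFourier.integral_fourierIntegral_smul_eq_flip (μ := volume) (ν := volume)
      (L := -innerₗ (Space d)) Real.continuous_fourierChar
      (continuous_inner.neg : Continuous fun p : Space d × Space d => -(inner ℝ p.1 p.2))
      u.integrable hg
  have h5 : ∀ x, (𝓕⁻ u) x = VectorFourier.fourierIntegral Real.fourierChar volume
      (-innerₗ (Space d)) u x := by
    intro x
    rw [SchwartzMap.fourierInv_coe]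
    rfl
  simp only [h5, h4]
  refine integral_congr_ae (Eventually.of_forall fun x => ?_)
  have h6 : VectorFourier.fourierIntegral Real.fourierChar volume (-innerₗ (Space d)).flip g x =
      ∫ ξ, Real.fourierChar (inner ℝ ξ x) • g ξ := by
    simp [VectorFourier.fourierIntegral, real_inner_comm]
  change u x • _ = φ x • _
  rw [h6]
  rfl

theorem norm_sq_eq_integral {F : Type*} [NormedAddCommGroup F] [InnerProductSpace ℂ F]
    (f : L2 d F) : ‖f‖ ^ 2 = ∫ x, ‖f x‖ ^ 2 := by
  have h := inner_self_eq_norm_sq_to_K (𝕜 := ℂ) f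
  rw [L2.inner_def] at h
  have e : ∀ x, inner ℂ (f x) (f x) = ((‖f x‖ ^ 2 : ℝ) : ℂ) := by
    intro x
    rw [inner_self_eq_norm_sq_to_K]
    norm_cast
  simp only [e] at h
  have h' := (integral_ofReal (𝕜 := ℂ) (f := fun x => ‖f x‖ ^ 2)
    (μ := (volume : Measure (Space d)))).symm.trans h
  exact_mod_cast h'.symm

end

/-! ### Decaying potentials -/

section Decay

variable {d : ℕ}

/-- The indicator function of `s`, as the symbol of a frequency truncation. -/
def cutoff (s : Set (Space d)) : Space d → ℂ := s.indicator fun _ => 1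

theorem memLp_cutoff {s : Set (Space d)} (hs : MeasurableSet s) :
    MemLp (cutoff s) ∞ (volume : Measure (Space d)) :=
  (memLp_top_const (1 : ℂ)).indicator hs

theorem norm_cutoff_le (s : Set (Space d)) (ξ : Space d) : ‖cutoff s ξ‖ ≤ 1 := by
  unfold cutoff
  by_cases h : ξ ∈ s <;> simp [h]

theorem fourierMul_cutoff_add (s : Set (Space d)) (hs : MeasurableSet s) (f : L2 d ℂ) :
    fourierMul (memLp_cutoff hs) f + fourierMul (memLp_cutoff hs.compl) f = f := by
  apply fourier_injective
  rw [FourierTransform.fourier_add]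
  filter_upwards [fourier_fourierMul (memLp_cutoff hs) f,
    fourier_fourierMul (memLp_cutoff hs.compl) f,
    Lp.coeFn_add (𝓕 (fourierMul (memLp_cutoff hs) f) : L2 d ℂ)
      (𝓕 (fourierMul (memLp_cutoff hs.compl) f) : L2 d ℂ)] with ξ h1 h2 h3
  rw [h3, Pi.add_apply, h1, h2]
  by_cases h : ξ ∈ s <;> simp [cutoff, h]

/-- Low-frequency parts of a weakly null sequence are uniformly bounded and converge to zero
pointwise. -/
theorem tendsto_fourierMul_cutoff (N : ℝ) {v : ℕ → L2 d ℂ} {M : ℝ} (hM : ∀ n, ‖v n‖ ≤ M)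
    (hv : ∀ y, Tendsto (fun n => inner ℂ y (v n)) atTop (𝓝 0)) :
    ∃ K : ℝ, ∀ᵐ x, (∀ n, ‖(fourierMul (memLp_cutoff
      (measurableSet_closedBall (x := (0 : Space d)) (ε := N))) (v n) : L2 d ℂ) x‖ ≤ K) ∧
      Tendsto (fun n => (fourierMul (memLp_cutoff
        (measurableSet_closedBall (x := (0 : Space d)) (ε := N))) (v n) : L2 d ℂ) x) atTop
        (𝓝 0) := by
  set s := Metric.closedBall (0 : Space d) N with hs
  have hsm : MeasurableSet s := measurableSet_closedBall
  have hsfin : volume s ≠ ⊤ := measure_closedBall_lt_top.ne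
  have hfm : IsFiniteMeasure (volume.restrict s) := ⟨by
    rw [Measure.restrict_apply_univ]; exact hsfin.lt_top⟩
  have hE : ∀ x ξ : Space d, ‖(starRingEnd ℂ) (Real.fourierChar (inner ℝ ξ x) : ℂ)‖ = 1 := by
    intro x ξ
    rw [RCLike.norm_conj, Circle.norm_coe]
  have hk : ∀ x : Space d, MemLp (s.indicator fun ξ =>
      (starRingEnd ℂ) (Real.fourierChar (inner ℝ ξ x) : ℂ)) 2 (volume : Measure (Space d)) := by
    intro x
    rw [memLp_indicator_iff_restrict hsm]
    refine MemLp.of_bound (C := 1) ?_ (Eventually.of_forall fun ξ => ?_)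
    · exact (Complex.continuous_conj.comp (continuous_subtype_val.comp
        (Real.continuous_fourierChar.comp (by fun_prop)))).aestronglyMeasurable
    · exact (hE x ξ).le
  let one : L2 d ℂ := indicatorConstLp 2 hsm hsfin (1 : ℂ)
  have hkn : ∀ x : Space d, ‖(hk x).toLp _‖ ≤ ‖one‖ := by
    intro x
    refine Lp.norm_le_norm_of_ae_le ?_
    filter_upwards [(hk x).coeFn_toLp,
      indicatorConstLp_coeFn (p := 2) (hs := hsm) (hμs := hsfin) (c := (1 : ℂ))] with ξ h1 h2
    rw [h1, h2]
    by_cases h : ξ ∈ s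
    · rw [Set.indicator_of_mem h, Set.indicator_of_mem h, hE, norm_one]
    · rw [Set.indicator_of_notMem h, Set.indicator_of_notMem h]
  -- The low-frequency part at `x` is the inner product of the Fourier transform with a truncated
  -- exponential. The norm of that exponential is bounded independently of `x`, so weak convergence
  -- becomes pointwise convergence with a uniform bound.
  have hpt : ∀ n, (fourierMul (memLp_cutoff hsm) (v n) : L2 d ℂ) =ᵐ[volume]
      fun x => inner ℂ ((hk x).toLp _) (𝓕 (v n) : L2 d ℂ) := by
    intro n
    have hint : Integrable (fun ξ => cutoff s ξ • (𝓕 (v n) : L2 d ℂ) ξ) volume := by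
      have h1 : Integrable (s.indicator (𝓕 (v n) : L2 d ℂ)) volume := by
        rw [integrable_indicator_iff hsm]
        exact ((Lp.memLp (𝓕 (v n) : L2 d ℂ)).restrict s).integrable one_le_two
      refine h1.congr (Eventually.of_forall fun ξ => ?_)
      by_cases h : ξ ∈ s <;> simp [h, cutoff]
    filter_upwards [ae_eq_fourierInv hint (fourier_fourierMul (memLp_cutoff hsm) (v n))] with x hx
    rw [hx, L2.inner_def]
    refine integral_congr_ae ?_
    filter_upwards [(hk x).coeFn_toLp] with ξ hξ
    rw [hξ]
    by_cases h : ξ ∈ s <;> simp [h, cutoff, Circle.smul_def, mul_comm]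
  have hweak : ∀ y, Tendsto (fun n => inner ℂ y (𝓕 (v n) : L2 d ℂ)) atTop (𝓝 0) :=
    weakly_tendsto_clm
      (Lp.fourierTransformₗᵢ (Space d) ℂ).toContinuousLinearEquiv.toContinuousLinearMap hv
  refine ⟨‖one‖ * M, ?_⟩
  filter_upwards [ae_all_iff.2 hpt] with x hx
  refine ⟨fun n => ?_, ?_⟩
  · rw [hx n]
    refine (norm_inner_le_norm _ _).trans ?_
    rw [Lp.norm_fourier_eq]
    exact mul_le_mul (hkn x) (hM n) (norm_nonneg _) (norm_nonneg _)
  · simp only [hx]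
    exact hweak _

theorem coeFn_scalarMultiplication (X : Space d → ℝ) (u : (scalarMultiplication X).domain) :
    (scalarMultiplication X u : L2 d ℂ) =ᵐ[volume] fun x => (X x : ℂ) * (u : L2 d ℂ) x :=
  (mem_multiplicationDomain _ u).coeFn_toLp

theorem mem_scalarMultiplication_domain {X : Space d → ℝ} {f : L2 d ℂ} :
    f ∈ (scalarMultiplication X).domain ↔
      MemLp (fun x => (X x : ℂ) * f x) 2 (volume : Measure (Space d)) := Iff.rfl

theorem schwartz_mem_domain {F : Type*} [NormedAddCommGroup F] [InnerProductSpace ℂ F]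
    [CompleteSpace F] (u : 𝓢(Space d, F)) : u.toLp 2 volume ∈ (laplacian d F).domain := by
  change MemSobolev 2 2 (toDistr d F (u.toLp 2 volume))
  have e : toDistr d F (u.toLp 2 volume) = (u : 𝓢'(Space d, F)) :=
    Lp.toTemperedDistribution_toLp_eq u
  rw [e]
  exact u.memSobolev

/-- A Laplacian-bounded function is locally square-integrable. -/
theorem memLp_indicator_closedBall {X : Space d → ℝ} (hX : AEStronglyMeasurable X volume)
    (hD : (laplacian d ℂ).domain ≤ (scalarMultiplication X).domain) (R : ℝ) :
    MemLp ((Metric.closedBall (0 : Space d) R).indicator X) 2 volume := by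
  -- A bump function equal to one on the ball is in `H²`, so its product with `X` is
  -- square-integrable; the maximum with `1` keeps the inner radius positive when `R` is not.
  let b : ContDiffBump (0 : Space d) := ⟨max R 1, max R 1 + 1, by positivity, by linarith⟩
  have hb₁ : HasCompactSupport (Complex.ofRealCLM ∘ b) := b.hasCompactSupport.comp_left rfl
  have hb₂ : ContDiff ℝ ∞ (Complex.ofRealCLM ∘ b) := Complex.ofRealCLM.contDiff.comp b.contDiff
  let u : 𝓢(Space d, ℂ) := hb₁.toSchwartzMap hb₂
  have h := mem_scalarMultiplication_domain.1 (hD (schwartz_mem_domain u))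
  refine h.mono (hX.indicator measurableSet_closedBall) ?_
  filter_upwards [u.coeFn_toLp 2 volume] with x hx
  rw [hx]
  by_cases hxR : x ∈ Metric.closedBall (0 : Space d) R
  · have h1 : u x = 1 := by
      have : b x = 1 := b.one_of_mem_closedBall
        (Metric.closedBall_subset_closedBall (le_max_left R 1) hxR)
      change ((b x : ℝ) : ℂ) = 1
      rw [this, Complex.ofReal_one]
    rw [Set.indicator_of_mem hxR, h1, mul_one, Complex.norm_real]
  · rw [Set.indicator_of_notMem hxR, norm_zero]
    exact norm_nonneg _

/-- On frequencies with `‖ξ‖ ≥ N` the symbol is at least `N ^ 2`, the factor `(2π)²` being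
discarded. -/
theorem norm_fourierMul_cutoff_compl_le {N : ℝ} (hN : 0 < N) (v : (laplacian d ℂ).domain) :
    ‖fourierMul (memLp_cutoff (measurableSet_closedBall (x := (0 : Space d)) (ε := N)).compl)
      (v : L2 d ℂ)‖ ≤ (N ^ 2)⁻¹ * ‖laplacian d ℂ v‖ := by
  refine norm_le_of_fourier_le ?_
  filter_upwards [fourier_fourierMul (memLp_cutoff
    (measurableSet_closedBall (x := (0 : Space d)) (ε := N)).compl) (v : L2 d ℂ),
    fourier_laplacian v] with ξ h1 h2
  rw [h1, h2]
  by_cases h : ξ ∈ Metric.closedBall (0 : Space d) N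
  · simp only [cutoff, Set.mem_compl_iff, h, not_true_eq_false, not_false_eq_true,
      Set.indicator_of_notMem, zero_smul, norm_zero]
    positivity
  · have h' : N ≤ ‖ξ‖ := by
      rw [mem_closedBall_zero_iff, not_le] at h
      exact h.le
    simp only [cutoff, Set.mem_compl_iff, h, not_false_eq_true, Set.indicator_of_mem, one_smul,
      norm_smul, norm_neg, Complex.norm_real, Real.norm_of_nonneg (symbol_nonneg ξ)]
    rw [← mul_assoc]
    refine le_mul_of_one_le_left (norm_nonneg _) ?_
    rw [inv_mul_eq_div, one_le_div (by positivity), symbol]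
    have hpi : 1 ≤ (2 * Real.pi) ^ 2 := by nlinarith [Real.pi_gt_three]
    have : N ^ 2 ≤ ‖ξ‖ ^ 2 := by gcongr
    nlinarith [sq_nonneg ‖ξ‖]

theorem norm_fourierMul_cutoff_le {s : Set (Space d)} (hs : MeasurableSet s) (f : L2 d ℂ) :
    ‖fourierMul (memLp_cutoff hs) f‖ ≤ ‖f‖ := by
  have := norm_le_of_fourier_le (f := fourierMul (memLp_cutoff hs) f) (g := f) (c := 1) ?_
  · rwa [one_mul] at this
  · filter_upwards [fourier_fourierMul (memLp_cutoff hs) f] with ξ h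
    rw [h, norm_smul]
    exact mul_le_mul_of_nonneg_right (norm_cutoff_le s ξ) (norm_nonneg _)

/-- Multiplication by a decaying function of relative bound zero maps weakly null sequences that
are bounded in the graph norm to null sequences. -/
theorem tendsto_scalarMultiplication {X : Space d → ℝ} (hX : AEStronglyMeasurable X volume)
    (hdecay : DecaysAtInfinity X)
    (hD : (laplacian d ℂ).domain ≤ (scalarMultiplication X).domain)
    (hb : ∀ ε : ℝ, 0 < ε → ∃ C : ℝ, ∀ u : (laplacian d ℂ).domain,
      ‖scalarMultiplication X (Submodule.inclusion hD u)‖ ≤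
        ε * ‖laplacian d ℂ u‖ + C * ‖(u : L2 d ℂ)‖)
    {v : ℕ → (laplacian d ℂ).domain} {M : ℝ} (hM : ∀ n, ‖(v n : L2 d ℂ)‖ ≤ M)
    (hM' : ∀ n, ‖laplacian d ℂ (v n)‖ ≤ M)
    (hv : ∀ y, Tendsto (fun n => inner ℂ y (v n : L2 d ℂ)) atTop (𝓝 0)) :
    Tendsto (fun n => scalarMultiplication X (Submodule.inclusion hD (v n))) atTop (𝓝 0) := by
  have hM0 : 0 ≤ M := (norm_nonneg _).trans (hM 0)
  rw [Metric.tendsto_atTop]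
  intro δ hδ
  -- The error `δ` is spent in quarters: two for the high frequencies, one outside a ball and one
  -- inside. The number `δ / (4 (M + 1))` serves both as relative bound and as threshold for `|X|`;
  -- the `+ 1` keeps the denominator positive.
  obtain ⟨C, hC⟩ := hb (δ / (4 * (M + 1))) (by positivity)
  -- The cutoff frequency is chosen after `C`, so that the high-frequency `L²` norm outweighs this
  -- constant.
  obtain ⟨N, hN1, hN2⟩ : ∃ N : ℝ, 0 < N ∧ |C| * ((N ^ 2)⁻¹ * M) ≤ δ / 4 := by
    refine ⟨max 1 (4 * |C| * M / δ), by positivity, ?_⟩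
    set N := max 1 (4 * |C| * M / δ)
    have h1 : 1 ≤ N := le_max_left _ _
    have h2 : 4 * |C| * M / δ ≤ N := le_max_right _ _
    have h3 : N ≤ N ^ 2 := by nlinarith
    rw [div_le_iff₀ hδ] at h2
    have h4 : (N ^ 2)⁻¹ * N ^ 2 = 1 := inv_mul_cancel₀ (by positivity)
    have h5 : 0 ≤ (N ^ 2)⁻¹ := by positivity
    calc |C| * ((N ^ 2)⁻¹ * M) = (N ^ 2)⁻¹ * (|C| * M) := by ring
      _ ≤ (N ^ 2)⁻¹ * (N ^ 2 * (δ / 4)) := by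
        refine mul_le_mul_of_nonneg_left ?_ h5
        nlinarith
      _ = δ / 4 := by rw [← mul_assoc, h4, one_mul]
  set η := δ / (4 * (M + 1)) with hη
  have hη0 : 0 < η := by positivity
  have hηM : η * M ≤ δ / 4 := by
    rw [hη, div_mul_eq_mul_div, div_le_div_iff₀ (by positivity) (by norm_num)]
    nlinarith
  obtain ⟨R, hR⟩ : ∃ R : ℝ, ∀ᵐ x : Space d, x ∉ Metric.closedBall (0 : Space d) R → |X x| ≤ η := by
    have h1 : ∀ᶠ x in cocompact (Space d) ⊓ ae volume, |X x| ≤ η := by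
      have := hdecay.eventually (Metric.ball_mem_nhds (0 : ℝ) hη0)
      filter_upwards [this] with x hx
      have hx : dist (X x) 0 < η := hx
      rw [Real.dist_eq, sub_zero] at hx
      exact hx.le
    obtain ⟨s, hs, t, ht, hst⟩ := Filter.mem_inf_iff_superset.1 h1
    obtain ⟨K, hK, hKs⟩ := Filter.mem_cocompact.1 hs
    obtain ⟨R, hR⟩ := hK.isBounded.subset_closedBall (0 : Space d)
    refine ⟨R, ?_⟩
    filter_upwards [ht] with x hx hxR
    exact hst ⟨hKs fun h => hxR (hR h), hx⟩
  set B := Metric.closedBall (0 : Space d) N with hB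
  have hBm : MeasurableSet B := measurableSet_closedBall
  set S := Metric.closedBall (0 : Space d) R with hS
  have hSm : MeasurableSet S := measurableSet_closedBall
  let P : ℕ → (laplacian d ℂ).domain := fun n =>
    ⟨fourierMul (memLp_cutoff hBm) (v n : L2 d ℂ), fourierMul_mem_domain _ (v n).2⟩
  let Q : ℕ → (laplacian d ℂ).domain := fun n =>
    ⟨fourierMul (memLp_cutoff hBm.compl) (v n : L2 d ℂ), fourierMul_mem_domain _ (v n).2⟩
  have hPQ : ∀ n, v n = P n + Q n := fun n =>
    Subtype.ext (fourierMul_cutoff_add B hBm (v n : L2 d ℂ)).symm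
  let A : (laplacian d ℂ).domain → L2 d ℂ :=
    fun u => scalarMultiplication X (Submodule.inclusion hD u)
  have hA : ∀ n, A (v n) = A (P n) + A (Q n) := by
    intro n
    simp only [A]
    conv_lhs => rw [hPQ n]
    rw [map_add, LinearPMap.map_add]
  have hQ : ∀ n, ‖A (Q n)‖ ≤ δ / 4 + δ / 4 := by
    intro n
    have h1 : ‖laplacian d ℂ (Q n)‖ ≤ M := by
      have : laplacian d ℂ (Q n) = fourierMul (memLp_cutoff hBm.compl) (laplacian d ℂ (v n)) :=
        laplacian_fourierMul _ (v n)
      rw [this]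
      exact (norm_fourierMul_cutoff_le hBm.compl _).trans (hM' n)
    have h2 : ‖(Q n : L2 d ℂ)‖ ≤ (N ^ 2)⁻¹ * M :=
      (norm_fourierMul_cutoff_compl_le hN1 (v n)).trans
        (mul_le_mul_of_nonneg_left (hM' n) (by positivity))
    refine (hC (Q n)).trans (add_le_add ?_ ?_)
    · exact (mul_le_mul_of_nonneg_left h1 hη0.le).trans hηM
    · refine le_trans ?_ hN2
      refine (mul_le_mul_of_nonneg_right (le_abs_self C) (norm_nonneg _)).trans ?_
      exact mul_le_mul_of_nonneg_left h2 (abs_nonneg _)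
  have hAP : ∀ n, (A (P n) : L2 d ℂ) =ᵐ[volume] fun x => (X x : ℂ) * (P n : L2 d ℂ) x :=
    fun n => coeFn_scalarMultiplication X (Submodule.inclusion hD (P n))
  have hin : ∀ n, MemLp (S.indicator (A (P n) : L2 d ℂ)) 2 (volume : Measure (Space d)) :=
    fun n => (Lp.memLp (A (P n))).indicator hSm
  have hout : ∀ n, MemLp (Sᶜ.indicator (A (P n) : L2 d ℂ)) 2 (volume : Measure (Space d)) :=
    fun n => (Lp.memLp (A (P n))).indicator hSm.compl
  have hsplit : ∀ n, A (P n) = (hin n).toLp _ + (hout n).toLp _ := by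
    intro n
    apply Lp.ext
    filter_upwards [Lp.coeFn_add ((hin n).toLp _) ((hout n).toLp _), (hin n).coeFn_toLp,
      (hout n).coeFn_toLp] with x h1 h2 h3
    rw [h1, Pi.add_apply, h2, h3]
    exact (Set.indicator_self_add_compl_apply S _ x).symm
  have houtle : ∀ n, ‖(hout n).toLp _‖ ≤ δ / 4 := by
    intro n
    refine le_trans (b := η * ‖(P n : L2 d ℂ)‖) ?_ ?_
    · refine Lp.norm_le_mul_norm_of_ae_le_mul ?_
      filter_upwards [(hout n).coeFn_toLp, hAP n, hR] with x h1 h2 h3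
      rw [h1]
      by_cases hx : x ∈ S
      · rw [Set.indicator_of_notMem (by simpa using hx), norm_zero]
        positivity
      · rw [Set.indicator_of_mem (by simpa using hx), h2, norm_mul, Complex.norm_real]
        exact mul_le_mul_of_nonneg_right (h3 hx) (norm_nonneg _)
    · refine le_trans (mul_le_mul_of_nonneg_left ?_ hη0.le) hηM
      exact (norm_fourierMul_cutoff_le hBm _).trans (hM n)
  -- On the ball `X` is square-integrable and the low-frequency parts are bounded by `K`, so `K ^ 2
  -- |X| ^ 2` dominates.
  have hinlim : Tendsto (fun n => ‖(hin n).toLp _‖ ^ 2) atTop (𝓝 0) := by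
    obtain ⟨K, hK⟩ := tendsto_fourierMul_cutoff N hM hv
    have hXS := memLp_indicator_closedBall hX hD R
    have hlim : Tendsto (fun n => ∫ x, ‖((hin n).toLp _ : L2 d ℂ) x‖ ^ 2) atTop
        (𝓝 (∫ _ : Space d, (0 : ℝ))) := by
      refine tendsto_integral_of_dominated_convergence
        (fun x => K ^ 2 * ‖S.indicator X x‖ ^ 2) ?_ ?_ ?_ ?_
      · intro n
        exact ((Lp.aestronglyMeasurable _).norm.pow 2)
      · exact ((memLp_two_iff_integrable_sq_norm hXS.1).1 hXS).const_mul _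
      · intro n
        filter_upwards [(hin n).coeFn_toLp, hAP n, hK] with x h1 h2 h3
        rw [h1, Real.norm_of_nonneg (by positivity), ← mul_pow]
        refine pow_le_pow_left₀ (norm_nonneg _) ?_ 2
        by_cases hx : x ∈ S
        · rw [Set.indicator_of_mem hx, Set.indicator_of_mem hx, h2, norm_mul, Complex.norm_real,
            mul_comm]
          exact mul_le_mul_of_nonneg_right (h3.1 n) (norm_nonneg _)
        · rw [Set.indicator_of_notMem hx, Set.indicator_of_notMem hx, norm_zero, norm_zero,
            mul_zero]
      · filter_upwards [ae_all_iff.2 fun n => (hin n).coeFn_toLp, ae_all_iff.2 hAP, hK]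
          with x h1 h2 h3
        simp only [h1]
        by_cases hx : x ∈ S
        · simp only [Set.indicator_of_mem hx, h2]
          have h4 := (h3.2.const_mul (X x : ℂ)).norm.pow 2
          simpa using h4
        · simp only [Set.indicator_of_notMem hx]
          simp
    rw [integral_zero] at hlim
    refine hlim.congr fun n => ?_
    rw [norm_sq_eq_integral]
  obtain ⟨n₀, hn₀⟩ := eventually_atTop.1 (hinlim.eventually_lt_const
    (by positivity : 0 < (δ / 4) ^ 2))
  refine ⟨n₀, fun n hn => ?_⟩
  have h1 : ‖(hin n).toLp _‖ < δ / 4 := lt_of_pow_lt_pow_left₀ 2 (by positivity) (hn₀ n hn)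
  rw [dist_zero_right]
  change ‖A (v n)‖ < δ
  rw [hA n, hsplit n]
  refine (norm_add_le _ _).trans_lt ?_
  have h2 := norm_add_le ((hin n).toLp _) ((hout n).toLp _)
  linarith [houtle n, hQ n]

theorem memLp_inv_one_add_symbol :
    MemLp (fun ξ : Space d => ((1 + symbol ξ)⁻¹ : ℂ)) ∞ (volume : Measure (Space d)) := by
  have hc : Continuous fun ξ : Space d => ((1 + symbol ξ)⁻¹ : ℝ) :=
    (continuous_const.add continuous_symbol).inv₀ fun ξ =>
      ne_of_gt (add_pos_of_pos_of_nonneg one_pos (symbol_nonneg ξ))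
  have h1 : MemLp (fun ξ : Space d => (((1 + symbol ξ)⁻¹ : ℝ) : ℂ)) ∞ volume := by
    refine memLp_top_of_bound (Complex.continuous_ofReal.comp hc).aestronglyMeasurable 1
      (Eventually.of_forall fun ξ => ?_)
    have := symbol_nonneg ξ
    rw [Complex.norm_real, Real.norm_of_nonneg (by positivity)]
    exact inv_le_one_of_one_le₀ (by linarith)
  exact h1.ae_eq (Eventually.of_forall fun ξ => by push_cast; rfl)

theorem one_add_symbol_ne_zero (ξ : Space d) : (1 + symbol ξ : ℂ) ≠ 0 := by
  have := symbol_nonneg ξ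
  exact_mod_cast (by positivity : (1 + symbol ξ : ℝ) ≠ 0)

/-- The operator `(1 - Δ)⁻¹`. -/
def besselInv (d : ℕ) : L2 d ℂ →L[ℂ] L2 d ℂ := fourierMul memLp_inv_one_add_symbol

theorem besselInv_mem_domain (f : L2 d ℂ) : besselInv d f ∈ (laplacian d ℂ).domain := by
  rw [mem_laplacian_domain_iff]
  have h1 : (fun ξ => (𝓕 f : L2 d ℂ) ξ - (𝓕 (besselInv d f) : L2 d ℂ) ξ) =ᵐ[volume]
      fun ξ => (symbol ξ : ℂ) • (𝓕 (besselInv d f) : L2 d ℂ) ξ := by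
    filter_upwards [fourier_fourierMul memLp_inv_one_add_symbol f] with ξ h
    rw [besselInv, h]
    have := one_add_symbol_ne_zero ξ
    simp only [smul_eq_mul]
    field_simp
    ring
  exact ((Lp.memLp _).sub (Lp.memLp _)).ae_eq h1

theorem besselInv_sub_laplacian (u : (laplacian d ℂ).domain) :
    besselInv d ((u : L2 d ℂ) - laplacian d ℂ u) = u := by
  apply fourier_injective
  have h0 : (𝓕 ((u : L2 d ℂ) - laplacian d ℂ u) : L2 d ℂ) =
      (𝓕 (u : L2 d ℂ) : L2 d ℂ) - (𝓕 (laplacian d ℂ u) : L2 d ℂ) :=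
    (Lp.fourierTransformₗᵢ (Space d) ℂ).map_sub _ _
  filter_upwards [fourier_fourierMul memLp_inv_one_add_symbol ((u : L2 d ℂ) - laplacian d ℂ u),
    fourier_laplacian u, Lp.coeFn_sub (𝓕 (u : L2 d ℂ) : L2 d ℂ) (𝓕 (laplacian d ℂ u) : L2 d ℂ)]
    with ξ h1 h2 h3
  rw [besselInv, h1, h0, h3, Pi.sub_apply, h2]
  have := one_add_symbol_ne_zero ξ
  simp only [smul_eq_mul]
  field_simp
  ring

/-- The weak limit is taken of `(1 - Δ) u n` rather than of `u n`. Applying `(1 - Δ)⁻¹` gives a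
vector of `H²` whose subtraction leaves a weakly null sequence that is still bounded in the graph
norm. -/
theorem laplacianCompact_of_decaysAtInfinity {X : Space d → ℝ}
    (hX : AEStronglyMeasurable X volume) (hb : LaplacianBoundedZero X)
    (hdecay : DecaysAtInfinity X) : LaplacianCompact X := by
  obtain ⟨hD, hb⟩ := hb
  have hD' : (laplacian d ℂ).domain ≤ (scalarMultiplication X).domain := hD
  have hb' : ∀ ε : ℝ, 0 < ε → ∃ C : ℝ, ∀ u : (laplacian d ℂ).domain,
      ‖scalarMultiplication X (Submodule.inclusion hD' u)‖ ≤
        ε * ‖laplacian d ℂ u‖ + C * ‖(u : L2 d ℂ)‖ := by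
    intro ε hε
    obtain ⟨C, hC⟩ := hb ε hε
    refine ⟨C, fun u => ?_⟩
    have : ‖scalarMultiplication X (Submodule.inclusion hD' u)‖ ≤
      ε * ‖-(laplacian d ℂ u)‖ + C * ‖(u : L2 d ℂ)‖ := hC u
    rwa [norm_neg] at this
  refine ⟨hD, ?_⟩
  intro u' hu'
  obtain ⟨u, rfl⟩ : ∃ u : ℕ → (laplacian d ℂ).domain, u = u' := ⟨u', rfl⟩
  obtain ⟨C, hC⟩ := hu'
  have hC1 : ∀ n, ‖(u n : L2 d ℂ)‖ ≤ C := fun n => (hC n).1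
  have hC2 : ∀ n, ‖laplacian d ℂ (u n)‖ ≤ C := fun n => by
    have : ‖-(laplacian d ℂ (u n))‖ ≤ C := (hC n).2
    rwa [norm_neg] at this
  have hfact : Fact ((2 : ℝ≥0∞) ≠ ⊤) := ⟨by norm_num⟩
  obtain ⟨w, φ, hφ, hw⟩ := exists_subseq_weakly_tendsto
    (x := fun n => (u n : L2 d ℂ) - laplacian d ℂ (u n)) (M := C + C)
    (fun n => (norm_sub_le _ _).trans (add_le_add (hC1 n) (hC2 n)))
  let a : (laplacian d ℂ).domain := ⟨besselInv d w, besselInv_mem_domain w⟩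
  let v : ℕ → (laplacian d ℂ).domain := fun n => u (φ n) - a
  have hv : ∀ n, (v n : L2 d ℂ) =
      besselInv d ((u (φ n) : L2 d ℂ) - laplacian d ℂ (u (φ n)) - w) := by
    intro n
    rw [map_sub, besselInv_sub_laplacian]
    rfl
  have key := tendsto_scalarMultiplication hX hdecay hD' hb' (v := v)
    (M := C + ‖(a : L2 d ℂ)‖ + ‖laplacian d ℂ a‖)
    (fun n => by
      have : ‖(v n : L2 d ℂ)‖ ≤ ‖(u (φ n) : L2 d ℂ)‖ + ‖(a : L2 d ℂ)‖ := norm_sub_le _ _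
      linarith [hC1 (φ n), norm_nonneg (laplacian d ℂ a)])
    (fun n => by
      have h1 : laplacian d ℂ (v n) = laplacian d ℂ (u (φ n)) - laplacian d ℂ a :=
        LinearPMap.map_sub _ _ _
      rw [h1]
      have := norm_sub_le (laplacian d ℂ (u (φ n))) (laplacian d ℂ a)
      linarith [hC2 (φ n), norm_nonneg (a : L2 d ℂ)])
    (fun y => by
      simp only [hv]
      exact weakly_tendsto_clm (besselInv d) hw y)
  refine ⟨scalarMultiplication X (Submodule.inclusion hD' a), φ, hφ, ?_⟩
  have h2 := key.add_const (scalarMultiplication X (Submodule.inclusion hD' a))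
  rw [zero_add] at h2
  refine h2.congr fun n => ?_
  rw [← LinearPMap.map_add, ← map_add]
  change scalarMultiplication X (Submodule.inclusion hD' (u (φ n) - a + a)) = _
  rw [sub_add_cancel]

end Decay

end

end MatrixSchrodinger

namespace MatrixSchrodinger

open MeasureTheory Filter Topology TemperedDistribution FourierTransform UnboundedOp
open scoped SchwartzMap Laplacian ENNReal ContDiff ComplexConjugate

noncomputable section

/-! ### Constant matrices acting on `L²` -/

section Matrices

variable {d : ℕ}

theorem matrixCLM_apply (M : Matrix (Fin 2) (Fin 2) ℂ) (v : C2) (i : Fin 2) :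
    matrixCLM M v i = M i 0 * v 0 + M i 1 * v 1 := by
  change (M.mulVec (WithLp.ofLp v)) i = _
  simp [Matrix.mulVec, dotProduct, Fin.sum_univ_two]

theorem matrixCLM_mul_apply (M N : Matrix (Fin 2) (Fin 2) ℂ) (v : C2) :
    matrixCLM (M * N) v = matrixCLM M (matrixCLM N v) := by
  unfold matrixCLM
  rw [map_mul]
  rfl

theorem matrixCLM_one_apply (v : C2) : matrixCLM 1 v = v := by
  unfold matrixCLM
  rw [map_one]
  rfl

theorem inner_matrixCLM {M : Matrix (Fin 2) (Fin 2) ℂ} (hM : M.conjTranspose = M) (v w : C2) :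
    inner ℂ (matrixCLM M v) w = inner ℂ v (matrixCLM M w) := by
  have h : star (matrixCLM M) = matrixCLM M := by
    unfold matrixCLM
    rw [← map_star, Matrix.star_eq_conjTranspose, hM]
  rw [← ContinuousLinearMap.adjoint_inner_right, ← ContinuousLinearMap.star_eq_adjoint, h]

/-- The operator on `L²(ℝ^d, ℂ²)` given by a constant matrix. -/
def matrixOp (d : ℕ) (M : Matrix (Fin 2) (Fin 2) ℂ) : L2 d C2 →L[ℂ] L2 d C2 :=
  (matrixCLM M).compLpL 2 volume

theorem coeFn_matrixOp (M : Matrix (Fin 2) (Fin 2) ℂ) (f : L2 d C2) :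
    matrixOp d M f =ᵐ[volume] fun x => matrixCLM M (f x) :=
  (matrixCLM M).coeFn_compLpL f

theorem matrixOp_mul_apply (M N : Matrix (Fin 2) (Fin 2) ℂ) (f : L2 d C2) :
    matrixOp d (M * N) f = matrixOp d M (matrixOp d N f) := by
  apply Lp.ext
  filter_upwards [coeFn_matrixOp (M * N) f, coeFn_matrixOp N f,
    coeFn_matrixOp M (matrixOp d N f)] with x h1 h2 h3
  rw [h1, h3, h2, matrixCLM_mul_apply]

theorem matrixOp_one_apply (f : L2 d C2) : matrixOp d 1 f = f := by
  apply Lp.ext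
  filter_upwards [coeFn_matrixOp 1 f] with x h1
  rw [h1, matrixCLM_one_apply]

theorem inner_matrixOp {M : Matrix (Fin 2) (Fin 2) ℂ} (hM : M.conjTranspose = M) (f g : L2 d C2) :
    inner ℂ (matrixOp d M f) g = inner ℂ f (matrixOp d M g) := by
  rw [L2.inner_def, L2.inner_def]
  refine integral_congr_ae ?_
  filter_upwards [coeFn_matrixOp M f, coeFn_matrixOp M g] with x h1 h2
  rw [h1, h2, inner_matrixCLM hM]

theorem fourier_matrixOp (M : Matrix (Fin 2) (Fin 2) ℂ) (f : L2 d C2) :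
    (𝓕 (matrixOp d M f) : L2 d C2) = matrixOp d M (𝓕 f : L2 d C2) := fourier_compLpL _ f

/-- The Pauli matrix `σ₃`. -/
def pauliZ : Matrix (Fin 2) (Fin 2) ℂ := !![1, 0; 0, -1]

/-- The Pauli matrix `σ₁`. -/
def pauliX : Matrix (Fin 2) (Fin 2) ℂ := !![0, 1; 1, 0]

theorem pauliZ_mul_self : pauliZ * pauliZ = 1 := by
  ext i j; fin_cases i <;> fin_cases j <;> simp [pauliZ]

theorem pauliX_mul_self : pauliX * pauliX = 1 := by
  ext i j; fin_cases i <;> fin_cases j <;> simp [pauliX]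

theorem pauliZ_conjTranspose : pauliZ.conjTranspose = pauliZ := by
  ext i j; fin_cases i <;> fin_cases j <;> simp [pauliZ]

theorem matrixOp_pauliZ_involutive (f : L2 d C2) :
    matrixOp d pauliZ (matrixOp d pauliZ f) = f := by
  rw [← matrixOp_mul_apply, pauliZ_mul_self, matrixOp_one_apply]

theorem matrixOp_pauliX_involutive (f : L2 d C2) :
    matrixOp d pauliX (matrixOp d pauliX f) = f := by
  rw [← matrixOp_mul_apply, pauliX_mul_self, matrixOp_one_apply]

theorem matrixCLM_pauliZ_pauliX (v : C2) :
    matrixCLM pauliZ (matrixCLM pauliX v) = -matrixCLM pauliX (matrixCLM pauliZ v) := by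
  ext i
  fin_cases i <;> simp [matrixCLM_apply, pauliZ, pauliX]

theorem matrixOp_pauliZ_pauliX (f : L2 d C2) :
    matrixOp d pauliZ (matrixOp d pauliX f) = -matrixOp d pauliX (matrixOp d pauliZ f) := by
  apply Lp.ext
  filter_upwards [coeFn_matrixOp pauliZ f, coeFn_matrixOp pauliX f,
    coeFn_matrixOp pauliZ (matrixOp d pauliX f), coeFn_matrixOp pauliX (matrixOp d pauliZ f),
    Lp.coeFn_neg (matrixOp d pauliX (matrixOp d pauliZ f))] with x h1 h2 h3 h4 h5
  rw [h3, h5, Pi.neg_apply, h4, h1, h2, matrixCLM_pauliZ_pauliX]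

end Matrices

/-! ### The free operator -/

section Free

variable {d : ℕ} {μ : ℝ}

theorem freeOp_apply (u : (laplacian d C2).domain) :
    freeOp d μ u = matrixOp d pauliZ (-laplacian d C2 u + (μ : ℂ) • (u : L2 d C2)) := rfl

theorem matrixOp_mem_domain (M : Matrix (Fin 2) (Fin 2) ℂ) {f : L2 d C2}
    (hf : f ∈ (laplacian d C2).domain) : matrixOp d M f ∈ (laplacian d C2).domain :=
  compLpL_mem_laplacian_domain _ hf

theorem laplacian_matrixOp (M : Matrix (Fin 2) (Fin 2) ℂ) (u : (laplacian d C2).domain) :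
    laplacian d C2 ⟨matrixOp d M u, matrixOp_mem_domain M u.2⟩ =
      matrixOp d M (laplacian d C2 u) := laplacian_compLpL _ u

theorem dense_laplacian_domain : Dense ((laplacian d C2).domain : Set (L2 d C2)) := by
  have h := SchwartzMap.denseRange_toLpCLM (E := Space d) (F := C2) (p := 2) (by norm_num)
    (μ := volume)
  refine Dense.mono ?_ h
  rintro _ ⟨u, rfl⟩
  exact schwartz_mem_domain u

theorem pauliZ_freeOp (u : (laplacian d C2).domain) :
    matrixOp d pauliZ (freeOp d μ u) = -laplacian d C2 u + (μ : ℂ) • (u : L2 d C2) := by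
  rw [freeOp_apply, matrixOp_pauliZ_involutive]

theorem inner_pauliZ_freeOp (u v : (laplacian d C2).domain) :
    inner ℂ (matrixOp d pauliZ (freeOp d μ u)) (v : L2 d C2) =
      inner ℂ (u : L2 d C2) (matrixOp d pauliZ (freeOp d μ v)) := by
  rw [pauliZ_freeOp, pauliZ_freeOp, inner_add_left, inner_add_right, inner_neg_left,
    inner_neg_right, inner_laplacian, inner_smul_left, inner_smul_right, Complex.conj_ofReal]

theorem freeOp_matrixOp_pauliZ (u : (laplacian d C2).domain) :
    freeOp d μ ⟨matrixOp d pauliZ u, matrixOp_mem_domain _ u.2⟩ =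
      matrixOp d pauliZ (freeOp d μ u) := by
  have := freeOp_apply (μ := μ) ⟨matrixOp d pauliZ (u : L2 d C2), matrixOp_mem_domain _ u.2⟩
  rw [laplacian_matrixOp] at this
  refine this.trans ?_
  rw [freeOp_apply, ← map_smul, ← map_neg, ← map_add]

/-- The free operator commutes with `σ₃`, so its symmetry follows from that of `-Δ + μ`. -/
theorem inner_freeOp (u v : (laplacian d C2).domain) :
    inner ℂ (freeOp d μ u) (v : L2 d C2) = inner ℂ (u : L2 d C2) (freeOp d μ v) := by
  have h := inner_pauliZ_freeOp (μ := μ) u ⟨matrixOp d pauliZ v, matrixOp_mem_domain _ v.2⟩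
  rw [inner_matrixOp pauliZ_conjTranspose] at h
  simp only at h
  rw [matrixOp_pauliZ_involutive] at h
  have h2 := congrArg (matrixOp d pauliZ) (freeOp_matrixOp_pauliZ (μ := μ) v)
  rw [matrixOp_pauliZ_involutive] at h2
  exact h.trans (congrArg (inner ℂ (u : L2 d C2)) h2)

theorem freeOp_matrixOp_pauliX (u : (laplacian d C2).domain) :
    freeOp d μ ⟨matrixOp d pauliX u, matrixOp_mem_domain _ u.2⟩ =
      -matrixOp d pauliX (freeOp d μ u) := by
  have := freeOp_apply (μ := μ) ⟨matrixOp d pauliX (u : L2 d C2), matrixOp_mem_domain _ u.2⟩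
  rw [laplacian_matrixOp] at this
  refine this.trans ?_
  rw [freeOp_apply, ← map_smul, ← map_neg, ← map_add, matrixOp_pauliZ_pauliX]

/-- The graph norm of the free operator controls that of the Laplacian, which transfers relative
compactness from `Δ` to the free operator. -/
theorem norm_laplacian_le (u : (laplacian d C2).domain) :
    ‖laplacian d C2 u‖ ≤ ‖matrixOp d pauliZ‖ * ‖freeOp d μ u‖ + |μ| * ‖(u : L2 d C2)‖ := by
  have h : laplacian d C2 u = (μ : ℂ) • (u : L2 d C2) - matrixOp d pauliZ (freeOp d μ u) := by
    rw [pauliZ_freeOp]; abel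
  rw [h]
  refine (norm_sub_le _ _).trans ?_
  rw [norm_smul, Complex.norm_real, Real.norm_eq_abs]
  linarith [(matrixOp d pauliZ).le_opNorm (freeOp d μ u)]

theorem fourier_freeOp (u : (laplacian d C2).domain) :
    (𝓕 (freeOp d μ u) : L2 d C2) =ᵐ[volume]
      fun ξ => ((symbol ξ + μ : ℝ) : ℂ) • matrixCLM pauliZ ((𝓕 (u : L2 d C2) : L2 d C2) ξ) := by
  have h0 : (𝓕 (freeOp d μ u) : L2 d C2) = matrixOp d pauliZ
      (-(𝓕 (laplacian d C2 u) : L2 d C2) + (μ : ℂ) • (𝓕 (u : L2 d C2) : L2 d C2)) := by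
    rw [freeOp_apply, fourier_matrixOp]
    congr 1
    change Lp.fourierTransformₗᵢ (Space d) C2 _ = -Lp.fourierTransformₗᵢ (Space d) C2 _ +
      (μ : ℂ) • Lp.fourierTransformₗᵢ (Space d) C2 _
    rw [map_add, map_neg, map_smul]
  rw [h0]
  filter_upwards [coeFn_matrixOp pauliZ
      (-(𝓕 (laplacian d C2 u) : L2 d C2) + (μ : ℂ) • (𝓕 (u : L2 d C2) : L2 d C2)),
    Lp.coeFn_add (-(𝓕 (laplacian d C2 u) : L2 d C2)) ((μ : ℂ) • (𝓕 (u : L2 d C2) : L2 d C2)),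
    Lp.coeFn_neg (𝓕 (laplacian d C2 u) : L2 d C2),
    Lp.coeFn_smul (μ : ℂ) (𝓕 (u : L2 d C2) : L2 d C2), fourier_laplacian u] with ξ h1 h2 h3 h4 h5
  rw [h1, h2, Pi.add_apply, h3, Pi.neg_apply, h4, Pi.smul_apply, h5, neg_smul, neg_neg, ← add_smul,
    map_smul]
  push_cast
  rfl

theorem fourier_shift_freeOp (z : ℂ) (u : (laplacian d C2).domain) :
    (𝓕 (shift (freeOp d μ) z u) : L2 d C2) =ᵐ[volume]
      fun ξ => ((symbol ξ + μ : ℝ) : ℂ) • matrixCLM pauliZ ((𝓕 (u : L2 d C2) : L2 d C2) ξ) -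
        z • (𝓕 (u : L2 d C2) : L2 d C2) ξ := by
  have h0 : (𝓕 (shift (freeOp d μ) z u) : L2 d C2) =
      (𝓕 (freeOp d μ u) : L2 d C2) - z • (𝓕 (u : L2 d C2) : L2 d C2) := by
    change Lp.fourierTransformₗᵢ (Space d) C2 (freeOp d μ u - z • (u : L2 d C2)) =
      Lp.fourierTransformₗᵢ (Space d) C2 _ - z • Lp.fourierTransformₗᵢ (Space d) C2 _
    rw [map_sub, map_smul]
  rw [h0]
  filter_upwards [Lp.coeFn_sub (𝓕 (freeOp d μ u) : L2 d C2) (z • (𝓕 (u : L2 d C2) : L2 d C2)),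
    Lp.coeFn_smul z (𝓕 (u : L2 d C2) : L2 d C2), fourier_freeOp (μ := μ) u] with ξ h1 h2 h3
  rw [h1, Pi.sub_apply, h2, Pi.smul_apply, h3]

end Free

end

end MatrixSchrodinger

namespace MatrixSchrodinger

open MeasureTheory Filter Topology TemperedDistribution FourierTransform UnboundedOp
open scoped SchwartzMap Laplacian ENNReal ContDiff ComplexConjugate

noncomputable section

/-! ### The spectrum of the free operator -/

section Gap

variable {μ : ℝ}

theorem ofReal_mem_gapComplement {t : ℝ} (ht : μ ≤ t) : (t : ℂ) ∈ gapComplement μ :=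
  ⟨t, Or.inr ht, rfl⟩

theorem neg_ofReal_mem_gapComplement {t : ℝ} (ht : μ ≤ t) : -(t : ℂ) ∈ gapComplement μ :=
  ⟨-t, Or.inl (neg_le_neg ht), by push_cast; rfl⟩

theorem isClosed_gapComplement : IsClosed (gapComplement μ) :=
  Complex.isometry_ofReal.isClosedEmbedding.isClosedMap _ (isClosed_Iic.union isClosed_Ici)

theorem mem_gapComplement_iff {z : ℂ} :
    z ∈ gapComplement μ ↔ ∃ t : ℝ, μ ≤ t ∧ (z = t ∨ z = -t) := by
  constructor
  · rintro ⟨t, ht | ht, rfl⟩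
    · exact ⟨-t, by linarith [show t ≤ -μ from ht], Or.inr (by push_cast; ring)⟩
    · exact ⟨t, ht, Or.inl rfl⟩
  · rintro ⟨t, ht, rfl | rfl⟩
    · exact ofReal_mem_gapComplement ht
    · exact neg_ofReal_mem_gapComplement ht

theorem conj_eq_of_mem_gapComplement {z : ℂ} (hz : z ∈ gapComplement μ) : conj z = z := by
  obtain ⟨t, -, rfl⟩ := hz
  exact Complex.conj_ofReal t

theorem ofReal_mul_I_notMem_gapComplement (hμ : 0 < μ) (y : ℝ) :
    (y : ℂ) * Complex.I ∉ gapComplement μ := by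
  rintro ⟨t, ht, h⟩
  have h1 := congrArg Complex.re h
  simp at h1
  subst h1
  rcases ht with ht | ht
  · exact absurd (show (0 : ℝ) ≤ -μ from ht) (by linarith)
  · exact absurd (show μ ≤ 0 from ht) (by linarith)

/-- The half-lines are stable under multiplication by factors at least one, so their complement is
star-shaped about `0`, which it contains because `μ > 0`. -/
theorem isPreconnected_gapComplement_compl (hμ : 0 < μ) : IsPreconnected (gapComplement μ)ᶜ := by
  have h : StarConvex ℝ (0 : ℂ) (gapComplement μ)ᶜ := by
    rw [starConvex_zero_iff]
    intro z hz a ha0 ha1 h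
    apply hz
    obtain ⟨t, ht, h⟩ := mem_gapComplement_iff.1 h
    have ha : 0 < a := by
      rcases ha0.eq_or_lt with rfl | h'
      · rw [zero_smul] at h
        have : (t : ℂ) = 0 := by
          rcases h with h | h
          · exact h.symm
          · exact neg_eq_zero.1 h.symm
        rw [Complex.ofReal_eq_zero] at this
        linarith
      · exact h'
    have ha' : (a : ℂ) ≠ 0 := Complex.ofReal_ne_zero.2 ha.ne'
    refine mem_gapComplement_iff.2 ⟨t / a, ?_, ?_⟩
    · rw [le_div_iff₀ ha]
      nlinarith
    · rw [Complex.real_smul] at h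
      push_cast
      refine h.imp (fun h => ?_) fun h => ?_
      · rw [← h]; field_simp
      · rw [← neg_div, ← h]; field_simp
  have h0 : (0 : ℂ) ∉ gapComplement μ := by simpa using ofReal_mul_I_notMem_gapComplement hμ 0
  exact (h.isPathConnected h0).isConnected.isPreconnected

/-- Outside `gapComplement μ`, `t ^ 2 - z ^ 2` is bounded below by a multiple of `t ^ 2`. -/
theorem exists_sq_le_norm (hμ : 0 < μ) {z : ℂ} (hz : z ∉ gapComplement μ) :
    ∃ K : ℝ, 0 < K ∧ ∀ t : ℝ, μ ≤ t → t ^ 2 ≤ K * ‖(t : ℂ) ^ 2 - z ^ 2‖ := by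
  obtain ⟨δ, hδ, hball⟩ := Metric.isOpen_iff.1 (isClosed_gapComplement (μ := μ)).isOpen_compl z hz
  have h1 : ∀ w ∈ gapComplement μ, δ ≤ ‖w - z‖ := by
    intro w hw
    by_contra h
    exact hball (by rw [mem_ball_iff_norm]; linarith) hw
  -- A positive distance `δ` from `z` to the closed set makes `‖z‖` at most `‖z‖ / δ * ‖w - z‖`.
  -- This is applied below to both factors of `t ^ 2 - z ^ 2`, with `w = t` and `w = -t`.
  have h2 : ∀ w ∈ gapComplement μ, ‖w‖ ≤ (1 + ‖z‖ / δ) * ‖w - z‖ := by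
    intro w hw
    have h3 : ‖w‖ ≤ ‖w - z‖ + ‖z‖ := by simpa using norm_add_le (w - z) z
    have h4 : ‖z‖ ≤ ‖z‖ / δ * ‖w - z‖ := by
      rw [div_mul_eq_mul_div, le_div_iff₀ hδ]
      exact mul_le_mul_of_nonneg_left (h1 w hw) (norm_nonneg z)
    linarith
  refine ⟨(1 + ‖z‖ / δ) ^ 2, by positivity, fun t ht => ?_⟩
  have ht0 : 0 ≤ t := hμ.le.trans ht
  have h3 := h2 _ (ofReal_mem_gapComplement ht)
  have h4 := h2 _ (neg_ofReal_mem_gapComplement ht)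
  rw [norm_neg] at h4
  rw [Complex.norm_real, Real.norm_of_nonneg ht0] at h3 h4
  have h5 : (t : ℂ) ^ 2 - z ^ 2 = -(((t : ℂ) - z) * (-(t : ℂ) - z)) := by ring
  rw [h5, norm_neg, norm_mul]
  calc t ^ 2 = t * t := sq t
    _ ≤ ((1 + ‖z‖ / δ) * ‖(t : ℂ) - z‖) * ((1 + ‖z‖ / δ) * ‖-(t : ℂ) - z‖) :=
        mul_le_mul h3 h4 ht0 (by positivity)
    _ = _ := by ring

end Gap

section FreeSpectrum

variable {d : ℕ} {μ : ℝ}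

/-- On the Fourier side the operator is `t σ₃` with `t = symbol + μ`, and `σ₃² = 1` gives the
inverse of `t σ₃ - z` as `(t σ₃ + z) / (t² - z²)`. The lower bound on `t² - z²` makes this bounded,
even after multiplication by the symbol, so that it maps into `H²`. -/
theorem mem_resolventSet_freeOp (hμ : 0 < μ) {z : ℂ} (hz : z ∉ gapComplement μ) :
    z ∈ resolventSet (freeOp d μ) := by
  obtain ⟨K, hK, hKt⟩ := exists_sq_le_norm hμ hz
  let t : Space d → ℝ := fun ξ => symbol ξ + μ
  have htμ : ∀ ξ, μ ≤ t ξ := fun ξ => le_add_of_nonneg_left (symbol_nonneg ξ)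
  have ht0 : ∀ ξ, 0 < t ξ := fun ξ => hμ.trans_le (htμ ξ)
  have htc : Continuous t := continuous_symbol.add continuous_const
  have hne : ∀ ξ, (t ξ : ℂ) ^ 2 - z ^ 2 ≠ 0 := by
    intro ξ h
    have := hKt _ (htμ ξ)
    rw [h, norm_zero, mul_zero] at this
    exact absurd this (not_le.2 (pow_pos (ht0 ξ) 2))
  let a₂ : Space d → ℂ := fun ξ => ((t ξ : ℂ) ^ 2 - z ^ 2)⁻¹
  have ha₂c : Continuous a₂ := by
    have : Continuous fun ξ => (t ξ : ℂ) ^ 2 - z ^ 2 := by fun_prop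
    exact this.inv₀ hne
  have hbd : ∀ ξ, t ξ ^ 2 * ‖a₂ ξ‖ ≤ K := by
    intro ξ
    rw [norm_inv, ← div_eq_mul_inv, div_le_iff₀ (norm_pos_iff.2 (hne ξ))]
    exact hKt _ (htμ ξ)
  -- Any continuous symbol of size `O(t²)` becomes bounded after division by `t² - z²`; all four
  -- multipliers below are of this kind.
  have hm : ∀ (k : Space d → ℂ), Continuous k → (∃ C : ℝ, ∀ ξ, ‖k ξ‖ ≤ C * t ξ ^ 2) →
      MemLp (fun ξ => k ξ * a₂ ξ) ∞ (volume : Measure (Space d)) := by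
    rintro k hk ⟨C, hC⟩
    have hC0 : 0 ≤ C := by
      have := (norm_nonneg _).trans (hC 0)
      exact nonneg_of_mul_nonneg_left this (pow_pos (ht0 0) 2)
    refine memLp_top_of_bound (hk.mul ha₂c).aestronglyMeasurable (C * K)
      (Eventually.of_forall fun ξ => ?_)
    rw [norm_mul]
    calc ‖k ξ‖ * ‖a₂ ξ‖ ≤ (C * t ξ ^ 2) * ‖a₂ ξ‖ :=
          mul_le_mul_of_nonneg_right (hC ξ) (norm_nonneg _)
      _ = C * (t ξ ^ 2 * ‖a₂ ξ‖) := by ring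
      _ ≤ C * K := mul_le_mul_of_nonneg_left (hbd ξ) hC0
  have hs : ∀ ξ, symbol ξ ≤ t ξ := fun ξ => le_add_of_nonneg_right hμ.le
  have hst : ∀ ξ, ‖(symbol ξ : ℂ)‖ ≤ t ξ := fun ξ => by
    rw [Complex.norm_real, Real.norm_of_nonneg (symbol_nonneg ξ)]; exact hs ξ
  have htn : ∀ ξ, ‖(t ξ : ℂ)‖ = t ξ := fun ξ => by
    rw [Complex.norm_real, Real.norm_of_nonneg (ht0 ξ).le]
  have hsc : Continuous fun ξ : Space d => (symbol ξ : ℂ) :=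
    Complex.continuous_ofReal.comp continuous_symbol
  have hμt : ∀ ξ, μ * t ξ ≤ t ξ ^ 2 := fun ξ => by nlinarith [htμ ξ, ht0 ξ]
  have htt : ∀ ξ, t ξ ≤ μ⁻¹ * t ξ ^ 2 := fun ξ => by
    rw [inv_mul_eq_div, le_div_iff₀ hμ]; linarith [hμt ξ]
  let a₁ : Space d → ℂ := fun ξ => (t ξ : ℂ) * a₂ ξ
  have ha₁ : MemLp a₁ ∞ (volume : Measure (Space d)) :=
    hm _ (by fun_prop) ⟨μ⁻¹, fun ξ => by rw [htn]; exact htt ξ⟩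
  have ha₂ : MemLp (fun ξ => z * a₂ ξ) ∞ (volume : Measure (Space d)) :=
    hm _ continuous_const ⟨‖z‖ * (μ⁻¹ ^ 2), fun ξ => by
      rw [mul_assoc, ← mul_pow]
      refine le_mul_of_one_le_right (norm_nonneg z) (one_le_pow₀ ?_)
      rw [inv_mul_eq_div, one_le_div hμ]
      exact htμ ξ⟩
  have hb₁ : MemLp (fun ξ => ((symbol ξ : ℂ) * t ξ) * a₂ ξ) ∞ (volume : Measure (Space d)) :=
    hm _ (by fun_prop) ⟨1, fun ξ => by
      rw [norm_mul, htn, one_mul, sq]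
      exact mul_le_mul_of_nonneg_right (hst ξ) (ht0 ξ).le⟩
  have hb₂ : MemLp (fun ξ => ((symbol ξ : ℂ) * z) * a₂ ξ) ∞ (volume : Measure (Space d)) :=
    hm _ (by fun_prop) ⟨‖z‖ * μ⁻¹, fun ξ => by
      rw [norm_mul, mul_comm, mul_assoc]
      exact mul_le_mul_of_nonneg_left ((hst ξ).trans (htt ξ)) (norm_nonneg z)⟩
  let B : L2 d C2 →L[ℂ] L2 d C2 := fourierMul ha₁ ∘L matrixOp d pauliZ + fourierMul ha₂
  have hB : ∀ f, (𝓕 (B f) : L2 d C2) =ᵐ[volume] fun ξ =>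
      a₂ ξ • ((t ξ : ℂ) • matrixCLM pauliZ ((𝓕 f : L2 d C2) ξ) + z • (𝓕 f : L2 d C2) ξ) := by
    intro f
    have h0 : (𝓕 (B f) : L2 d C2) =
        (𝓕 (fourierMul ha₁ (matrixOp d pauliZ f)) : L2 d C2) + (𝓕 (fourierMul ha₂ f) : L2 d C2) :=
      (Lp.fourierTransformₗᵢ (Space d) C2).map_add _ _
    rw [h0]
    have h3 := fourier_fourierMul ha₁ (matrixOp d pauliZ f)
    rw [fourier_matrixOp] at h3
    filter_upwards [h3, fourier_fourierMul ha₂ f, coeFn_matrixOp pauliZ (𝓕 f : L2 d C2),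
      Lp.coeFn_add (𝓕 (fourierMul ha₁ (matrixOp d pauliZ f)) : L2 d C2)
        (𝓕 (fourierMul ha₂ f) : L2 d C2)] with ξ h1 h2 h3 h4
    rw [h4, Pi.add_apply, h1, h2, h3]
    simp only [a₁]
    module
  have hBd : ∀ f, B f ∈ (laplacian d C2).domain := by
    intro f
    rw [mem_laplacian_domain_iff]
    have h1 := ((matrixCLM pauliZ).comp_memLp' (Lp.memLp (𝓕 f : L2 d C2))).smul hb₁ (r := 2)
    have h2 := (Lp.memLp (𝓕 f : L2 d C2)).smul hb₂ (r := 2)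
    refine (h1.add h2).ae_eq ?_
    filter_upwards [hB f] with ξ h
    rw [h]
    simp only [Pi.add_apply, Pi.smul_apply', Function.comp_apply]
    module
  have hsq : ∀ v : C2, matrixCLM pauliZ (matrixCLM pauliZ v) = v := fun v => by
    rw [← matrixCLM_mul_apply, pauliZ_mul_self, matrixCLM_one_apply]
  refine ⟨B, fun f => ⟨hBd f, ?_⟩, fun u' => ?_⟩
  · apply fourier_injective
    filter_upwards [fourier_shift_freeOp (μ := μ) z ⟨B f, hBd f⟩, hB f] with ξ h1 h2
    refine h1.trans ?_
    simp only [h2]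
    simp only [map_smul, map_add, hsq, smul_add, smul_smul]
    have h3 : ∀ v w : C2, ((t ξ : ℂ) * (a₂ ξ * t ξ)) • v + ((t ξ : ℂ) * (a₂ ξ * z)) • w -
        ((z * (a₂ ξ * t ξ)) • w + (z * (a₂ ξ * z)) • v) =
        (a₂ ξ * ((t ξ : ℂ) ^ 2 - z ^ 2)) • v := by
      intro v w
      module
    refine (h3 _ _).trans ?_
    rw [inv_mul_cancel₀ (hne ξ), one_smul]
  · obtain ⟨u, rfl⟩ : ∃ u : (laplacian d C2).domain, u = u' := ⟨u', rfl⟩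
    apply fourier_injective
    filter_upwards [fourier_shift_freeOp (μ := μ) z u, hB (shift (freeOp d μ) z u)] with ξ h1 h2
    refine h2.trans ?_
    rw [h1]
    simp only [map_sub, map_smul, hsq]
    have h3 : ∀ v w : C2, a₂ ξ • ((t ξ : ℂ) • ((t ξ : ℂ) • v - z • w) +
        z • ((t ξ : ℂ) • w - z • v)) = (a₂ ξ * ((t ξ : ℂ) ^ 2 - z ^ 2)) • v := by
      intro v w
      module
    refine (h3 _ _).trans ?_
    rw [inv_mul_cancel₀ (hne ξ), one_smul]

/-- The frequency shell `s + 1 / (n + 2) < symbol ξ < s + 1 / (n + 1)`. -/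
def shell (d : ℕ) (s : ℝ) (n : ℕ) : Set (Space d) :=
  symbol ⁻¹' Set.Ioo (s + 1 / ((n : ℝ) + 1 + 1)) (s + 1 / ((n : ℝ) + 1))

theorem isOpen_shell (s : ℝ) (n : ℕ) : IsOpen (shell d s n) := isOpen_Ioo.preimage continuous_symbol

theorem exists_symbol_eq (hd : 0 < d) {t : ℝ} (ht : 0 ≤ t) : ∃ ξ : Space d, symbol ξ = t := by
  refine ⟨EuclideanSpace.single ⟨0, hd⟩ (Real.sqrt t / (2 * Real.pi)), ?_⟩
  rw [symbol, PiLp.norm_single, Real.norm_eq_abs, sq_abs, div_pow, Real.sq_sqrt ht,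
    mul_div_cancel₀]
  positivity

theorem measure_shell_ne_zero (hd : 0 < d) {s : ℝ} (hs : 0 ≤ s) (n : ℕ) :
    volume (shell d s n) ≠ 0 := by
  have h : s + 1 / ((n : ℝ) + 1 + 1) < s + 1 / ((n : ℝ) + 1) := by gcongr; linarith
  obtain ⟨t, ht1, ht2⟩ := exists_between h
  have ht0 : 0 ≤ t := by
    have : 0 < 1 / ((n : ℝ) + 1 + 1) := by positivity
    linarith
  obtain ⟨ξ, hξ⟩ := exists_symbol_eq hd ht0
  refine ((isOpen_shell s n).measure_pos volume ⟨ξ, ?_⟩).ne'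
  rw [shell, Set.mem_preimage, hξ]
  exact ⟨ht1, ht2⟩

theorem measure_shell_ne_top (s : ℝ) (n : ℕ) : volume (shell d s n) ≠ ⊤ := by
  refine (Bornology.IsBounded.measure_lt_top ?_).ne
  refine (Metric.isBounded_closedBall (x := (0 : Space d)) (r := |s| + 2)).subset fun ξ hξ => ?_
  rw [mem_closedBall_zero_iff]
  have h1 : symbol ξ < s + 1 / ((n : ℝ) + 1) := hξ.2
  have h2 : 1 / ((n : ℝ) + 1) ≤ 1 := by
    rw [div_le_one (by positivity)]
    linarith [n.cast_nonneg (α := ℝ)]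
  have h3 : ‖ξ‖ ^ 2 ≤ symbol ξ := by
    unfold symbol
    refine le_mul_of_one_le_left (by positivity) (one_le_pow₀ ?_)
    linarith [Real.pi_gt_three]
  have h4 := le_abs_self s
  have h5 := abs_nonneg s
  nlinarith [norm_nonneg ξ]

theorem disjoint_shell (s : ℝ) {m n : ℕ} (h : m ≠ n) : Disjoint (shell d s m) (shell d s n) := by
  wlog hmn : m < n generalizing m n
  · exact (this h.symm (lt_of_le_of_ne (not_lt.1 hmn) h.symm)).symm
  rw [Set.disjoint_left]
  intro ξ h1 h2
  have h3 : s + 1 / ((m : ℝ) + 1 + 1) < symbol ξ := h1.1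
  have h4 : symbol ξ < s + 1 / ((n : ℝ) + 1) := h2.2
  have h5 : (m : ℝ) + 1 ≤ n := by exact_mod_cast hmn
  have h6 : 1 / ((n : ℝ) + 1) ≤ 1 / ((m : ℝ) + 1 + 1) := by gcongr
  linarith

/-- A singular sequence for the free operator at a point of `gapComplement μ`. -/
theorem exists_weyl_sequence (hd : 0 < d) {z : ℂ} (hz : z ∈ gapComplement μ) :
    ∃ u : ℕ → (freeOp d μ).domain, (∀ n, ‖(u n : L2 d C2)‖ = 1) ∧
      (∀ m n, m ≠ n → 1 ≤ ‖(u m : L2 d C2) - u n‖) ∧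
      Tendsto (fun n => shift (freeOp d μ) z (u n)) atTop (𝓝 0) := by
  -- A point of the half-lines is `σ (s + μ)` with `σ = ±1`, and `e` is the eigenvector of `σ₃` for
  -- `σ`; the excitation happens at symbol value `s`.
  obtain ⟨s, hs, σ, e, he, hσ, hev, hzs⟩ : ∃ s : ℝ, 0 ≤ s ∧ ∃ (σ : ℂ) (e : C2), ‖e‖ = 1 ∧
      ‖σ‖ = 1 ∧ matrixCLM pauliZ e = σ • e ∧ z = σ * ((s + μ : ℝ) : ℂ) := by
    obtain ⟨t, ht, h⟩ := mem_gapComplement_iff.1 hz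
    refine ⟨t - μ, sub_nonneg.2 ht, ?_⟩
    rw [sub_add_cancel]
    rcases h with h | h
    · refine ⟨1, EuclideanSpace.single 0 1, by simp, by simp, ?_, by rw [h, one_mul]⟩
      ext i
      fin_cases i <;> simp [matrixCLM_apply, pauliZ]
    · refine ⟨-1, EuclideanSpace.single 1 1, by simp, by simp, ?_, by rw [h, neg_one_mul]⟩
      ext i
      fin_cases i <;> simp [matrixCLM_apply, pauliZ]
  have hm : ∀ n, MeasurableSet (shell d s n) := fun n => (isOpen_shell s n).measurableSet
  let g : ℕ → L2 d C2 := fun n => indicatorConstLp 2 (hm n) (measure_shell_ne_top s n) e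
  have hg : ∀ n, (g n : Space d → C2) =ᵐ[volume] (shell d s n).indicator fun _ => e :=
    fun n => indicatorConstLp_coeFn
  have hg0 : ∀ n, 0 < ‖g n‖ := by
    intro n
    rw [norm_indicatorConstLp (by norm_num) (by norm_num), he, one_mul]
    exact Real.rpow_pos_of_pos (ENNReal.toReal_pos (measure_shell_ne_zero hd hs n)
      (measure_shell_ne_top s n)) _
  -- Normalized indicators of disjoint frequency shells are orthonormal; their mutual distance is
  -- `√2`, which is more than the required `1`.
  let f : ℕ → L2 d C2 := fun n =>
    (Lp.fourierTransformₗᵢ (Space d) C2).symm (((‖g n‖⁻¹ : ℝ) : ℂ) • g n)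
  have hfF : ∀ n, (𝓕 (f n) : L2 d C2) = ((‖g n‖⁻¹ : ℝ) : ℂ) • g n := fun n =>
    (Lp.fourierTransformₗᵢ (Space d) C2).apply_symm_apply _
  have hf : ∀ n, (𝓕 (f n) : L2 d C2) =ᵐ[volume]
      (shell d s n).indicator fun _ => ((‖g n‖⁻¹ : ℝ) : ℂ) • e := by
    intro n
    rw [hfF n]
    filter_upwards [hg n, Lp.coeFn_smul ((‖g n‖⁻¹ : ℝ) : ℂ) (g n)] with ξ h1 h2
    rw [h2, Pi.smul_apply, h1]
    by_cases h : ξ ∈ shell d s n <;> simp [h]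
  have hf1 : ∀ n, ‖f n‖ = 1 := by
    intro n
    rw [← Lp.norm_fourier_eq, hfF, norm_smul, Complex.norm_real,
      Real.norm_of_nonneg (inv_nonneg.2 (hg0 n).le), inv_mul_cancel₀ (hg0 n).ne']
  have hfd : ∀ n, f n ∈ (laplacian d C2).domain := by
    intro n
    rw [mem_laplacian_domain_iff]
    have hb : MemLp ((shell d s n).indicator fun ξ => (symbol ξ : ℂ)) ∞
        (volume : Measure (Space d)) := by
      refine memLp_top_of_bound (((Complex.continuous_ofReal.comp
        continuous_symbol).aestronglyMeasurable).indicator (hm n)) (s + 1 / ((n : ℝ) + 1))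
        (Eventually.of_forall fun ξ => ?_)
      by_cases h : ξ ∈ shell d s n
      · rw [Set.indicator_of_mem h, Complex.norm_real,
          Real.norm_of_nonneg (symbol_nonneg ξ)]
        exact h.2.le
      · rw [Set.indicator_of_notMem h, norm_zero]
        positivity
    refine ((Lp.memLp (𝓕 (f n) : L2 d C2)).smul hb (r := 2)).ae_eq ?_
    filter_upwards [hf n] with ξ h1
    rw [Pi.smul_apply', h1]
    by_cases h : ξ ∈ shell d s n <;> simp [h]
  have horth : ∀ m n, m ≠ n → inner ℂ (f m) (f n) = 0 := by
    intro m n hmn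
    rw [← Lp.inner_fourier_eq, L2.inner_def]
    refine integral_eq_zero_of_ae ?_
    filter_upwards [hf m, hf n] with ξ h1 h2
    rw [h1, h2]
    by_cases h : ξ ∈ shell d s m
    · rw [Set.indicator_of_notMem (Set.disjoint_left.1 (disjoint_shell s hmn) h), inner_zero_right]
      rfl
    · rw [Set.indicator_of_notMem h, inner_zero_left]
      rfl
  refine ⟨fun n => ⟨f n, hfd n⟩, hf1, fun m n hmn => ?_, ?_⟩
  · have h := norm_sub_sq (𝕜 := ℂ) (f m) (f n)
    rw [horth m n hmn, hf1, hf1] at h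
    norm_num at h
    have h2 : (1 : ℝ) ^ 2 ≤ ‖f m - f n‖ ^ 2 := by rw [h]; norm_num
    exact (pow_le_pow_iff_left₀ zero_le_one (norm_nonneg _) two_ne_zero).1 h2
  -- On the `n`-th shell the free operator minus `z` acts as `σ (symbol - s)`, of modulus at most `1
  -- / (n + 1)`.
  · refine squeeze_zero_norm (fun n => ?_) tendsto_one_div_add_atTop_nhds_zero_nat
    suffices h : ‖shift (freeOp d μ) z ⟨f n, hfd n⟩‖ ≤ 1 / ((n : ℝ) + 1) * ‖f n‖ by
      rwa [hf1, mul_one] at h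
    refine norm_le_of_fourier_le ?_
    filter_upwards [fourier_shift_freeOp (μ := μ) z ⟨f n, hfd n⟩, hf n] with ξ h1 h2
    refine (congrArg norm h1).trans_le ?_
    simp only [h2]
    by_cases h : ξ ∈ shell d s n
    · rw [Set.indicator_of_mem h, map_smul, hev, hzs]
      have h3 : ∀ (c : ℂ), ((symbol ξ + μ : ℝ) : ℂ) • c • σ • e -
          (σ * ((s + μ : ℝ) : ℂ)) • c • e = (σ * ((symbol ξ - s : ℝ) : ℂ)) • c • e := by
        intro c
        push_cast
        module
      rw [h3, norm_smul, norm_mul, hσ, one_mul, Complex.norm_real, Real.norm_eq_abs]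
      refine mul_le_mul_of_nonneg_right ?_ (norm_nonneg _)
      have h4 : s + 1 / ((n : ℝ) + 1 + 1) < symbol ξ := h.1
      have h5 : symbol ξ < s + 1 / ((n : ℝ) + 1) := h.2
      have h6 : 0 < 1 / ((n : ℝ) + 1 + 1) := by positivity
      rw [abs_le]
      constructor <;> linarith
    · rw [Set.indicator_of_notMem h]
      simp

/-- A bounded inverse would map the null sequence of a Weyl sequence back to unit vectors. -/
theorem spectrum_freeOp (hd : 0 < d) (hμ : 0 < μ) :
    UnboundedOp.spectrum (freeOp d μ) = gapComplement μ := by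
  ext z
  constructor
  · intro hz
    by_contra h
    exact hz (mem_resolventSet_freeOp hμ h)
  · rintro hz ⟨B, hB⟩
    obtain ⟨u, hu1, -, hu2⟩ := exists_weyl_sequence hd hz
    have h := ((B.continuous.tendsto 0).comp hu2).norm
    rw [map_zero, norm_zero] at h
    have h1 : ∀ n, ‖B (shift (freeOp d μ) z (u n))‖ = 1 := fun n =>
      (congrArg norm (hB.2 (u n))).trans (hu1 n)
    refine one_ne_zero (tendsto_nhds_unique ?_ h)
    exact tendsto_const_nhds.congr fun n => (h1 n).symm

end FreeSpectrum

end

end MatrixSchrodinger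

/-! ### Sums of relatively compact perturbations. -/

namespace UnboundedOp

open Filter Topology

variable {H : Type*} [NormedAddCommGroup H] [InnerProductSpace ℂ H]

theorem IsGraphCompact.add {T : H →ₗ.[ℂ] H} {V W : T.domain →ₗ[ℂ] H} (hV : IsGraphCompact T V)
    (hW : IsGraphCompact T W) : IsGraphCompact T (V + W) := by
  rintro u ⟨C, hC⟩
  obtain ⟨y, φ, hφ, hy⟩ := hV u ⟨C, hC⟩
  obtain ⟨y', ψ, hψ, hy'⟩ := hW (u ∘ φ) ⟨C, fun n => hC _⟩
  exact ⟨y + y', φ ∘ ψ, hφ.comp hψ, (hy.comp hψ.tendsto_atTop).add hy'⟩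

end UnboundedOp

namespace MatrixSchrodinger

open MeasureTheory Filter Topology TemperedDistribution FourierTransform UnboundedOp
open scoped SchwartzMap Laplacian ENNReal ContDiff ComplexConjugate

noncomputable section

/-! ### The matrix potential -/

section Potential

variable {d : ℕ} {μ : ℝ}

/-- The `j`-th component of an element of `H²(ℝ^d, ℂ²)`. -/
def component (j : Fin 2) : (laplacian d C2).domain →ₗ[ℂ] (laplacian d ℂ).domain :=
  ((EuclideanSpace.proj j : C2 →L[ℂ] ℂ).compLpL 2 volume).toLinearMap.restrict
    fun _ hf => compLpL_mem_laplacian_domain _ hf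

theorem laplacian_component (j : Fin 2) (u : (laplacian d C2).domain) :
    laplacian d ℂ (component j u) =
      (EuclideanSpace.proj j : C2 →L[ℂ] ℂ).compLpL 2 volume (laplacian d C2 u) :=
  laplacian_compLpL _ u

/-- The map `u ↦ (X u_j) v` on `H²(ℝ^d, ℂ²)`. -/
def entryMul {X : Space d → ℝ} (hX : (laplacian d ℂ).domain ≤ (scalarMultiplication X).domain)
    (v : C2) (j : Fin 2) : (laplacian d C2).domain →ₗ[ℂ] L2 d C2 :=
  ((ContinuousLinearMap.toSpanSingleton ℂ v).compLpL 2 volume).toLinearMap ∘ₗ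
    (scalarMultiplication X).toFun ∘ₗ Submodule.inclusion hX ∘ₗ component j

theorem coeFn_entryMul {X : Space d → ℝ}
    (hX : (laplacian d ℂ).domain ≤ (scalarMultiplication X).domain) (v : C2) (j : Fin 2)
    (u : (laplacian d C2).domain) :
    entryMul hX v j u =ᵐ[volume] fun x => ((X x : ℂ) * (u : L2 d C2) x j) • v := by
  filter_upwards [(ContinuousLinearMap.toSpanSingleton ℂ v).coeFn_compLpL
      (scalarMultiplication X (Submodule.inclusion hX (component j u))),
    coeFn_scalarMultiplication X (Submodule.inclusion hX (component j u)),
    (EuclideanSpace.proj j : C2 →L[ℂ] ℂ).coeFn_compLpL (u : L2 d C2)] with x h1 h2 h3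
  refine h1.trans ?_
  rw [h2, ContinuousLinearMap.toSpanSingleton_apply]
  congr 2

theorem LaplacianCompact.domain_le {X : Space d → ℝ} (hX : LaplacianCompact X) :
    (laplacian d ℂ).domain ≤ (scalarMultiplication X).domain := hX.1

theorem LaplacianCompact.isGraphCompact_entryMul {X : Space d → ℝ} (hX : LaplacianCompact X)
    (v : C2) (j : Fin 2) : IsGraphCompact (laplacian d C2) (entryMul hX.domain_le v j) := by
  rintro u ⟨C, hC⟩
  set P := (EuclideanSpace.proj j : C2 →L[ℂ] ℂ).compLpL 2 (volume : Measure (Space d)) with hP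
  have h1 : ∀ f : L2 d C2, ‖f‖ ≤ C → ‖P f‖ ≤ ‖P‖ * C := fun f hf =>
    (P.le_opNorm f).trans (mul_le_mul_of_nonneg_left hf (norm_nonneg _))
  obtain ⟨y, φ, hφ, hy⟩ := hX.2 (fun n => component j (u n)) ⟨‖P‖ * C, fun n =>
    ⟨h1 _ (hC n).1, by
      have h2 : ‖-laplacian d ℂ (component j (u n))‖ ≤ ‖P‖ * C := by
        rw [norm_neg, laplacian_component]
        exact h1 _ (hC n).2
      exact h2⟩⟩
  exact ⟨_, φ, hφ,
    (((ContinuousLinearMap.toSpanSingleton ℂ v).compLpL 2 volume).continuous.tendsto y).comp hy⟩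

variable {U W : Space d → ℝ}

/-- The matrix with rows `(U, W)` and `(-W, -U)` at the point `x`. -/
def potentialMatrix (U W : Space d → ℝ) (x : Space d) : Matrix (Fin 2) (Fin 2) ℂ :=
  !![(U x : ℂ), (W x : ℂ); -(W x : ℂ), -(U x : ℂ)]

/-- The potential as an operator on `H²(ℝ^d, ℂ²)`. -/
def potentialH2 (hU : LaplacianCompact U) (hW : LaplacianCompact W) :
    (laplacian d C2).domain →ₗ[ℂ] L2 d C2 :=
  entryMul hU.domain_le (EuclideanSpace.single 0 1) 0 +
    entryMul hW.domain_le (EuclideanSpace.single 0 1) 1 +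
    (entryMul hW.domain_le (EuclideanSpace.single 1 (-1)) 0 +
      entryMul hU.domain_le (EuclideanSpace.single 1 (-1)) 1)

theorem coeFn_potentialH2 (hU : LaplacianCompact U) (hW : LaplacianCompact W)
    (u : (laplacian d C2).domain) :
    potentialH2 hU hW u =ᵐ[volume] fun x => matrixCLM (potentialMatrix U W x) ((u : L2 d C2) x) := by
  set A := entryMul hU.domain_le (EuclideanSpace.single 0 1) 0 u with hA
  set B := entryMul hW.domain_le (EuclideanSpace.single 0 1) 1 u with hB
  set C := entryMul hW.domain_le (EuclideanSpace.single 1 (-1)) 0 u with hC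
  set D := entryMul hU.domain_le (EuclideanSpace.single 1 (-1)) 1 u with hD
  have h0 : potentialH2 hU hW u = A + B + (C + D) := rfl
  rw [h0]
  filter_upwards [coeFn_entryMul hU.domain_le (EuclideanSpace.single 0 1) 0 u,
    coeFn_entryMul hW.domain_le (EuclideanSpace.single 0 1) 1 u,
    coeFn_entryMul hW.domain_le (EuclideanSpace.single 1 (-1)) 0 u,
    coeFn_entryMul hU.domain_le (EuclideanSpace.single 1 (-1)) 1 u,
    Lp.coeFn_add A B, Lp.coeFn_add C D, Lp.coeFn_add (A + B) (C + D)] with x h1 h2 h3 h4 h5 h6 h7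
  rw [h7, Pi.add_apply, h5, h6, Pi.add_apply, Pi.add_apply, h1, h2, h3, h4]
  ext i
  fin_cases i <;> simp [matrixCLM_apply, potentialMatrix]

theorem laplacian_domain_le_potential_domain (hU : LaplacianCompact U) (hW : LaplacianCompact W) :
    (laplacian d C2).domain ≤ (potential U W).domain := fun f hf =>
  (Lp.memLp (potentialH2 hU hW ⟨f, hf⟩)).ae_eq (coeFn_potentialH2 hU hW ⟨f, hf⟩)

theorem potential_eq_potentialH2 (hU : LaplacianCompact U) (hW : LaplacianCompact W) {f : L2 d C2}
    (hf : f ∈ (laplacian d C2).domain) (hf' : f ∈ (potential U W).domain) :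
    potential U W ⟨f, hf'⟩ = potentialH2 hU hW ⟨f, hf⟩ := by
  apply Lp.ext
  exact (mem_multiplicationDomain _ ⟨f, hf'⟩).coeFn_toLp.trans (coeFn_potentialH2 hU hW ⟨f, hf⟩).symm

/-- The sum is defined on the intersection of the two domains, which is `H²` because `H²` lies in
the domain of the potential. In this form the abstract perturbation results apply. -/
theorem fullOp_eq_perturb (hU : LaplacianCompact U) (hW : LaplacianCompact W) :
    fullOp μ U W = perturb (freeOp d μ) (potentialH2 hU hW) := by
  refine LinearPMap.ext (inf_eq_left.2 (laplacian_domain_le_potential_domain hU hW)) ?_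
  intro f hf hf'
  have h : (fullOp μ U W) ⟨f, hf⟩ = freeOp d μ ⟨f, hf.1⟩ + potential U W ⟨f, hf.2⟩ := rfl
  rw [h, potential_eq_potentialH2 hU hW hf.1 hf.2]
  rfl

/-- Each of the four entries is compact relative to the Laplacian, and `norm_laplacian_le` bounds
the Laplacian by the free operator. -/
theorem isGraphCompact_potentialH2 (hU : LaplacianCompact U) (hW : LaplacianCompact W) :
    IsGraphCompact (freeOp d μ) (potentialH2 hU hW) := by
  have h : IsGraphCompact (laplacian d C2) (potentialH2 hU hW) :=
    ((hU.isGraphCompact_entryMul _ _).add (hW.isGraphCompact_entryMul _ _)).add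
      ((hW.isGraphCompact_entryMul _ _).add (hU.isGraphCompact_entryMul _ _))
  rintro u' ⟨C, hC⟩
  obtain ⟨u, rfl⟩ : ∃ u : ℕ → (laplacian d C2).domain, u = u' := ⟨u', rfl⟩
  have hC1 : ∀ n, ‖(u n : L2 d C2)‖ ≤ C := fun n => (hC n).1
  have hC2 : ∀ n, ‖freeOp d μ (u n)‖ ≤ C := fun n => (hC n).2
  refine h u ⟨max C (‖matrixOp d pauliZ‖ * C + |μ| * C), fun n => ⟨(hC1 n).trans (le_max_left _ _),
    (norm_laplacian_le (μ := μ) (u n)).trans (le_trans ?_ (le_max_right _ _))⟩⟩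
  exact add_le_add (mul_le_mul_of_nonneg_left (hC2 n) (norm_nonneg _))
    (mul_le_mul_of_nonneg_left (hC1 n) (abs_nonneg _))

/-- The product is the real symmetric matrix with rows `(U, W)` and `(W, U)`. This makes `σ₃` times
the full operator symmetric although the operator itself need not be. -/
theorem pauliZ_mul_potentialMatrix_conjTranspose (x : Space d) :
    (pauliZ * potentialMatrix U W x).conjTranspose = pauliZ * potentialMatrix U W x := by
  ext i j
  fin_cases i <;> fin_cases j <;>
    simp [pauliZ, potentialMatrix, Matrix.mul_apply, Fin.sum_univ_two]

theorem potentialMatrix_pauliX (x : Space d) (v : C2) :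
    matrixCLM (potentialMatrix U W x) (matrixCLM pauliX v) =
      -matrixCLM pauliX (matrixCLM (potentialMatrix U W x) v) := by
  ext i
  fin_cases i <;> simp [matrixCLM_apply, pauliX, potentialMatrix, add_comm]

theorem inner_pauliZ_potentialH2 (hU : LaplacianCompact U) (hW : LaplacianCompact W)
    (u v : (laplacian d C2).domain) :
    inner ℂ (matrixOp d pauliZ (potentialH2 hU hW u)) (v : L2 d C2) =
      inner ℂ (u : L2 d C2) (matrixOp d pauliZ (potentialH2 hU hW v)) := by
  rw [L2.inner_def, L2.inner_def]
  refine integral_congr_ae ?_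
  filter_upwards [coeFn_matrixOp pauliZ (potentialH2 hU hW u),
    coeFn_matrixOp pauliZ (potentialH2 hU hW v), coeFn_potentialH2 hU hW u,
    coeFn_potentialH2 hU hW v] with x h1 h2 h3 h4
  rw [h1, h2, h3, h4, ← matrixCLM_mul_apply, ← matrixCLM_mul_apply,
    inner_matrixCLM (pauliZ_mul_potentialMatrix_conjTranspose x)]

theorem potentialH2_pauliX (hU : LaplacianCompact U) (hW : LaplacianCompact W)
    (u : (laplacian d C2).domain) :
    potentialH2 hU hW ⟨matrixOp d pauliX u, matrixOp_mem_domain _ u.2⟩ =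
      -matrixOp d pauliX (potentialH2 hU hW u) := by
  apply Lp.ext
  filter_upwards [coeFn_potentialH2 hU hW ⟨matrixOp d pauliX u, matrixOp_mem_domain _ u.2⟩,
    coeFn_matrixOp pauliX (u : L2 d C2), coeFn_matrixOp pauliX (potentialH2 hU hW u),
    Lp.coeFn_neg (matrixOp d pauliX (potentialH2 hU hW u)), coeFn_potentialH2 hU hW u]
    with x h1 h2 h3 h4 h5
  rw [h1, h4, Pi.neg_apply, h3, h5]
  simp only [h2]
  exact potentialMatrix_pauliX x _

end Potential

end

end MatrixSchrodinger

namespace MatrixSchrodinger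

open MeasureTheory Filter Topology UnboundedOp
open scoped ComplexConjugate

noncomputable section

/-! ### The full operator -/

section Full

variable {d : ℕ} {μ : ℝ} {U W : Space d → ℝ}

theorem inner_pauliZ_fullOp (hU : LaplacianCompact U) (hW : LaplacianCompact W)
    (u v : (perturb (freeOp d μ) (potentialH2 hU hW)).domain) :
    inner ℂ (matrixOp d pauliZ (perturb (freeOp d μ) (potentialH2 hU hW) u)) (v : L2 d C2) =
      inner ℂ (u : L2 d C2) (matrixOp d pauliZ (perturb (freeOp d μ) (potentialH2 hU hW) v)) := by
  obtain ⟨u', rfl⟩ : ∃ u' : (laplacian d C2).domain, u' = u := ⟨u, rfl⟩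
  obtain ⟨v', rfl⟩ : ∃ v' : (laplacian d C2).domain, v' = v := ⟨v, rfl⟩
  change inner ℂ (matrixOp d pauliZ (freeOp d μ u' + potentialH2 hU hW u')) (v' : L2 d C2) =
    inner ℂ (u' : L2 d C2) (matrixOp d pauliZ (freeOp d μ v' + potentialH2 hU hW v'))
  rw [map_add, map_add, inner_add_left, inner_add_right, inner_pauliZ_freeOp,
    inner_pauliZ_potentialH2]

/-- Both the free operator and the potential anticommute with `σ₁`, so conjugation by `σ₁` changes
the sign of the full operator. -/
theorem neg_mem_resolventSet_fullOp (hU : LaplacianCompact U) (hW : LaplacianCompact W) {z : ℂ}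
    (hz : z ∈ resolventSet (perturb (freeOp d μ) (potentialH2 hU hW))) :
    -z ∈ resolventSet (perturb (freeOp d μ) (potentialH2 hU hW)) := by
  rw [← neg_one_mul]
  have hdom : ∀ u : (perturb (freeOp d μ) (potentialH2 hU hW)).domain,
      matrixOp d pauliX (u : L2 d C2) ∈ (perturb (freeOp d μ) (potentialH2 hU hW)).domain :=
    fun u => matrixOp_mem_domain (f := (u : L2 d C2)) pauliX u.2
  refine mem_resolventSet_of_conj (J := matrixOp d pauliX) (c := -1) matrixOp_pauliX_involutive
    (by norm_num) (fun u => ⟨hdom u, ?_⟩) hdom hz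
  obtain ⟨u', rfl⟩ : ∃ u' : (laplacian d C2).domain, u' = u := ⟨u, rfl⟩
  have h1 := freeOp_matrixOp_pauliX (μ := μ) u'
  have h2 := potentialH2_pauliX hU hW u'
  refine (congrArg₂ (· + ·) h1 h2).trans ?_
  change -matrixOp d pauliX (freeOp d μ u') + -matrixOp d pauliX (potentialH2 hU hW u') =
    (-1 : ℂ) • matrixOp d pauliX (freeOp d μ u' + potentialH2 hU hW u')
  rw [map_add, neg_one_smul, neg_add]

/-- One resolvent point serves three purposes: it makes the operator closed, it starts the
connectedness argument, and it identifies the adjoint. -/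
theorem exists_mem_resolventSet_fullOp (hμ : 0 < μ) (hU : LaplacianCompact U)
    (hW : LaplacianCompact W) :
    ∃ y : ℝ, (y * Complex.I : ℂ) ∈ resolventSet (perturb (freeOp d μ) (potentialH2 hU hW)) := by
  obtain ⟨y, -, hy⟩ := (isGraphCompact_potentialH2 (μ := μ) hU hW).exists_mem_resolventSet
    dense_laplacian_domain inner_freeOp
    fun y _ => mem_resolventSet_freeOp hμ (ofReal_mul_I_notMem_gapComplement hμ y)
  exact ⟨y, hy⟩

theorem isFredholmPoint_fullOp (hμ : 0 < μ) (hU : LaplacianCompact U) (hW : LaplacianCompact W)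
    {z : ℂ} (hz : z ∉ gapComplement μ) :
    IsFredholmPoint (perturb (freeOp d μ) (potentialH2 hU hW)) z :=
  (isGraphCompact_potentialH2 hU hW).isFredholmPoint (mem_resolventSet_freeOp hμ hz)

theorem isClosed_shift_fullOp (hμ : 0 < μ) (hU : LaplacianCompact U) (hW : LaplacianCompact W)
    (z : ℂ) : (shift (perturb (freeOp d μ) (potentialH2 hU hW)) z).IsClosed := by
  obtain ⟨y, hy⟩ := exists_mem_resolventSet_fullOp hμ hU hW
  exact isClosed_shift_of_mem_resolventSet hy z

theorem eventually_mem_resolventSet_fullOp (hμ : 0 < μ) (hU : LaplacianCompact U)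
    (hW : LaplacianCompact W) {z : ℂ} (hz : z ∉ gapComplement μ) :
    ∀ᶠ w in 𝓝[≠] z, w ∈ resolventSet (perturb (freeOp d μ) (potentialH2 hU hW)) := by
  obtain ⟨y, hy⟩ := exists_mem_resolventSet_fullOp hμ hU hW
  exact eventually_mem_resolventSet_of_isPreconnected (isPreconnected_gapComplement_compl hμ)
    (fun w hw => isFredholmPoint_fullOp hμ hU hW hw) (ofReal_mul_I_notMem_gapComplement hμ y) hy hz

theorem mem_Delta5_fullOp (hμ : 0 < μ) (hU : LaplacianCompact U) (hW : LaplacianCompact W)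
    {z : ℂ} (hz : z ∉ gapComplement μ) :
    z ∈ Delta5 (perturb (freeOp d μ) (potentialH2 hU hW)) :=
  ⟨(isGraphCompact_potentialH2 hU hW).mem_Delta4 (mem_resolventSet_freeOp hμ hz)
    (isClosed_shift_fullOp hμ hU hW z), eventually_mem_resolventSet_fullOp hμ hU hW hz⟩

/-- The Weyl sequence excludes a finite-dimensional kernel, and since `z` is real, `σ₃` carries this
over to the cokernel. -/
theorem notMem_Delta1_fullOp (hd : 0 < d) (hU : LaplacianCompact U) (hW : LaplacianCompact W)
    {z : ℂ} (hz : z ∈ gapComplement μ) :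
    z ∉ Delta1 (perturb (freeOp d μ) (potentialH2 hU hW)) := by
  rintro ⟨hcl, hr, h⟩
  obtain ⟨u, hu1, hu2, hu3⟩ := exists_weyl_sequence hd hz
  refine (isGraphCompact_potentialH2 hU hW).not_isClosed_range hu1 hu2 hu3 hcl hr ?_
  rcases h with h | h
  · exact h
  · exact finiteDimensional_kernel_of_coker matrixOp_pauliZ_involutive
      (inner_matrixOp pauliZ_conjTranspose) (inner_pauliZ_fullOp hU hW)
      (conj_eq_of_mem_gapComplement hz) h

/-- The sets `Delta1`, ..., `Delta5` decrease, so it suffices that the smallest contains the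
complement of the half-lines and the largest avoids the half-lines. -/
theorem essentialSpectrum_fullOp (hd : 0 < d) (hμ : 0 < μ) (hU : LaplacianCompact U)
    (hW : LaplacianCompact W) (j : Fin 5) :
    essentialSpectrum (perturb (freeOp d μ) (potentialH2 hU hW)) j = gapComplement μ := by
  set T := perturb (freeOp d μ) (potentialH2 hU hW) with hT
  have h54 : Delta5 T ⊆ Delta4 T := fun z hz => hz.1
  have h43 : Delta4 T ⊆ Delta3 T := fun z hz => hz.1
  have h32 : Delta3 T ⊆ Delta2 T := fun z hz =>
    ⟨⟨hz.1, hz.2.1, Or.inl hz.2.2.1⟩, hz.2.2.1⟩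
  have h21 : Delta2 T ⊆ Delta1 T := fun z hz => hz.1
  have h5 : (gapComplement μ)ᶜ ⊆ Delta5 T := fun z hz => mem_Delta5_fullOp hμ hU hW hz
  have h1 : Delta1 T ⊆ (gapComplement μ)ᶜ := fun z hz hz' => notMem_Delta1_fullOp hd hU hW hz' hz
  have key : ∀ D : Set ℂ, Delta5 T ⊆ D → D ⊆ Delta1 T → Dᶜ = gapComplement μ := by
    intro D hD hD'
    rw [(h1.trans' hD').antisymm (h5.trans hD), compl_compl]
  fin_cases j
  · exact key (Delta1 T) (h54.trans (h43.trans (h32.trans h21))) subset_rfl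
  · exact key (Delta2 T) (h54.trans (h43.trans h32)) h21
  · exact key (Delta3 T) (h54.trans h43) (h32.trans h21)
  · exact key (Delta4 T) h54 (h43.trans (h32.trans h21))
  · exact key (Delta5 T) subset_rfl (h54.trans (h43.trans (h32.trans h21)))

theorem hasFiniteAlgebraicMultiplicity_fullOp (hμ : 0 < μ) (hU : LaplacianCompact U)
    (hW : LaplacianCompact W) {z : ℂ} (hz : z ∉ gapComplement μ) :
    HasFiniteAlgebraicMultiplicity (perturb (freeOp d μ) (potentialH2 hU hW)) z :=
  (isFredholmPoint_fullOp hμ hU hW hz).hasFiniteAlgebraicMultiplicity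
    (eventually_mem_resolventSet_fullOp hμ hU hW hz) (mem_Delta5_fullOp hμ hU hW hz).1.1.2.2.1

theorem neg_mem_spectrum_fullOp (hU : LaplacianCompact U) (hW : LaplacianCompact W) {z : ℂ}
    (hz : z ∈ UnboundedOp.spectrum (perturb (freeOp d μ) (potentialH2 hU hW))) :
    -z ∈ UnboundedOp.spectrum (perturb (freeOp d μ) (potentialH2 hU hW)) := fun h =>
  hz (neg_neg z ▸ neg_mem_resolventSet_fullOp hU hW h)

/-- Points of the half-lines are real. Elsewhere the spectrum consists of eigenvalues, to which the
symmetry of `σ₃ H` applies. -/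
theorem conj_mem_spectrum_fullOp (hμ : 0 < μ) (hU : LaplacianCompact U) (hW : LaplacianCompact W)
    {z : ℂ} (hz : z ∈ UnboundedOp.spectrum (perturb (freeOp d μ) (potentialH2 hU hW))) :
    conj z ∈ UnboundedOp.spectrum (perturb (freeOp d μ) (potentialH2 hU hW)) := by
  by_cases h : z ∈ gapComplement μ
  · rwa [conj_eq_of_mem_gapComplement h]
  · exact ((isFredholmPoint_fullOp hμ hU hW h).isEigenvalue hz).conj_notMem_resolventSet
      matrixOp_pauliZ_involutive (inner_matrixOp pauliZ_conjTranspose) (inner_pauliZ_fullOp hU hW)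

open scoped LinearPMap in
theorem spectrum_adjoint_fullOp (hμ : 0 < μ) (hU : LaplacianCompact U) (hW : LaplacianCompact W) :
    UnboundedOp.spectrum (perturb (freeOp d μ) (potentialH2 hU hW))† =
      UnboundedOp.spectrum (perturb (freeOp d μ) (potentialH2 hU hW)) := by
  obtain ⟨y, hy⟩ := exists_mem_resolventSet_fullOp hμ hU hW
  refine spectrum_adjoint_eq dense_laplacian_domain matrixOp_pauliZ_involutive
    (inner_matrixOp pauliZ_conjTranspose) (inner_pauliZ_fullOp hU hW) hy ?_
  -- The resolvent point is purely imaginary, so its conjugate is its negative, already covered by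
  -- the `σ₁` symmetry.
  have h := neg_mem_resolventSet_fullOp hU hW hy
  rwa [← mul_neg, ← Complex.conj_I, ← Complex.conj_ofReal y, ← map_mul] at h

end Full

end

end MatrixSchrodinger

/-! ### The main theorem. -/

open MatrixSchrodinger UnboundedOp MeasureTheory Filter Topology in
open scoped Pointwise LinearPMap ComplexConjugate in
theorem theorem1 (d : ℕ) (hd : 0 < d) (μ : ℝ) (hμ : 0 < μ) :
    (∀ X : Space d → ℝ, AEStronglyMeasurable X volume →
      LaplacianBoundedZero X → DecaysAtInfinity X → LaplacianCompact X) ∧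
    ∀ U W : Space d → ℝ, AEStronglyMeasurable U volume → AEStronglyMeasurable W volume →
      LaplacianCompact U → LaplacianCompact W →
      UnboundedOp.spectrum (freeOp d μ) = gapComplement μ ∧
      (∀ j : Fin 5, essentialSpectrum (fullOp μ U W) j = gapComplement μ) ∧
      (∀ z ∉ gapComplement μ, ∀ᶠ w in 𝓝[≠] z, w ∉ UnboundedOp.spectrum (fullOp μ U W)) ∧
      (∀ z ∈ UnboundedOp.spectrum (fullOp μ U W) \ gapComplement μ,
        IsEigenvalue (fullOp μ U W) z ∧ HasFiniteAlgebraicMultiplicity (fullOp μ U W) z) ∧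
      UnboundedOp.spectrum (fullOp μ U W) = -UnboundedOp.spectrum (fullOp μ U W) ∧
      UnboundedOp.spectrum (fullOp μ U W)† = UnboundedOp.spectrum (fullOp μ U W) ∧
      (∀ z ∈ UnboundedOp.spectrum (fullOp μ U W),
        conj z ∈ UnboundedOp.spectrum (fullOp μ U W) ∧
        -conj z ∈ UnboundedOp.spectrum (fullOp μ U W)) := by
  refine ⟨fun X hX hb hdecay => laplacianCompact_of_decaysAtInfinity hX hb hdecay,
    fun U W _ _ hU hW => ?_⟩
  rw [fullOp_eq_perturb hU hW]
  refine ⟨spectrum_freeOp hd hμ, essentialSpectrum_fullOp hd hμ hU hW, fun z hz => ?_,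
    fun z hz => ⟨(isFredholmPoint_fullOp hμ hU hW hz.2).isEigenvalue hz.1,
      hasFiniteAlgebraicMultiplicity_fullOp hμ hU hW hz.2⟩, ?_, spectrum_adjoint_fullOp hμ hU hW,
    fun z hz => ⟨conj_mem_spectrum_fullOp hμ hU hW hz,
      neg_mem_spectrum_fullOp hU hW (conj_mem_spectrum_fullOp hμ hU hW hz)⟩⟩
  · filter_upwards [eventually_mem_resolventSet_fullOp hμ hU hW hz] with w hw h
    exact h hw
  · ext z
    exact ⟨fun h => neg_mem_spectrum_fullOp hU hW h,
      fun h => neg_neg z ▸ neg_mem_spectrum_fullOp hU hW h⟩
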